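/- Let $A>0$, and let $\mathfrak X$ denote either the space of smooth vector fields on $\mathbb R^2$ with compact support or the space of rapidly decreasing (Schwartz) vector fields on $\mathbb R^2$. For $n\ge 1$ put $$H^n(X,Y)=\sum_{i,j\ge 0,\ i+j\le n}\frac{A^{i+j}\,n!}{i!\,j!\,(n-i-j)!}\int_{\mathbb R^2}\langle\partial_1^i\partial_2^jX,\partial_1^i\partial_2^jY\rangle\,dx=\int_{\mathbb R^2}\langle(1-A\Delta)^nX,Y\rangle\,dx ,\qquad X,Y\in\mathfrak X .$$ The right invariant metric on $\mathrm{Diff}(\mathbb R^2)$ defined by $H^n$ induces a quotient metric $G^{\mathrm{diff},n}$ on the space $B_e=\mathrm{Emb}(S^1,\mathbb R^2)/\mathrm{Diff}(S^1)$ of embedded closed curves: if $c$ parametrizes the curve $C$, $n_c$ is its unit normal, and $h$ is a vector field along $c$ (representing a tangent vector to $B_e$ at $C$ modulo fields tangent to $C$), then $$G^{\mathrm{diff},n}_C(h,h)=\inf\{H^n(X,X): X\in\mathfrak X,\ \langle X(c(\theta)),n_c(\theta)\rangle=\langle h(\theta),n_c(\theta)\rangle\text{ for all }\theta\}.$$ The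 geodesic of concentric circles is the family $c(t,\theta)=r(t)e^{i\theta}$, $r(t)>0$, parametrized with constant speed, $G^{\mathrm{diff},n}(c_t,c_t)=\sigma^2$, where $\sigma>0$. (a) If $n\ge 2$, this geodesic is complete: for every $R>0$ the families of circles of radius $r\in(0,R]$ and $r\in[R,\infty)$ both have infinite $G^{\mathrm{diff},n}$-length, and for every initial radius $r(0)=r_0>0$ and every speed $\sigma>0$ there is a constant speed parametrization $r(t)$ defined for all $t\in\mathbb R$, with $r(t)\to 0$ as $t\to-\infty$ and $r(t)\to\infty$ as $t\to\infty$. (b) If $n=1$, it is incomplete as $r\to 0$ and complete as $r\to\infty$: for every $R>0$ the family $r\in(0,R]$ has finite length and the family $r\in[R,\infty)$ has infinite length; for every $r_0,\sigma>0$ there are a finite $T>0$ and a parametrization with speed $\sigma$ and $r(0)=r_0$ which is defined on $(-T,\infty)$, with $r(t)\to 0$ as $t\downarrow -T$ and $r(t)\to\infty$ as $t\to\infty$; and no parametrization with constant speed $\sigma$ is defined for all $t\in\mathbb R$. Moreover, for every $r>0$, the metric at the circle of radius $r$ on the radial tangent vector $r_t e^{i\theta}$, $r_t\in\mathbb R$,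 is $$G^{\mathrm{diff},1}(r_te^{i\theta},r_te^{i\theta})=\frac{2\pi A\,r_t^2}{I_1(r/\sqrt A)\,K_1(r/\sqrt A)},$$ where $I_1$ and $K_1$ are the modified Bessel functions of order one. -/

import Mathlib

open Real Set Filter Topology MeasureTheory
open scoped ENNReal ContDiff SchwartzMap

noncomputable section

namespace DiffMetric

/-- The Euclidean plane. -/
abbrev Plane : Type := EuclideanSpace ℝ (Fin 2)

/-- The two standard choices for the Lie algebra of `Diff(ℝ²)`: smooth vector fields of compact
support, or rapidly decreasing smooth vector fields. -/
inductive FieldClass : Type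
  | compactSupport : FieldClass
  | rapidlyDecreasing : FieldClass

/-- The set of vector fields on the plane which belongs to a choice of the Lie algebra. -/
def FieldClass.fields : FieldClass → Set (Plane → Plane)
  | FieldClass.compactSupport => {X | ContDiff ℝ ∞ X ∧ HasCompactSupport X}
  | FieldClass.rapidlyDecreasing => {X | ∃ S : 𝓢(Plane, Plane), ∀ x, X x = S x}

/-- The partial derivative in the `k`-th coordinate direction. -/
def partialD (k : Fin 2) (X : Plane → Plane) : Plane → Plane :=
  fun x => fderiv ℝ X x (EuclideanSpace.single k 1)

/-- The Sobolev inner product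
`Hⁿ(X, Y) = ∑_{i + j ≤ n} A^(i+j) n! / (i! j! (n-i-j)!) ∫ ⟨∂₁ⁱ ∂₂ʲ X, ∂₁ⁱ ∂₂ʲ Y⟩ dx`,
which is the inner product `∫ ⟨(1 - A Δ)ⁿ X, Y⟩ dx`. -/
def sobolevInner (A : ℝ) (n : ℕ) (X Y : Plane → Plane) : ℝ :=
  ∑ i ∈ Finset.range (n + 1), ∑ j ∈ Finset.range (n + 1 - i),
    A ^ (i + j) * ((n.factorial : ℝ) / (i.factorial * j.factorial * (n - i - j).factorial)) *
      ∫ x, inner ℝ ((partialD 0)^[i] ((partialD 1)^[j] X) x)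
        ((partialD 0)^[i] ((partialD 1)^[j] Y) x)

/-- Rotation by 90 degrees. -/
def rotJ (v : Plane) : Plane := !₂[-(v 1), v 0]

/-- The unit normal `n = J v`, where `v = c_θ / |c_θ|`, of a parametrized curve. -/
def unitNormal (c : ℝ → Plane) (θ : ℝ) : Plane :=
  ‖deriv c θ‖⁻¹ • rotJ (deriv c θ)

/-- The squared length `G_C(h, h)` of the tangent vector to the space `B_e` of unparametrized
embedded curves which the vector field `h` along `c` represents, `C` being the image of the
closed curve `c` (a periodic function of `θ`).

The metric is the quotient, along `φ ↦ φ(C₀)`, of the right invariant metric on `Diff(ℝ²)` which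
is given by `sobolevInner` on the Lie algebra. By right invariance, the vectors above `h` are the
vector fields `X` in the Lie algebra whose restriction to `c` is `h` modulo fields tangent to `c`,
that is, has the same normal component as `h`; the quotient (semi)norm is the infimum of their
norms. Values are in `[0, ∞]`, so that an infimum over no field at all is `∞`. -/
def quotientMetric (𝔛 : FieldClass) (A : ℝ) (n : ℕ) (c h : ℝ → Plane) : ℝ≥0∞ :=
  ⨅ X ∈ {X | X ∈ 𝔛.fields ∧
      ∀ θ, inner ℝ (X (c θ)) (unitNormal c θ) = inner ℝ (h θ) (unitNormal c θ)},
    ENNReal.ofReal (sobolevInner A n X X)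

/-- The squared speed `G(c_t, c_t)` at time `t` of the path `t ↦ c t` of curves `θ ↦ c t θ`. -/
def speedSq (𝔛 : FieldClass) (A : ℝ) (n : ℕ) (c : ℝ → ℝ → Plane) (t : ℝ) : ℝ≥0∞ :=
  quotientMetric 𝔛 A n (c t) (fun θ => deriv (fun s => c s θ) t)

/-- The length `∫ √(G(c_t, c_t)) dt` over `t ∈ I` of the path `t ↦ c t`. -/
def pathLength (𝔛 : FieldClass) (A : ℝ) (n : ℕ) (c : ℝ → ℝ → Plane) (I : Set ℝ) : ℝ≥0∞ :=
  ∫⁻ t in I, (speedSq 𝔛 A n c t) ^ (1 / 2 : ℝ)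

/-- The circle of radius `r` around the origin, `θ ↦ r e^{iθ}`. -/
def circleCurve (r : ℝ) : ℝ → Plane := fun θ => !₂[r * cos θ, r * sin θ]

/-- `t ↦ r(t) e^{iθ}`, for `t ∈ I`, is the geodesic of concentric circles with speed `σ`:
the radius is positive and differentiable and `G(c_t, c_t) = σ²`. -/
def IsCircleGeodesic (𝔛 : FieldClass) (A : ℝ) (n : ℕ) (σ : ℝ) (I : Set ℝ) (r : ℝ → ℝ) : Prop :=
  ∀ t ∈ I, 0 < r t ∧ DifferentiableAt ℝ r t ∧
    speedSq 𝔛 A n (fun s => circleCurve (r s)) t = ENNReal.ofReal (σ ^ 2)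

/-- The modified Bessel function `I_m` of the first kind, of integer order. -/
def besselI (m : ℕ) (z : ℝ) : ℝ :=
  ∑' k : ℕ, (z / 2) ^ (2 * k + m) / ((k.factorial : ℝ) * ((k + m).factorial : ℝ))

/-- The modified Bessel function `K_m` of the second kind, of integer order, for `z > 0`. -/
def besselK (m : ℕ) (z : ℝ) : ℝ :=
  ∫ t in Ioi (0 : ℝ), exp (-z * cosh t) * cosh (m * t)

end DiffMetric

end

open DiffMetric

/-! On a circle of radius `r` the constraint fixes the radial component of `X`. The squared length
of `v e^{iθ}` is therefore `v² g_n(r)`, where `g_n(r)` (`circleMetric`) is the least energy of a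
field with radial component 1 there. The speed along concentric circles is `√g_n`, and every claim
about lengths and constant speed parametrizations is a claim about the primitive `W` of `√g_n`
(`arcLength`): whether it is bounded below at `0` and unbounded at `∞`.

The value of `g_1` comes from matching bounds. For the lower bound (`besselMetric_le_sobolevInner`),
the energy of `X` on each circle dominates `u² + A (u'² + (u/ρ)²)`, where `u` is the circle integral
of the radial component (`radialMean_energy_le`). Completing the square with a solution of the
Riccati equation (`picone_le`), built from `I₀/I₁` inside and `-K₀/K₁` outside, leaves only boundary
terms. Those at `0` and `∞` vanish, and the jump at `r` is evaluated by the Wronskian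
(`bessel_wronskian`). For the upper bound, the minimizer is the radial field with profile `I₁`
inside and `K₁` outside. It has a corner at `r` and no compact support, so it is smoothed and cut
off; the energies converge by dominated convergence (`tendsto_sobolevInner_cutoff`).

Dilations of the plane compare `g_n` at different radii (`circleMetric_le_dilate`). This yields
continuity of `g_n` and shows that `g_1` is nondecreasing. Since `g_1 ≤ g_n` and `g_1 > 0`, the
speed is bounded below towards `∞`, so the length there is infinite for all `n ≥ 1`; for `n = 1` the
speed is bounded above towards `0`, so the length there is finite. No Bessel asymptotics at infinity
are needed for this.

For `n ≥ 2` it suffices to bound `g_2` from below near `0`. Second derivatives control the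
divergence together with its gradient in `L²`. In the plane this just fails to bound the divergence,
at the cost of a logarithm: the mean radial component is `O(r √(log (1/r)))` times the square root
of the energy (`sq_le_of_divergence_bound`). Prescribing it to be constant forces `√g_2 ≥ c / (r (2
+ log (2/r)))`, whose integral at `0` diverges like `log log (1/r)` (`tendsto_arcLength_zero`). -/

noncomputable section

namespace DiffMetric

/-! ### Power series of the modified Bessel functions `I_m` -/

/-- The entire function `∑ uᵏ / (k! (k+m)!)`, with `I_m(z) = (z/2)^m besselSeries m (z²/4)`. -/
def besselSeries (m : ℕ) (u : ℝ) : ℝ :=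
  ∑' k : ℕ, u ^ k / ((k.factorial : ℝ) * ((k + m).factorial : ℝ))

theorem summable_besselSeries (m : ℕ) (u : ℝ) :
    Summable fun k : ℕ => u ^ k / ((k.factorial : ℝ) * ((k + m).factorial : ℝ)) := by
  refine Summable.of_norm_bounded (Real.summable_pow_div_factorial |u|) fun k => ?_
  rw [Real.norm_eq_abs, abs_div, abs_pow,
    abs_of_pos (show (0 : ℝ) < (k.factorial : ℝ) * ((k + m).factorial : ℝ) by positivity)]
  have h1 : (1 : ℝ) ≤ ((k + m).factorial : ℝ) := by exact_mod_cast Nat.factorial_pos _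
  have h2 : (0 : ℝ) < (k.factorial : ℝ) := by exact_mod_cast Nat.factorial_pos _
  exact div_le_div_of_nonneg_left (by positivity) h2 (le_mul_of_one_le_right h2.le h1)

/-- Termwise differentiation: the factor `k` cancels against `k!`, and reindexing raises `m` by one.
Smoothness of the series follows by iteration. -/
theorem hasDerivAt_besselSeries (m : ℕ) (u : ℝ) :
    HasDerivAt (besselSeries m) (besselSeries (m + 1) u) u := by
  set R := |u| + 1
  have key : HasDerivAt (fun y => ∑' k : ℕ, y ^ k / ((k.factorial : ℝ) * ((k + m).factorial : ℝ)))
      (∑' k : ℕ, (k : ℝ) * u ^ (k - 1) / ((k.factorial : ℝ) * ((k + m).factorial : ℝ))) u := by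
    refine hasDerivAt_tsum_of_isPreconnected
      (g := fun (k : ℕ) (y : ℝ) => y ^ k / ((k.factorial : ℝ) * ((k + m).factorial : ℝ)))
      (g' := fun (k : ℕ) (y : ℝ) =>
        (k : ℝ) * y ^ (k - 1) / ((k.factorial : ℝ) * ((k + m).factorial : ℝ)))
      (u := fun k : ℕ => (k : ℝ) * R ^ (k - 1) / (k.factorial : ℝ)) (t := Metric.ball 0 R) (y₀ := u)
      ?_ Metric.isOpen_ball (convex_ball _ _).isPreconnected (fun k y _ => ?_) (fun k y hy => ?_)
      ?_ (summable_besselSeries m u) ?_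
    · refine (summable_nat_add_iff 1).1 ?_
      refine (Real.summable_pow_div_factorial R).congr fun k => ?_
      rw [Nat.factorial_succ]
      push_cast
      field_simp
    · exact (hasDerivAt_pow k y).div_const _
    · rw [Real.norm_eq_abs, abs_div, abs_mul, abs_pow, Nat.abs_cast,
        abs_of_pos (show (0 : ℝ) < (k.factorial : ℝ) * ((k + m).factorial : ℝ) by positivity)]
      have hy' : |y| ≤ R := by simpa using (mem_ball_zero_iff.1 hy).le
      have : (1 : ℝ) ≤ ((k + m).factorial : ℝ) := by exact_mod_cast Nat.factorial_pos _
      have h2 : (0 : ℝ) < (k.factorial : ℝ) := by exact_mod_cast Nat.factorial_pos _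
      gcongr
      exact le_mul_of_one_le_right h2.le this
    · simp [R]
    · simp [R]
  refine key.congr_deriv (Eq.symm ?_)
  rw [besselSeries, ← Summable.sum_add_tsum_nat_add 1 (f := fun k : ℕ =>
    (k : ℝ) * u ^ (k - 1) / ((k.factorial : ℝ) * ((k + m).factorial : ℝ)))]
  · simp only [Finset.range_one, Finset.sum_singleton, Nat.cast_zero, zero_mul, zero_div, zero_add]
    refine tsum_congr fun k => ?_
    rw [Nat.factorial_succ, show k + 1 + m = k + (m + 1) by ring]
    push_cast
    field_simp
  · refine (summable_nat_add_iff 1).1 ?_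
    refine (summable_besselSeries (m + 1) u).congr fun k => ?_
    rw [Nat.factorial_succ, show k + 1 + m = k + (m + 1) by ring]
    push_cast
    field_simp

theorem contDiff_besselSeries (m : ℕ) : ContDiff ℝ ∞ (besselSeries m) := by
  rw [contDiff_infty]
  intro n
  induction n generalizing m with
  | zero => exact contDiff_zero.2 (continuous_iff_continuousAt.2 fun u =>
      (hasDerivAt_besselSeries m u).continuousAt)
  | succ n ih =>
    push_cast
    rw [contDiff_succ_iff_deriv]
    refine ⟨fun u => (hasDerivAt_besselSeries m u).differentiableAt, by simp, ?_⟩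
    rw [show deriv (besselSeries m) = besselSeries (m + 1) from
      funext fun u => (hasDerivAt_besselSeries m u).deriv]
    exact ih (m + 1)

theorem besselSeries_recurrence (m : ℕ) (u : ℝ) :
    u * besselSeries (m + 2) u + (m + 1) * besselSeries (m + 1) u = besselSeries m u := by
  have h2 := (summable_besselSeries (m + 2) u).hasSum.mul_left u
  have h1 := (summable_besselSeries (m + 1) u).hasSum.mul_left ((m : ℝ) + 1)
  have h0 := (summable_besselSeries m u).hasSum
  have h0' := h0
  -- The factor `u` shifts the first series by one degree, so the constant terms of the other two
  -- are split off before coefficients are compared.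
  rw [← hasSum_nat_add_iff' 1] at h0 h1
  have h3 := h2.add h1
  have := h3.unique (h0.congr_fun ?_)
  · simp only [Finset.range_one, Finset.sum_singleton] at this
    simp only [besselSeries]
    have e : ((m : ℝ) + 1) * (u ^ 0 / ((Nat.factorial 0 : ℝ) * ((0 + (m + 1)).factorial : ℝ))) =
        u ^ 0 / ((Nat.factorial 0 : ℝ) * ((0 + m).factorial : ℝ)) := by
      simp only [zero_add, Nat.factorial_succ]; push_cast; field_simp
    linarith
  · intro k
    rw [show k + (m + 2) = (k + m + 1) + 1 by ring, show k + 1 + (m + 1) = (k + m + 1) + 1 by ring,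
      show k + 1 + m = k + m + 1 by ring, Nat.factorial_succ (k + m + 1), Nat.factorial_succ k]
    push_cast
    field_simp
    ring

theorem besselI_eq (m : ℕ) (z : ℝ) :
    besselI m z = (z / 2) ^ m * besselSeries m (z ^ 2 / 4) := by
  rw [besselI, besselSeries, ← tsum_mul_left]
  refine tsum_congr fun k => ?_
  rw [pow_add, pow_mul, div_pow]
  norm_num
  ring

theorem besselSeries_pos (m : ℕ) {u : ℝ} (hu : 0 ≤ u) : 0 < besselSeries m u :=
  (summable_besselSeries m u).tsum_pos (fun k => by positivity) 0 (by positivity)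

theorem besselI_pos (m : ℕ) {z : ℝ} (hz : 0 < z) : 0 < besselI m z := by
  rw [besselI_eq]
  have := besselSeries_pos m (show 0 ≤ z ^ 2 / 4 by positivity)
  positivity

theorem hasDerivAt_besselI_zero (z : ℝ) : HasDerivAt (besselI 0) (besselI 1 z) z := by
  have h : besselI 0 = fun z => besselSeries 0 (z ^ 2 / 4) := by
    ext z; simp [besselI_eq]
  rw [h]
  refine ((hasDerivAt_besselSeries 0 (z ^ 2 / 4)).comp z
    ((hasDerivAt_pow 2 z).div_const 4)).congr_deriv ?_
  rw [besselI_eq]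
  norm_num
  ring

theorem hasDerivAt_besselI_one {z : ℝ} (hz : z ≠ 0) :
    HasDerivAt (besselI 1) (besselI 0 z - besselI 1 z / z) z := by
  have h : besselI 1 = fun z => z / 2 * besselSeries 1 (z ^ 2 / 4) := by
    ext z; simp [besselI_eq]
  rw [h]
  refine (((hasDerivAt_id z).div_const 2).mul
    ((hasDerivAt_besselSeries 1 (z ^ 2 / 4)).comp z
      ((hasDerivAt_pow 2 z).div_const 4))).congr_deriv ?_
  have := besselSeries_recurrence 0 (z ^ 2 / 4)
  rw [besselI_eq]
  norm_num [h] at this ⊢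
  field_simp
  linear_combination (8 : ℝ) * this

/-! ### The functions `K_0`, `K_1` as moments of `cosh`, and the Wronskian -/

/-- The integrals `∫₀^∞ cosh^m t exp (-z cosh t) dt`. -/
def coshMoment (m : ℕ) (z : ℝ) : ℝ :=
  ∫ t in Ioi (0 : ℝ), cosh t ^ m * exp (-z * cosh t)

theorem besselK_zero : besselK 0 = coshMoment 0 := by
  ext z; simp [besselK, coshMoment]

theorem besselK_one : besselK 1 = coshMoment 1 := by
  ext z; simp [besselK, coshMoment, mul_comm]

theorem le_cosh (t : ℝ) : t ≤ cosh t := by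
  rcases le_total t 0 with h | h
  · exact h.trans (cosh_pos t).le
  · exact (Real.self_le_sinh_iff.2 h).trans (sinh_lt_cosh t).le

/-- Half of the exponent absorbs the power through `x^m / m! ≤ exp x`; the other half decays
exponentially because `t ≤ cosh t`. -/
theorem integrableOn_coshMoment (m : ℕ) {z : ℝ} (hz : 0 < z) :
    IntegrableOn (fun t => cosh t ^ m * exp (-z * cosh t)) (Ioi 0) := by
  have hb : IntegrableOn (fun t => (m.factorial : ℝ) * (2 / z) ^ m * exp (-(z / 2) * t)) (Ioi 0) :=
    (integrableOn_exp_mul_Ioi (by linarith) 0).const_mul _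
  refine Integrable.mono' hb (by fun_prop) (Eventually.of_forall fun t => ?_)
  rw [Real.norm_eq_abs, abs_of_pos (by have := cosh_pos t; positivity)]
  have h1 : (z / 2 * cosh t) ^ m / m.factorial ≤ exp (z / 2 * cosh t) :=
    Real.pow_div_factorial_le_exp _ (by have := cosh_pos t; positivity) m
  have h2 : exp (-z * cosh t) = exp (-(z / 2 * cosh t)) * exp (-(z / 2 * cosh t)) := by
    rw [← exp_add]; ring_nf
  have h3 : exp (-(z / 2 * cosh t)) ≤ exp (-(z / 2) * t) := by
    apply exp_le_exp.2; nlinarith [le_cosh t]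
  have h4 : cosh t ^ m ≤ m.factorial * (2 / z) ^ m * exp (z / 2 * cosh t) := by
    rw [div_le_iff₀ (by positivity), mul_pow] at h1
    calc cosh t ^ m = (2 / z) ^ m * ((z / 2) ^ m * cosh t ^ m) := by
          rw [← mul_assoc, ← mul_pow]; field_simp; simp
      _ ≤ (2 / z) ^ m * (exp (z / 2 * cosh t) * m.factorial) := by gcongr
      _ = _ := by ring
  calc cosh t ^ m * exp (-z * cosh t)
      ≤ (m.factorial * (2 / z) ^ m * exp (z / 2 * cosh t)) *
        (exp (-(z / 2 * cosh t)) * exp (-(z / 2 * cosh t))) := by rw [h2]; gcongr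
    _ = m.factorial * (2 / z) ^ m * exp (-(z / 2 * cosh t)) *
        (exp (z / 2 * cosh t) * exp (-(z / 2 * cosh t))) := by ring
    _ = m.factorial * (2 / z) ^ m * exp (-(z / 2 * cosh t)) := by
        rw [← exp_add, add_neg_cancel, exp_zero, mul_one]
    _ ≤ _ := by gcongr

theorem coshMoment_pos (m : ℕ) {z : ℝ} (hz : 0 < z) : 0 < coshMoment m z := by
  rw [coshMoment, setIntegral_pos_iff_support_of_nonneg_ae]
  · have : (Function.support fun t => cosh t ^ m * exp (-z * cosh t)) = univ := by
      ext t; simp [(cosh_pos t).ne', exp_ne_zero]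
    rw [this]; simp
  · exact Eventually.of_forall fun t => by have := cosh_pos t; positivity
  · exact integrableOn_coshMoment m hz

theorem hasDerivAt_coshMoment (m : ℕ) {z : ℝ} (hz : 0 < z) :
    HasDerivAt (coshMoment m) (-coshMoment (m + 1) z) z := by
  have key := hasDerivAt_integral_of_dominated_loc_of_deriv_le (μ := volume.restrict (Ioi (0 : ℝ)))
    (F := fun z t => cosh t ^ m * exp (-z * cosh t))
    (F' := fun z t => -(cosh t ^ (m + 1) * exp (-z * cosh t)))
    -- On the neighbourhood `y > z/2` of `z` the integrand at `z/2` dominates uniformly.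
    (bound := fun t => cosh t ^ (m + 1) * exp (-(z / 2) * cosh t)) (s := Ioi (z / 2)) (x₀ := z)
    (Ioi_mem_nhds (by linarith)) (Eventually.of_forall fun y => by fun_prop)
    (integrableOn_coshMoment m hz) (by fun_prop)
    (Eventually.of_forall fun t y hy => ?_) (integrableOn_coshMoment (m + 1) (by linarith))
    (Eventually.of_forall fun t y _ => ?_)
  · exact key.2.congr_deriv (by simp only [coshMoment]; rw [integral_neg])
  · have := cosh_pos t
    rw [norm_neg, Real.norm_eq_abs, abs_of_pos (by positivity)]
    have : y > z / 2 := hy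
    gcongr
  · refine ((((hasDerivAt_id y).neg.mul_const (cosh t)).exp).const_mul (cosh t ^ m)).congr_deriv ?_
    simp only [Pi.neg_apply, id]
    ring

theorem contDiffOn_coshMoment (m : ℕ) : ContDiffOn ℝ ∞ (coshMoment m) (Ioi 0) := by
  rw [contDiffOn_infty]
  intro n
  induction n generalizing m with
  | zero => exact contDiffOn_zero.2 fun z hz =>
      (hasDerivAt_coshMoment m hz).continuousAt.continuousWithinAt
  | succ n ih =>
    push_cast
    rw [contDiffOn_succ_iff_deriv_of_isOpen isOpen_Ioi]
    refine ⟨fun z hz => (hasDerivAt_coshMoment m hz).differentiableAt.differentiableWithinAt,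
      by simp, ?_⟩
    exact (ih (m + 1)).neg.congr fun z hz => (hasDerivAt_coshMoment m hz).deriv

theorem tendsto_exp_neg_mul_cosh {z : ℝ} (hz : 0 < z) (m : ℕ) :
    Tendsto (fun t => cosh t ^ m * exp (-z * cosh t)) atTop (𝓝 0) := by
  have h := (Real.tendsto_pow_mul_exp_neg_atTop_nhds_zero m).comp
    ((tendsto_atTop_mono le_cosh tendsto_id).const_mul_atTop hz)
  have := h.const_mul ((1 / z) ^ m)
  rw [mul_zero] at this
  refine this.congr fun t => ?_
  simp only [Function.comp]
  rw [mul_pow, ← mul_assoc, ← mul_assoc, ← mul_pow]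
  field_simp
  simp

/-- Integrate the derivative of `sinh t * exp (-z cosh t)`, which vanishes at both ends, and replace
`sinh²` by `cosh² - 1`. This is Bessel's equation for `K_0`. -/
theorem coshMoment_recurrence {z : ℝ} (hz : 0 < z) :
    coshMoment 2 z = coshMoment 0 z + coshMoment 1 z / z := by
  have hd : ∀ t ∈ Ici (0 : ℝ), HasDerivAt (fun t => sinh t * exp (-z * cosh t))
      (cosh t ^ 1 * exp (-z * cosh t) - z * (cosh t ^ 2 * exp (-z * cosh t)) +
        z * (cosh t ^ 0 * exp (-z * cosh t))) t := fun t _ => by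
    refine ((hasDerivAt_sinh t).mul (((hasDerivAt_cosh t).const_mul (-z)).exp)).congr_deriv ?_
    have := cosh_sq t
    linear_combination (z * exp (-z * cosh t)) * this
  have hi : ∀ m, Integrable (fun t => cosh t ^ m * exp (-z * cosh t)) (volume.restrict (Ioi 0)) :=
    fun m => integrableOn_coshMoment m hz
  have hlim : Tendsto (fun t => sinh t * exp (-z * cosh t)) atTop (𝓝 0) := by
    refine squeeze_zero_norm' ?_ (tendsto_exp_neg_mul_cosh hz 1)
    filter_upwards [eventually_ge_atTop 0] with t ht
    rw [Real.norm_eq_abs, abs_of_nonneg (by have := sinh_nonneg_iff.2 ht; positivity), pow_one]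
    have := (sinh_lt_cosh t).le
    gcongr
  have := integral_Ioi_of_hasDerivAt_of_tendsto' hd
    (((hi 1).sub ((hi 2).const_mul z)).add ((hi 0).const_mul z)) hlim
  rw [integral_add (f := fun t => cosh t ^ 1 * exp (-z * cosh t) -
      z * (cosh t ^ 2 * exp (-z * cosh t))) ((hi 1).sub ((hi 2).const_mul z)) ((hi 0).const_mul z),
    integral_sub (hi 1) ((hi 2).const_mul z), integral_const_mul, integral_const_mul] at this
  simp only [sinh_zero, zero_mul, sub_zero] at this
  have e : z * coshMoment 2 z = z * coshMoment 0 z + coshMoment 1 z := by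
    simp only [coshMoment]; linarith
  field_simp
  linarith

theorem besselK_zero_pos {z : ℝ} (hz : 0 < z) : 0 < besselK 0 z := by
  rw [besselK_zero]; exact coshMoment_pos 0 hz

theorem besselK_one_pos {z : ℝ} (hz : 0 < z) : 0 < besselK 1 z := by
  rw [besselK_one]; exact coshMoment_pos 1 hz

theorem hasDerivAt_besselK_zero {z : ℝ} (hz : 0 < z) :
    HasDerivAt (besselK 0) (-besselK 1 z) z := by
  rw [besselK_zero, besselK_one]; exact hasDerivAt_coshMoment 0 hz

theorem hasDerivAt_besselK_one {z : ℝ} (hz : 0 < z) :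
    HasDerivAt (besselK 1) (-besselK 0 z - besselK 1 z / z) z := by
  rw [besselK_zero, besselK_one]
  refine (hasDerivAt_coshMoment 1 hz).congr_deriv ?_
  rw [coshMoment_recurrence hz]; ring

theorem coshMoment_mono {z : ℝ} (hz : 0 < z) : coshMoment 0 z ≤ coshMoment 1 z := by
  refine setIntegral_mono (integrableOn_coshMoment 0 hz) (integrableOn_coshMoment 1 hz) fun t => ?_
  have := one_le_cosh t
  simp only [pow_zero, pow_one]
  gcongr

theorem besselK_zero_le_one {z : ℝ} (hz : 0 < z) : besselK 0 z ≤ besselK 1 z := by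
  rw [besselK_zero, besselK_one]; exact coshMoment_mono hz

/-- The extra factor `exp (-(z - z₀) cosh t)` is at most `exp (-(z - z₀))` because `cosh t ≥ 1`. It
gives the decay of the outer profile below. -/
theorem coshMoment_le_exp (m : ℕ) {z₀ z : ℝ} (h₀ : 0 < z₀) (h : z₀ ≤ z) :
    coshMoment m z ≤ coshMoment m z₀ * exp (-(z - z₀)) := by
  rw [coshMoment, coshMoment, ← integral_mul_const]
  refine setIntegral_mono (integrableOn_coshMoment m (h₀.trans_le h))
    ((integrableOn_coshMoment m h₀).mul_const _) fun t => ?_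
  have := cosh_pos t
  simp only
  rw [mul_assoc, ← exp_add]
  gcongr
  nlinarith [one_le_cosh t]

/-- Split `cosh t = sinh t + exp (-t)`: the first part integrates exactly to `exp (-z) / z`, and the
second lies between 0 and 1. Hence `z K₁(z) → 1` at the origin. -/
theorem mul_besselK_one_mem {z : ℝ} (hz : 0 < z) :
    exp (-z) ≤ z * besselK 1 z ∧ z * besselK 1 z ≤ exp (-z) + z := by
  have hd : ∀ t ∈ Ici (0 : ℝ), HasDerivAt (fun t => -exp (-z * cosh t))
      (z * (sinh t * exp (-z * cosh t))) t := fun t _ => by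
    refine (((hasDerivAt_cosh t).const_mul (-z)).exp).neg.congr_deriv ?_
    ring
  have hi1 := integrableOn_coshMoment 1 hz
  have hs : IntegrableOn (fun t => sinh t * exp (-z * cosh t)) (Ioi 0) := by
    refine Integrable.mono' hi1 (by fun_prop) ?_
    filter_upwards [ae_restrict_mem measurableSet_Ioi] with t ht
    rw [Real.norm_eq_abs, abs_of_nonneg (by have := sinh_nonneg_iff.2 ht.le; positivity), pow_one]
    have := (sinh_lt_cosh t).le
    gcongr
  have hlim : Tendsto (fun t => -exp (-z * cosh t)) atTop (𝓝 0) := by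
    simpa using (tendsto_exp_neg_mul_cosh hz 0).neg
  have hI := integral_Ioi_of_hasDerivAt_of_tendsto' hd (hs.const_mul z) hlim
  simp only [cosh_zero, mul_one, sub_neg_eq_add, zero_add] at hI
  have hdiff : z * besselK 1 z = exp (-z) + z * ∫ t in Ioi (0 : ℝ), exp (-t) * exp (-z * cosh t) := by
    rw [← hI, besselK_one, coshMoment, integral_const_mul, ← mul_add, ← integral_add hs]
    · congr 1
      refine integral_congr_ae (Eventually.of_forall fun t => ?_)
      simp only [pow_one]
      rw [← cosh_sub_sinh]; ring
    · refine (hi1.sub hs).congr (Eventually.of_forall fun t => ?_)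
      simp only [pow_one, Pi.sub_apply]
      rw [← cosh_sub_sinh]; ring
  have hup : ∫ t in Ioi (0 : ℝ), exp (-t) * exp (-z * cosh t) ≤ 1 := by
    have h1 : ∫ t in Ioi (0 : ℝ), exp (-t) = 1 := integral_exp_neg_Ioi_zero
    rw [← h1]
    refine integral_mono_of_nonneg (Eventually.of_forall fun t => by positivity)
      (integrableOn_exp_neg_Ioi 0) (Eventually.of_forall fun t => ?_)
    have : exp (-z * cosh t) ≤ 1 := exp_le_one_iff.2 (by nlinarith [cosh_pos t])
    exact mul_le_of_le_one_right (exp_pos _).le this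
  have hlo : 0 ≤ ∫ t in Ioi (0 : ℝ), exp (-t) * exp (-z * cosh t) :=
    integral_nonneg fun t => by positivity
  constructor
  · rw [hdiff]; nlinarith
  · rw [hdiff]; nlinarith

/-- The Wronskian identity for the modified Bessel functions. -/
theorem bessel_wronskian {z : ℝ} (hz : 0 < z) :
    z * (besselI 0 z * besselK 1 z + besselI 1 z * besselK 0 z) = 1 := by
  set W : ℝ → ℝ := fun z => z * (besselI 0 z * besselK 1 z + besselI 1 z * besselK 0 z)
  -- `W` is constant, so its value can be read off in the limit at the origin.
  have hW : ∀ y ∈ Ioi (0 : ℝ), HasDerivAt W 0 y := fun y hy => by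
    have hy' : y ≠ 0 := ne_of_gt hy
    refine ((hasDerivAt_id y).mul (((hasDerivAt_besselI_zero y).mul
      (hasDerivAt_besselK_one hy)).add ((hasDerivAt_besselI_one hy').mul
        (hasDerivAt_besselK_zero hy)))).congr_deriv ?_
    simp only [id, Pi.add_apply, Pi.mul_apply]
    field_simp
    ring
  have hconst : ∀ y ∈ Ioi (0 : ℝ), W y = W z := fun y hy =>
    isOpen_Ioi.is_const_of_deriv_eq_zero isPreconnected_Ioi
      (fun x hx => (hW x hx).differentiableAt.differentiableWithinAt)
      (fun x hx => (hW x hx).deriv) hy hz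
  have hmem : Ioi (0 : ℝ) ∈ 𝓝[>] (0 : ℝ) := self_mem_nhdsWithin
  have t1 : Tendsto (fun y => y * besselK 1 y) (𝓝[>] 0) (𝓝 1) := by
    have c1 : Tendsto (fun y : ℝ => exp (-y)) (𝓝[>] 0) (𝓝 1) := by
      have : Continuous fun y : ℝ => exp (-y) := by fun_prop
      simpa using (this.tendsto 0).mono_left nhdsWithin_le_nhds
    have c2 : Tendsto (fun y : ℝ => exp (-y) + y) (𝓝[>] 0) (𝓝 1) := by
      have : Continuous fun y : ℝ => exp (-y) + y := by fun_prop
      simpa using (this.tendsto 0).mono_left nhdsWithin_le_nhds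
    refine tendsto_of_tendsto_of_tendsto_of_le_of_le' c1 c2 ?_ ?_ <;>
      filter_upwards [hmem] with y hy
    exacts [(mul_besselK_one_mem hy).1, (mul_besselK_one_mem hy).2]
  have t0 : Tendsto (besselI 0) (𝓝[>] 0) (𝓝 1) := by
    have := (hasDerivAt_besselI_zero 0).continuousAt.tendsto.mono_left
      (nhdsWithin_le_nhds (s := Ioi 0))
    have h0 : besselI 0 0 = 1 := by
      rw [besselI_eq, besselSeries, tsum_eq_single 0 (fun k hk => by simp [hk])]
      simp
    rwa [h0] at this
  have tid : Tendsto (fun y : ℝ => y) (𝓝[>] 0) (𝓝 0) := tendsto_id.mono_left nhdsWithin_le_nhds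
  have tS : Tendsto (fun y => besselSeries 1 (y ^ 2 / 4)) (𝓝[>] 0) (𝓝 (besselSeries 1 0)) := by
    have : Continuous fun y : ℝ => besselSeries 1 (y ^ 2 / 4) := by
      have := (contDiff_besselSeries 1).continuous
      fun_prop
    simpa using (this.tendsto 0).mono_left nhdsWithin_le_nhds
  -- Bounding `K₀` by `K₁` replaces the logarithmic behaviour of `K₀` at the origin: `y K₁` stays
  -- bounded while `I₁ → 0`.
  have t2 : Tendsto (fun y => y * (besselI 1 y * besselK 0 y)) (𝓝[>] 0) (𝓝 0) := by
    have hb : Tendsto (fun y => y / 2 * besselSeries 1 (y ^ 2 / 4) * (y * besselK 1 y)) (𝓝[>] 0)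
        (𝓝 0) := by
      simpa using ((tid.div_const 2).mul tS).mul t1
    refine squeeze_zero' ?_ ?_ hb <;> filter_upwards [hmem] with y hy
    · have := besselI_pos 1 hy
      have := besselK_zero_pos hy
      have : 0 < y := hy
      positivity
    · have hk := besselK_zero_le_one hy
      have := besselI_pos 1 hy
      have hy0 : 0 < y := hy
      have e : besselI 1 y = y / 2 * besselSeries 1 (y ^ 2 / 4) := by rw [besselI_eq, pow_one]
      rw [← e]
      nlinarith [mul_le_mul_of_nonneg_left hk (mul_pos hy0 this).le]
  have t3 : Tendsto W (𝓝[>] 0) (𝓝 1) := by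
    have := (t0.mul t1).add t2
    rw [mul_one, add_zero] at this
    refine this.congr fun y => ?_
    simp only [W]; ring
  have t4 : Tendsto W (𝓝[>] 0) (𝓝 (W z)) := by
    refine tendsto_const_nhds.congr' ?_
    filter_upwards [hmem] with y hy
    exact (hconst y hy).symm
  exact tendsto_nhds_unique t4 t3

/-! ### Circles, their moving frame, and the constraint on radial components -/

theorem circleCurve_eq_smul (r θ : ℝ) : circleCurve r θ = r • circleCurve 1 θ := by
  ext i; fin_cases i <;> simp [circleCurve]

theorem circleCurve_one_eq (θ : ℝ) : circleCurve 1 θ =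
    cos θ • EuclideanSpace.single (0 : Fin 2) (1 : ℝ) + sin θ • EuclideanSpace.single 1 1 := by
  ext i; fin_cases i <;> simp [circleCurve]

theorem norm_circleCurve_one (θ : ℝ) : ‖circleCurve 1 θ‖ = 1 := by
  simp [circleCurve, EuclideanSpace.norm_eq]

theorem norm_circleCurve {r : ℝ} (hr : 0 ≤ r) (θ : ℝ) : ‖circleCurve r θ‖ = r := by
  rw [circleCurve_eq_smul, norm_smul, norm_circleCurve_one, mul_one, norm_of_nonneg hr]

theorem inner_circleCurve_one (θ : ℝ) : inner ℝ (circleCurve 1 θ) (circleCurve 1 θ) = 1 := by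
  rw [real_inner_self_eq_norm_sq, norm_circleCurve_one, one_pow]

/-- The unit tangent vector `i e^{iθ}` of the circles around the origin. -/
def angularVector (θ : ℝ) : Plane := !₂[-sin θ, cos θ]

theorem angularVector_eq (θ : ℝ) : angularVector θ =
    (-sin θ) • EuclideanSpace.single (0 : Fin 2) (1 : ℝ) + cos θ • EuclideanSpace.single 1 1 := by
  ext i; fin_cases i <;> simp [angularVector]

theorem hasDerivAt_circleCurve_one (θ : ℝ) :
    HasDerivAt (circleCurve 1) (angularVector θ) θ := by
  rw [angularVector_eq, show circleCurve 1 = _ from funext circleCurve_one_eq]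
  exact ((hasDerivAt_cos θ).smul_const _).add ((hasDerivAt_sin θ).smul_const _)

theorem hasDerivAt_angularVector (θ : ℝ) :
    HasDerivAt angularVector (-circleCurve 1 θ) θ := by
  rw [circleCurve_one_eq, show angularVector = _ from funext angularVector_eq, neg_add,
    ← neg_smul, ← neg_smul]
  exact ((hasDerivAt_sin θ).neg.smul_const _).add ((hasDerivAt_cos θ).smul_const _)

theorem norm_angularVector (θ : ℝ) : ‖angularVector θ‖ = 1 := by
  simp [angularVector, EuclideanSpace.norm_eq]

theorem hasDerivAt_circleCurve (r θ : ℝ) :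
    HasDerivAt (circleCurve r) (r • angularVector θ) θ := by
  rw [show circleCurve r = _ from funext (circleCurve_eq_smul r)]
  exact (hasDerivAt_circleCurve_one θ).const_smul r

theorem unitNormal_circleCurve {r : ℝ} (hr : 0 < r) (θ : ℝ) :
    unitNormal (circleCurve r) θ = -circleCurve 1 θ := by
  rw [unitNormal, (hasDerivAt_circleCurve r θ).deriv, norm_smul, norm_angularVector, mul_one,
    norm_of_nonneg hr.le]
  ext i
  fin_cases i <;> simp [rotJ, angularVector, circleCurve] <;> field_simp

/-- The squared length of the radial unit vector field at the circle of radius `r`. -/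
def circleMetric (𝔛 : FieldClass) (A : ℝ) (n : ℕ) (r : ℝ) : ℝ≥0∞ :=
  quotientMetric 𝔛 A n (circleCurve r) (circleCurve 1)

/-- The fields whose radial component is `v` along the circle of radius `r`. -/
def radialFields (𝔛 : FieldClass) (r v : ℝ) : Set (Plane → Plane) :=
  {X | X ∈ 𝔛.fields ∧ ∀ θ, inner ℝ (X (r • circleCurve 1 θ)) (circleCurve 1 θ) = v}

/-- The unit normal is the inward one, `-e^{iθ}`, but its sign occurs on both sides of the
constraint and cancels. -/
theorem quotientMetric_circleCurve (𝔛 : FieldClass) (A : ℝ) (n : ℕ) {r : ℝ} (hr : 0 < r) (v : ℝ) :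
    quotientMetric 𝔛 A n (circleCurve r) (fun θ => v • circleCurve 1 θ) =
      ⨅ X ∈ radialFields 𝔛 r v, ENNReal.ofReal (sobolevInner A n X X) := by
  have : {X | X ∈ 𝔛.fields ∧ ∀ θ, inner ℝ (X (circleCurve r θ)) (unitNormal (circleCurve r) θ) =
      inner ℝ (v • circleCurve 1 θ) (unitNormal (circleCurve r) θ)} = radialFields 𝔛 r v := by
    ext X
    refine and_congr Iff.rfl (forall_congr' fun θ => ?_)
    rw [unitNormal_circleCurve hr, inner_neg_right, inner_neg_right, neg_inj, inner_smul_left,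
      inner_circleCurve_one, circleCurve_eq_smul r]
    simp
  rw [quotientMetric, this]

theorem circleMetric_eq (𝔛 : FieldClass) (A : ℝ) (n : ℕ) {r : ℝ} (hr : 0 < r) :
    circleMetric 𝔛 A n r = ⨅ X ∈ radialFields 𝔛 r 1, ENNReal.ofReal (sobolevInner A n X X) := by
  rw [← quotientMetric_circleCurve 𝔛 A n hr]
  simp [circleMetric]

/-! ### Field classes and the Sobolev energy under scaling -/

/-- Lower bounds are proved for Schwartz fields, while explicit competitors have compact support.
Together with `mem_fields_of_compactSupport` this treats both classes at once. -/
theorem exists_schwartz_of_mem_fields {𝔛 : FieldClass} {X : Plane → Plane} (hX : X ∈ 𝔛.fields) :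
    ∃ S : 𝓢(Plane, Plane), X = S := by
  cases 𝔛 with
  | compactSupport => exact ⟨hX.2.toSchwartzMap hX.1, rfl⟩
  | rapidlyDecreasing => obtain ⟨S, hS⟩ := hX; exact ⟨S, funext hS⟩

theorem mem_fields_of_compactSupport (𝔛 : FieldClass) {X : Plane → Plane} (h : ContDiff ℝ ∞ X)
    (h' : HasCompactSupport X) : X ∈ 𝔛.fields := by
  cases 𝔛 with
  | compactSupport => exact ⟨h, h'⟩
  | rapidlyDecreasing => exact ⟨h'.toSchwartzMap h, fun _ => rfl⟩

theorem const_smul_mem_fields {𝔛 : FieldClass} {X : Plane → Plane} (hX : X ∈ 𝔛.fields) (c : ℝ) :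
    (fun x => c • X x) ∈ 𝔛.fields := by
  cases 𝔛 with
  | compactSupport => exact ⟨hX.1.const_smul c, hX.2.comp_left (g := fun x : Plane => c • x) (smul_zero c)⟩
  | rapidlyDecreasing => obtain ⟨S, hS⟩ := hX; exact ⟨c • S, fun x => by simp only [hS x]; rfl⟩

theorem comp_smul_mem_fields {𝔛 : FieldClass} {X : Plane → Plane} (hX : X ∈ 𝔛.fields) {c : ℝ}
    (hc : c ≠ 0) : (fun x => X (c • x)) ∈ 𝔛.fields := by
  cases 𝔛 with
  | compactSupport =>
    exact ⟨hX.1.comp (contDiff_id.const_smul c),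
      hX.2.comp_homeomorph (Homeomorph.smulOfNeZero c hc)⟩
  | rapidlyDecreasing =>
    obtain ⟨S, hS⟩ := hX
    exact ⟨SchwartzMap.compCLMOfContinuousLinearEquiv ℝ
      (ContinuousLinearEquiv.smulLeft (Units.mk0 c hc)) S, fun x => hS _⟩

theorem exists_partialD_iterate (S : 𝓢(Plane, Plane)) (k : Fin 2) (i : ℕ) :
    ∃ T : 𝓢(Plane, Plane), (partialD k)^[i] S = T := by
  induction i with
  | zero => exact ⟨S, rfl⟩
  | succ i ih =>
    obtain ⟨T, hT⟩ := ih
    exact ⟨LineDeriv.lineDerivOp (EuclideanSpace.single k (1 : ℝ)) T, by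
      rw [Function.iterate_succ_apply', hT]; rfl⟩

theorem exists_partialD_iterate₂ (S : 𝓢(Plane, Plane)) (i j : ℕ) :
    ∃ T : 𝓢(Plane, Plane), (partialD 0)^[i] ((partialD 1)^[j] S) = T := by
  obtain ⟨T, hT⟩ := exists_partialD_iterate S 1 j
  rw [hT]
  exact exists_partialD_iterate T 0 i

theorem SchwartzMap.integrable_norm_sq (S : 𝓢(Plane, Plane)) : Integrable fun x => ‖S x‖ ^ 2 :=
  (S.memLp 2).integrable_norm_pow (by norm_num)

/-- The terms of the Sobolev energy. -/
def derivEnergy (i j : ℕ) (X : Plane → Plane) : ℝ :=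
  ∫ x, ‖(partialD 0)^[i] ((partialD 1)^[j] X) x‖ ^ 2

theorem derivEnergy_nonneg (i j : ℕ) (X : Plane → Plane) : 0 ≤ derivEnergy i j X :=
  integral_nonneg fun _ => by positivity

theorem sobolevInner_self (A : ℝ) (n : ℕ) (X : Plane → Plane) :
    sobolevInner A n X X = ∑ i ∈ Finset.range (n + 1), ∑ j ∈ Finset.range (n + 1 - i),
      A ^ (i + j) * ((n.factorial : ℝ) / (i.factorial * j.factorial * (n - i - j).factorial)) *
        derivEnergy i j X := by
  simp only [sobolevInner, real_inner_self_eq_norm_sq, derivEnergy]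

theorem factorial_div_mono {m n k : ℕ} (hk : k ≤ m) (h : m ≤ n) :
    (m.factorial : ℝ) / (m - k).factorial ≤ (n.factorial : ℝ) / (n - k).factorial := by
  rw [← Nat.cast_div (Nat.factorial_dvd_factorial (Nat.sub_le _ _)) (by positivity),
    ← Nat.cast_div (Nat.factorial_dvd_factorial (Nat.sub_le _ _)) (by positivity),
    ← Nat.descFactorial_eq_div hk, ← Nat.descFactorial_eq_div (hk.trans h)]
  exact_mod_cast Nat.descFactorial_le k h

/-- The coefficient `n! / (n - k)!` is a descending factorial, hence monotone in `n`, and the terms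
of higher order are nonnegative. Estimates for orders 1 and 2 thereby pass to all higher orders. -/
theorem sobolevInner_self_mono {A : ℝ} (hA : 0 < A) {m n : ℕ} (h : m ≤ n) (X : Plane → Plane) :
    sobolevInner A m X X ≤ sobolevInner A n X X := by
  rw [sobolevInner_self, sobolevInner_self]
  have hpos : ∀ i j, 0 ≤ A ^ (i + j) *
      ((n.factorial : ℝ) / (i.factorial * j.factorial * (n - i - j).factorial)) *
        derivEnergy i j X := fun i j => by
    have := derivEnergy_nonneg i j X
    positivity
  calc _ ≤ ∑ i ∈ Finset.range (m + 1), ∑ j ∈ Finset.range (m + 1 - i),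
      A ^ (i + j) * ((n.factorial : ℝ) / (i.factorial * j.factorial * (n - i - j).factorial)) *
        derivEnergy i j X := by
        refine Finset.sum_le_sum fun i hi => Finset.sum_le_sum fun j hj => ?_
        rw [Finset.mem_range] at hi hj
        have hd := derivEnergy_nonneg i j X
        have hf := factorial_div_mono (show i + j ≤ m by omega) h
        rw [Nat.sub_sub, Nat.sub_sub]
        gcongr A ^ (i + j) * ?_ * derivEnergy i j X
        calc _ = ((i.factorial : ℝ) * j.factorial)⁻¹ *
            ((m.factorial : ℝ) / (m - (i + j)).factorial) := by field_simp
          _ ≤ ((i.factorial : ℝ) * j.factorial)⁻¹ *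
            ((n.factorial : ℝ) / (n - (i + j)).factorial) := by gcongr
          _ = _ := by field_simp
    _ ≤ ∑ i ∈ Finset.range (m + 1), ∑ j ∈ Finset.range (n + 1 - i),
      A ^ (i + j) * ((n.factorial : ℝ) / (i.factorial * j.factorial * (n - i - j).factorial)) *
        derivEnergy i j X := by
        refine Finset.sum_le_sum fun i _ => ?_
        refine Finset.sum_le_sum_of_subset_of_nonneg ?_ fun j _ _ => hpos i j
        exact Finset.range_subset_range.2 (by omega)
    _ ≤ _ := by
        refine Finset.sum_le_sum_of_subset_of_nonneg ?_ fun i _ _ =>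
          Finset.sum_nonneg fun j _ => hpos i j
        exact Finset.range_subset_range.2 (by omega)

theorem partialD_comp_smul (k : Fin 2) (X : Plane → Plane) (a c : ℝ) :
    partialD k (fun x => a • X (c • x)) = fun x => (a * c) • partialD k X (c • x) := by
  ext1 x
  have h := fderiv_comp_smul (f := X) (x := x) c
  have h' : fderiv ℝ (fun x => a • X (c • x)) x = a • fderiv ℝ (fun x => X (c • x)) x :=
    congrFun (fderiv_const_smul_field a (f := fun x => X (c • x))) x
  rw [partialD, h', h, mul_smul]
  rfl

theorem partialD_iterate_comp_smul (k : Fin 2) (i : ℕ) (X : Plane → Plane) (a c : ℝ) :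
    (partialD k)^[i] (fun x => a • X (c • x)) =
      fun x => (a * c ^ i) • (partialD k)^[i] X (c • x) := by
  induction i with
  | zero => simp
  | succ i ih =>
    rw [Function.iterate_succ_apply', ih, partialD_comp_smul, Function.iterate_succ_apply']
    ext1 x
    rw [pow_succ, mul_assoc]

/-- Each derivative contributes a factor `c`, squared by the norm; the Jacobian of the dilation in
the plane contributes `c⁻²`. -/
theorem derivEnergy_comp_smul (i j : ℕ) (X : Plane → Plane) (a c : ℝ) :
    derivEnergy i j (fun x => a • X (c • x)) =
      a ^ 2 * (c ^ (2 * (i + j)) / c ^ 2) * derivEnergy i j X := by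
  rw [derivEnergy, partialD_iterate_comp_smul, partialD_iterate_comp_smul]
  simp only [norm_smul, mul_pow]
  rw [integral_const_mul, Measure.integral_comp_smul volume
    (fun x => ‖(partialD 0)^[i] ((partialD 1)^[j] X) x‖ ^ 2) c]
  simp only [finrank_euclideanSpace, Fintype.card_fin, smul_eq_mul, norm_eq_abs, sq_abs,
    abs_inv, abs_pow, derivEnergy]
  rw [← mul_assoc]
  congr 1
  simp only [mul_pow, ← pow_mul]
  ring

theorem sobolevInner_const_smul (A : ℝ) (n : ℕ) (X : Plane → Plane) (a : ℝ) :
    sobolevInner A n (fun x => a • X x) (fun x => a • X x) = a ^ 2 * sobolevInner A n X X := by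
  rw [sobolevInner_self, sobolevInner_self, Finset.mul_sum]
  refine Finset.sum_congr rfl fun i _ => ?_
  rw [Finset.mul_sum]
  refine Finset.sum_congr rfl fun j _ => ?_
  have := derivEnergy_comp_smul i j X a 1
  simp only [one_smul, one_pow, div_one, mul_one] at this
  rw [this]; ring

theorem sobolevInner_comp_smul_le {A : ℝ} (hA : 0 < A) (n : ℕ) (X : Plane → Plane) {c : ℝ}
    (hc : 0 < c) : sobolevInner A n (fun x => X (c • x)) (fun x => X (c • x)) ≤
      max 1 (c ^ (2 * n)) / c ^ 2 * sobolevInner A n X X := by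
  rw [sobolevInner_self, sobolevInner_self, Finset.mul_sum]
  refine Finset.sum_le_sum fun i hi => ?_
  rw [Finset.mul_sum]
  refine Finset.sum_le_sum fun j hj => ?_
  have := derivEnergy_comp_smul i j X 1 c
  simp only [one_smul, one_pow, one_mul] at this
  rw [this]
  have hd := derivEnergy_nonneg i j X
  have hk : i + j ≤ n := by
    rw [Finset.mem_range] at hi hj; omega
  have hle : c ^ (2 * (i + j)) ≤ max 1 (c ^ (2 * n)) := by
    rcases le_total c 1 with h | h
    · exact le_max_of_le_left (pow_le_one₀ hc.le h)
    · exact le_max_of_le_right (pow_le_pow_right₀ h (by omega))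
  calc _ = c ^ (2 * (i + j)) / c ^ 2 * (A ^ (i + j) *
        ((n.factorial : ℝ) / (i.factorial * j.factorial * (n - i - j).factorial)) *
          derivEnergy i j X) := by ring
    _ ≤ _ := by gcongr

/-! ### The quotient metric at circles: quadratic form, finiteness, comparison of radii -/

theorem const_smul_mem_radialFields {𝔛 : FieldClass} {X : Plane → Plane} {r v : ℝ}
    (hX : X ∈ radialFields 𝔛 r v) (a : ℝ) : (fun x => a • X x) ∈ radialFields 𝔛 r (a * v) :=
  ⟨const_smul_mem_fields hX.1 a, fun θ => by rw [real_inner_smul_left, hX.2]⟩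

theorem ofReal_sobolevInner_const_smul (A : ℝ) (n : ℕ) (X : Plane → Plane) (a : ℝ) :
    ENNReal.ofReal (sobolevInner A n (fun x => a • X x) (fun x => a • X x)) =
      ENNReal.ofReal (a ^ 2) * ENNReal.ofReal (sobolevInner A n X X) := by
  rw [sobolevInner_const_smul, ENNReal.ofReal_mul (sq_nonneg a)]

theorem zero_mem_radialFields (𝔛 : FieldClass) (r : ℝ) : (fun _ => 0) ∈ radialFields 𝔛 r 0 :=
  ⟨mem_fields_of_compactSupport 𝔛 contDiff_const HasCompactSupport.zero, fun θ => by simp⟩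

theorem sobolevInner_zero (A : ℝ) (n : ℕ) :
    sobolevInner A n (fun _ : Plane => (0 : Plane)) (fun _ => 0) = 0 := by
  have := sobolevInner_const_smul A n (fun _ => 0) 0
  simpa using this

/-- The quotient metric on radial vectors is a quadratic form. -/
theorem quotientMetric_radial (𝔛 : FieldClass) (A : ℝ) (n : ℕ) {r : ℝ} (hr : 0 < r) (v : ℝ) :
    quotientMetric 𝔛 A n (circleCurve r) (fun θ => v • circleCurve 1 θ) =
      ENNReal.ofReal (v ^ 2) * circleMetric 𝔛 A n r := by
  rw [quotientMetric_circleCurve 𝔛 A n hr]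
  -- For `v ≠ 0`, multiplication by `v` is a bijection between the two sets of competitors. For `v =
  -- 0` it is not, and the zero field gives the infimum.
  rcases eq_or_ne v 0 with rfl | hv
  · refine le_antisymm ((iInf₂_le _ (zero_mem_radialFields 𝔛 r)).trans ?_) ?_
    · simp [sobolevInner_zero]
    · simp
  have hv2 : ENNReal.ofReal (v ^ 2) ≠ 0 := by
    simpa using hv
  rw [circleMetric_eq 𝔛 A n hr]
  simp only [ENNReal.mul_iInf_of_ne hv2 ENNReal.ofReal_ne_top]
  apply le_antisymm
  · refine le_iInf₂ fun X hX => ?_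
    refine (iInf₂_le _ (by simpa using const_smul_mem_radialFields hX v)).trans ?_
    rw [ofReal_sobolevInner_const_smul]
  · refine le_iInf₂ fun X hX => ?_
    have := const_smul_mem_radialFields hX v⁻¹
    rw [inv_mul_cancel₀ hv] at this
    refine (iInf₂_le _ this).trans ?_
    rw [ofReal_sobolevInner_const_smul, ← mul_assoc, ← ENNReal.ofReal_mul (sq_nonneg v)]
    rw [← mul_pow, mul_inv_cancel₀ hv]
    simp

theorem radialFields_nonempty (𝔛 : FieldClass) {r : ℝ} (hr : 0 < r) :
    (radialFields 𝔛 r 1).Nonempty := by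
  let χ : ContDiffBump (0 : Plane) := ⟨r, r + 1, hr, by linarith⟩
  refine ⟨fun x => χ x • (r⁻¹ • x), mem_fields_of_compactSupport 𝔛
    (χ.contDiff.smul (contDiff_id.const_smul r⁻¹)) χ.hasCompactSupport.smul_right, fun θ => ?_⟩
  have : χ (r • circleCurve 1 θ) = 1 := χ.one_of_mem_closedBall (by
    rw [mem_closedBall_zero_iff, ← circleCurve_eq_smul, norm_circleCurve hr.le])
  simp only [this, one_smul, smul_smul, inv_mul_cancel₀ hr.ne', inner_circleCurve_one]

theorem circleMetric_ne_top (𝔛 : FieldClass) (A : ℝ) (n : ℕ) {r : ℝ} (hr : 0 < r) :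
    circleMetric 𝔛 A n r ≠ ⊤ := by
  obtain ⟨X, hX⟩ := radialFields_nonempty 𝔛 hr
  rw [circleMetric_eq 𝔛 A n hr]
  exact ((iInf₂_le X hX).trans_lt ENNReal.ofReal_lt_top).ne

theorem circleMetric_mono_order (𝔛 : FieldClass) {A : ℝ} (hA : 0 < A) {m n : ℕ} (h : m ≤ n)
    {r : ℝ} (hr : 0 < r) : circleMetric 𝔛 A m r ≤ circleMetric 𝔛 A n r := by
  rw [circleMetric_eq 𝔛 A n hr, circleMetric_eq 𝔛 A m hr]
  exact iInf₂_mono fun X _ => ENNReal.ofReal_le_ofReal (sobolevInner_self_mono hA h X)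

/-- Comparison of the metric at circles of different radii, by a dilation of the plane. -/
theorem circleMetric_le_dilate (𝔛 : FieldClass) {A : ℝ} (hA : 0 < A) (n : ℕ) {r s : ℝ}
    (hr : 0 < r) (hs : 0 < s) : circleMetric 𝔛 A n s ≤
      ENNReal.ofReal (max 1 ((r / s) ^ (2 * n)) / (r / s) ^ 2) * circleMetric 𝔛 A n r := by
  have hc : 0 < r / s := by positivity
  rw [circleMetric_eq 𝔛 A n hr, circleMetric_eq 𝔛 A n hs, ENNReal.mul_iInf_of_ne
    (by simpa using (by positivity)) ENNReal.ofReal_ne_top]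
  refine le_iInf fun X => ?_
  rw [ENNReal.mul_iInf_of_ne (by simpa using (by positivity)) ENNReal.ofReal_ne_top]
  refine le_iInf fun hX => ?_
  have hY : (fun x => X ((r / s) • x)) ∈ radialFields 𝔛 s 1 :=
    ⟨comp_smul_mem_fields hX.1 hc.ne', fun θ => by
      simp only [smul_smul, div_mul_cancel₀ _ hs.ne']; exact hX.2 θ⟩
  refine (iInf₂_le _ hY).trans ?_
  rw [← ENNReal.ofReal_mul (by positivity)]
  exact ENNReal.ofReal_le_ofReal (sobolevInner_comp_smul_le hA n X hc)

/-- The metric `circleMetric` as a real number. -/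
def circleMetricReal (𝔛 : FieldClass) (A : ℝ) (n : ℕ) (r : ℝ) : ℝ :=
  (circleMetric 𝔛 A n r).toReal

theorem ofReal_circleMetricReal (𝔛 : FieldClass) (A : ℝ) (n : ℕ) {r : ℝ} (hr : 0 < r) :
    ENNReal.ofReal (circleMetricReal 𝔛 A n r) = circleMetric 𝔛 A n r :=
  ENNReal.ofReal_toReal (circleMetric_ne_top 𝔛 A n hr)

theorem circleMetricReal_le_dilate (𝔛 : FieldClass) {A : ℝ} (hA : 0 < A) (n : ℕ) {r s : ℝ}
    (hr : 0 < r) (hs : 0 < s) : circleMetricReal 𝔛 A n s ≤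
      max 1 ((r / s) ^ (2 * n)) / (r / s) ^ 2 * circleMetricReal 𝔛 A n r := by
  have h := ENNReal.toReal_mono (ENNReal.mul_ne_top ENNReal.ofReal_ne_top
    (circleMetric_ne_top 𝔛 A n hr)) (circleMetric_le_dilate 𝔛 hA n hr hs)
  rwa [ENNReal.toReal_mul, ENNReal.toReal_ofReal (by positivity)] at h

/-- The Dirichlet energy is dilation invariant in the plane and the `L²` term shrinks when a field
is compressed to a smaller circle, so the comparison factor is exactly 1. -/
theorem circleMetricReal_one_mono (𝔛 : FieldClass) {A : ℝ} (hA : 0 < A) {r s : ℝ}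
    (hs : 0 < s) (h : s ≤ r) : circleMetricReal 𝔛 A 1 s ≤ circleMetricReal 𝔛 A 1 r := by
  have hr := hs.trans_le h
  have := circleMetricReal_le_dilate 𝔛 hA 1 hr hs
  have h1 : 1 ≤ r / s := (one_le_div hs).2 h
  rwa [mul_one, max_eq_right (one_le_pow₀ h1), div_self (by positivity), one_mul] at this

/-- Dilating both from `r` to `s` and from `s` to `r` squeezes the value at `s` between multiples of
the value at `r` whose factors tend to 1. -/
theorem continuousOn_circleMetricReal (𝔛 : FieldClass) {A : ℝ} (hA : 0 < A) (n : ℕ) :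
    ContinuousOn (circleMetricReal 𝔛 A n) (Ioi 0) := by
  intro r hr
  have hr0 : (0 : ℝ) < r := hr
  refine ContinuousAt.continuousWithinAt ?_
  set κ : ℝ → ℝ := fun c => max 1 (c ^ (2 * n)) / c ^ 2
  have hκ : ContinuousAt κ 1 := by
    have : ContinuousAt (fun c : ℝ => max 1 (c ^ (2 * n))) 1 := by fun_prop
    exact this.div (by fun_prop) (by norm_num)
  have hκ1 : κ 1 = 1 := by simp [κ]
  have h1 : Tendsto (fun s => κ (r / s) * circleMetricReal 𝔛 A n r) (𝓝 r)
      (𝓝 (circleMetricReal 𝔛 A n r)) := by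
    have h : Tendsto (fun s => r / s) (𝓝 r) (𝓝 1) := by
      have : ContinuousAt (fun s => r / s) r := continuousAt_const.div continuousAt_id hr0.ne'
      simpa [ContinuousAt, div_self hr0.ne'] using this
    have := (hκ.tendsto.comp h).mul_const (circleMetricReal 𝔛 A n r)
    rwa [hκ1, one_mul] at this
  have h2 : Tendsto (fun s => (κ (s / r))⁻¹ * circleMetricReal 𝔛 A n r) (𝓝 r)
      (𝓝 (circleMetricReal 𝔛 A n r)) := by
    have h : Tendsto (fun s => s / r) (𝓝 r) (𝓝 1) := by
      have : ContinuousAt (fun s => s / r) r := by fun_prop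
      simpa [ContinuousAt, div_self hr0.ne'] using this
    have := ((hκ.tendsto.comp h).inv₀ (by simp [hκ1])).mul_const (circleMetricReal 𝔛 A n r)
    rwa [hκ1, inv_one, one_mul] at this
  refine tendsto_of_tendsto_of_tendsto_of_le_of_le' h2 h1 ?_ ?_ <;>
    filter_upwards [Ioi_mem_nhds hr0] with s hs
  · have hs0 : (0 : ℝ) < s := hs
    have hpos : 0 < κ (s / r) := by
      have : 0 < s / r := by positivity
      positivity
    rw [inv_mul_le_iff₀ hpos]
    exact circleMetricReal_le_dilate 𝔛 hA n hs hr0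
  · exact circleMetricReal_le_dilate 𝔛 hA n hr0 hs

/-! ### Polar coordinates and circle integrals of the radial component -/

section

theorem measurePreserving_plane :
    MeasurePreserving (fun p : ℝ × ℝ => (!₂[p.1, p.2] : Plane)) := by
  have h1 := (volume_preserving_finTwoArrow ℝ).symm
  have h2 := (PiLp.volume_preserving_toLp (Fin 2)).comp h1
  have e : (fun p : ℝ × ℝ => (!₂[p.1, p.2] : Plane)) =
      WithLp.toLp 2 ∘ MeasurableEquiv.finTwoArrow.symm := by
    ext p i; fin_cases i <;> rfl
  rw [e]
  exact h2

theorem lintegral_plane_polar {h : Plane → ℝ≥0∞} (hh : Measurable h) :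
    ∫⁻ x, h x = ∫⁻ p in Ioi (0 : ℝ) ×ˢ Ioo (-π) π,
      ENNReal.ofReal p.1 * h (p.1 • circleCurve 1 p.2) := by
  rw [← measurePreserving_plane.lintegral_comp hh,
    ← lintegral_comp_polarCoord_symm (fun p : ℝ × ℝ => h !₂[p.1, p.2])]
  refine lintegral_congr fun p => ?_
  rw [← circleCurve_eq_smul]
  rfl

theorem continuous_circleCurve_prod :
    Continuous fun p : ℝ × ℝ => p.1 • circleCurve 1 p.2 := by
  have : Continuous (circleCurve 1) :=
    continuous_iff_continuousAt.2 fun θ => (hasDerivAt_circleCurve_one θ).continuousAt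
  fun_prop

theorem continuous_circleCurve_one : Continuous (circleCurve 1) :=
  continuous_iff_continuousAt.2 fun θ => (hasDerivAt_circleCurve_one θ).continuousAt

theorem continuous_angularVector : Continuous angularVector :=
  continuous_iff_continuousAt.2 fun θ => (hasDerivAt_angularVector θ).continuousAt

/-- Integration in polar coordinates over an annulus. -/
theorem integral_polar_le {h : Plane → ℝ} (hc : Continuous h) (h0 : ∀ x, 0 ≤ h x)
    (hi : Integrable h) {a b : ℝ} (ha : 0 ≤ a) (hab : a ≤ b) :
    ∫ ρ in a..b, ρ * ∫ θ in (-π)..π, h (ρ • circleCurve 1 θ) ≤ ∫ x, h x := by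
  have hpi : -π ≤ π := by linarith [pi_pos]
  have hcont : Continuous fun p : ℝ × ℝ => p.1 * h (p.1 • circleCurve 1 p.2) :=
    continuous_fst.mul (hc.comp continuous_circleCurve_prod)
  have hint : IntegrableOn (fun p : ℝ × ℝ => p.1 * h (p.1 • circleCurve 1 p.2))
      (Ioc a b ×ˢ Ioo (-π) π) (volume.prod volume) :=
    (hcont.continuousOn.integrableOn_compact (isCompact_Icc.prod isCompact_Icc)).mono_set
      (prod_mono Ioc_subset_Icc_self Ioo_subset_Icc_self)
  have e : ∫ ρ in a..b, ρ * ∫ θ in (-π)..π, h (ρ • circleCurve 1 θ) =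
      ∫ p in Ioc a b ×ˢ Ioo (-π) π, p.1 * h (p.1 • circleCurve 1 p.2) ∂(volume.prod volume) := by
    rw [setIntegral_prod _ hint, intervalIntegral.integral_of_le hab]
    refine integral_congr_ae (Eventually.of_forall fun ρ => ?_)
    simp only
    rw [intervalIntegral.integral_of_le hpi, integral_Ioc_eq_integral_Ioo, integral_const_mul]
  have hnn : ∀ᵐ p ∂((volume.prod volume).restrict (Ioc a b ×ˢ Ioo (-π) π)),
      0 ≤ p.1 * h (p.1 • circleCurve 1 p.2) := by
    filter_upwards [ae_restrict_mem (measurableSet_Ioc.prod measurableSet_Ioo)] with p hp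
    exact mul_nonneg (ha.trans hp.1.1.le) (h0 _)
  -- With `[0, ∞]`-valued integrals the comparison is monotonicity in the domain, and no
  -- integrability over the full polar strip has to be shown.
  rw [e, ← ENNReal.ofReal_le_ofReal_iff (integral_nonneg h0),
    ofReal_integral_eq_lintegral_ofReal hint hnn,
    ofReal_integral_eq_lintegral_ofReal hi (Eventually.of_forall h0),
    lintegral_plane_polar hc.measurable.ennreal_ofReal]
  calc _ = ∫⁻ p in Ioc a b ×ˢ Ioo (-π) π,
        ENNReal.ofReal p.1 * ENNReal.ofReal (h (p.1 • circleCurve 1 p.2)) := by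
        refine setLIntegral_congr_fun (measurableSet_Ioc.prod measurableSet_Ioo) fun p hp => ?_
        exact ENNReal.ofReal_mul (ha.trans hp.1.1.le)
    _ ≤ _ := lintegral_mono_set
        (prod_mono (fun x hx => ha.trans_lt hx.1) subset_rfl)

/-- Weighted Cauchy-Schwarz inequality on an interval. -/
theorem sq_integral_mul_le {w φ ψ : ℝ → ℝ} {a b : ℝ} (hab : a ≤ b)
    (hw : ContinuousOn w (Icc a b)) (hφ : ContinuousOn φ (Icc a b)) (hψ : ContinuousOn ψ (Icc a b))
    (hw0 : ∀ x ∈ Icc a b, 0 ≤ w x) :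
    (∫ x in a..b, w x * (φ x * ψ x)) ^ 2 ≤
      (∫ x in a..b, w x * φ x ^ 2) * ∫ x in a..b, w x * ψ x ^ 2 := by
  rw [← uIcc_of_le hab] at hw hφ hψ
  have i1 : IntervalIntegrable (fun x => w x * φ x ^ 2) volume a b :=
    (hw.mul (hφ.pow 2)).intervalIntegrable
  have i2 : IntervalIntegrable (fun x => w x * (φ x * ψ x)) volume a b :=
    (hw.mul (hφ.mul hψ)).intervalIntegrable
  have i3 : IntervalIntegrable (fun x => w x * ψ x ^ 2) volume a b :=
    (hw.mul (hψ.pow 2)).intervalIntegrable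
  have key : ∀ t : ℝ, 0 ≤ (∫ x in a..b, w x * φ x ^ 2) * (t * t) +
      (2 * ∫ x in a..b, w x * (φ x * ψ x)) * t + ∫ x in a..b, w x * ψ x ^ 2 := fun t => by
    have : 0 ≤ ∫ x in a..b, (w x * φ x ^ 2) * (t * t) + (w x * (φ x * ψ x)) * (2 * t) +
        w x * ψ x ^ 2 := by
      refine intervalIntegral.integral_nonneg hab fun x hx => ?_
      have := mul_nonneg (hw0 x hx) (sq_nonneg (t * φ x + ψ x))
      nlinarith
    rw [intervalIntegral.integral_add ((i1.mul_const _).add (i2.mul_const _)) i3,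
      intervalIntegral.integral_add (i1.mul_const _) (i2.mul_const _),
      intervalIntegral.integral_mul_const, intervalIntegral.integral_mul_const] at this
    linarith
  have := discrim_le_zero key
  rw [discrim] at this
  nlinarith

theorem sq_integral_circle_le {φ : ℝ → ℝ} (hφ : Continuous φ) :
    (∫ θ in (-π)..π, φ θ) ^ 2 ≤ 2 * π * ∫ θ in (-π)..π, φ θ ^ 2 := by
  have := sq_integral_mul_le (w := fun _ => 1) (φ := fun _ => 1) (ψ := φ)
    (show -π ≤ π by linarith [pi_pos]) continuousOn_const continuousOn_const hφ.continuousOn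
    (fun _ _ => zero_le_one)
  simp only [one_mul, one_pow, intervalIntegral.integral_const, smul_eq_mul, mul_one] at this
  linarith

/-- Differentiation of an integral over the circle with respect to the radius. -/
theorem hasDerivAt_integral_circle {G G' : ℝ → ℝ → ℝ}
    (hG : Continuous fun p : ℝ × ℝ => G p.1 p.2) (hG' : Continuous fun p : ℝ × ℝ => G' p.1 p.2)
    (hd : ∀ ρ θ, HasDerivAt (fun s => G s θ) (G' ρ θ) ρ) (ρ : ℝ) :
    HasDerivAt (fun s => ∫ θ in (-π)..π, G s θ) (∫ θ in (-π)..π, G' ρ θ) ρ := by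
  obtain ⟨C, hC⟩ := ((isCompact_Icc (a := ρ - 1) (b := ρ + 1)).prod
    (isCompact_Icc (a := -π) (b := π))).exists_bound_of_continuousOn hG'.continuousOn
  have c1 : ∀ s, Continuous (G s) := fun s => hG.comp (by fun_prop : Continuous fun θ => (s, θ))
  have c2 : ∀ s, Continuous (G' s) := fun s => hG'.comp (by fun_prop : Continuous fun θ => (s, θ))
  refine (intervalIntegral.hasDerivAt_integral_of_dominated_loc_of_deriv_le
    (bound := fun _ => C) (s := Icc (ρ - 1) (ρ + 1)) (Icc_mem_nhds (by linarith) (by linarith))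
    (Eventually.of_forall fun s => (c1 s).aestronglyMeasurable) ((c1 ρ).intervalIntegrable _ _)
    (c2 ρ).aestronglyMeasurable (Eventually.of_forall fun θ hθ s hs => ?_)
    intervalIntegrable_const (Eventually.of_forall fun θ _ s _ => hd s θ)).2
  rw [uIoc_of_le (by linarith [pi_pos])] at hθ
  exact hC (s, θ) ⟨hs, Ioc_subset_Icc_self hθ⟩

theorem continuous_integral_circle {G : ℝ → ℝ → ℝ} (hG : Continuous fun p : ℝ × ℝ => G p.1 p.2) :
    Continuous fun s => ∫ θ in (-π)..π, G s θ :=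
  intervalIntegral.continuous_parametric_intervalIntegral_of_continuous' hG _ _

/-- The integral of the radial component of a field over circles. -/
def radialMean (X : Plane → Plane) (ρ : ℝ) : ℝ :=
  ∫ θ in (-π)..π, inner ℝ (X (ρ • circleCurve 1 θ)) (circleCurve 1 θ)

/-- The integral over circles of the radial derivative of the radial component of a field. -/
def radialMeanDeriv (X : Plane → Plane) (ρ : ℝ) : ℝ :=
  ∫ θ in (-π)..π, inner ℝ (fderiv ℝ X (ρ • circleCurve 1 θ) (circleCurve 1 θ)) (circleCurve 1 θ)

variable {X : Plane → Plane}

theorem continuous_fderiv_circle (hX : ContDiff ℝ ∞ X) :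
    Continuous fun p : ℝ × ℝ => fderiv ℝ X (p.1 • circleCurve 1 p.2) :=
  (hX.continuous_fderiv (by simp)).comp continuous_circleCurve_prod

theorem hasDerivAt_radial (hX : ContDiff ℝ ∞ X) (ρ θ : ℝ) :
    HasDerivAt (fun s => X (s • circleCurve 1 θ))
      (fderiv ℝ X (ρ • circleCurve 1 θ) (circleCurve 1 θ)) ρ := by
  have h := (hX.differentiable (by simp) (ρ • circleCurve 1 θ)).hasFDerivAt
  have h2 : HasDerivAt (fun s : ℝ => s • circleCurve 1 θ) (circleCurve 1 θ) ρ := by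
    simpa using (hasDerivAt_id ρ).smul_const (circleCurve 1 θ)
  exact h.comp_hasDerivAt ρ h2

theorem hasDerivAt_angular (hX : ContDiff ℝ ∞ X) (ρ θ : ℝ) :
    HasDerivAt (fun t => X (ρ • circleCurve 1 t))
      (ρ • fderiv ℝ X (ρ • circleCurve 1 θ) (angularVector θ)) θ := by
  have h := (hX.differentiable (by simp) (ρ • circleCurve 1 θ)).hasFDerivAt
  have := h.comp_hasDerivAt θ ((hasDerivAt_circleCurve_one θ).const_smul ρ)
  rwa [map_smul] at this

theorem hasDerivAt_radialMean (hX : ContDiff ℝ ∞ X) (ρ : ℝ) :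
    HasDerivAt (radialMean X) (radialMeanDeriv X ρ) ρ := by
  have c := continuous_circleCurve_one
  have c1 := hX.continuous.comp continuous_circleCurve_prod
  have c2 := continuous_fderiv_circle hX
  refine hasDerivAt_integral_circle (G := fun s θ => inner ℝ (X (s • circleCurve 1 θ))
    (circleCurve 1 θ)) (G' := fun s θ => inner ℝ (fderiv ℝ X (s • circleCurve 1 θ)
      (circleCurve 1 θ)) (circleCurve 1 θ)) (c1.inner (c.comp continuous_snd))
    ((c2.clm_apply (c.comp continuous_snd)).inner (c.comp continuous_snd)) (fun s θ => ?_) ρ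
  simpa using (hasDerivAt_radial hX s θ).inner ℝ (hasDerivAt_const s (circleCurve 1 θ))

theorem circleCurve_one_periodic_pi : circleCurve 1 (-π) = circleCurve 1 π := by
  simp [circleCurve]

theorem angularVector_periodic_pi : angularVector (-π) = angularVector π := by
  simp [angularVector]

/-- The derivative in `θ` of `⟨X, e_θ⟩` integrates to zero around the circle, and `e_θ' = -e_r`
turns one of its two terms into the radial component. -/
theorem integral_angular_eq (hX : ContDiff ℝ ∞ X) (ρ : ℝ) :
    ρ * ∫ θ in (-π)..π, inner ℝ (fderiv ℝ X (ρ • circleCurve 1 θ) (angularVector θ))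
      (angularVector θ) = radialMean X ρ := by
  have c := continuous_circleCurve_one
  have c' := continuous_angularVector
  have cρ : Continuous fun θ : ℝ => ((ρ, θ) : ℝ × ℝ) := by fun_prop
  have c1 : Continuous fun θ => X (ρ • circleCurve 1 θ) :=
    (hX.continuous.comp continuous_circleCurve_prod).comp cρ
  have c2 : Continuous fun θ => fderiv ℝ X (ρ • circleCurve 1 θ) :=
    (continuous_fderiv_circle hX).comp cρ
  have i1 : Continuous fun θ => inner ℝ (fderiv ℝ X (ρ • circleCurve 1 θ) (angularVector θ))
      (angularVector θ) := (c2.clm_apply c').inner c'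
  have i1' : Continuous fun θ => ρ * inner ℝ
      (fderiv ℝ X (ρ • circleCurve 1 θ) (angularVector θ)) (angularVector θ) :=
    continuous_const.mul i1
  have i2 : Continuous fun θ => inner ℝ (X (ρ • circleCurve 1 θ)) (circleCurve 1 θ) := c1.inner c
  have hd : ∀ θ ∈ uIcc (-π) π, HasDerivAt
      (fun θ => inner ℝ (X (ρ • circleCurve 1 θ)) (angularVector θ))
      (ρ * inner ℝ (fderiv ℝ X (ρ • circleCurve 1 θ) (angularVector θ)) (angularVector θ) -
        inner ℝ (X (ρ • circleCurve 1 θ)) (circleCurve 1 θ)) θ := fun θ _ => by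
    have := (hasDerivAt_angular hX ρ θ).inner ℝ (hasDerivAt_angularVector θ)
    rw [inner_neg_right, real_inner_smul_left] at this
    exact this.congr_deriv (by ring)
  have := intervalIntegral.integral_eq_sub_of_hasDerivAt hd
    ((i1'.sub i2).intervalIntegrable _ _)
  rw [circleCurve_one_periodic_pi, angularVector_periodic_pi, sub_self,
    intervalIntegral.integral_sub (i1'.intervalIntegrable _ _)
      (i2.intervalIntegrable _ _), intervalIntegral.integral_const_mul] at this
  rw [radialMean]
  linarith

/-- At the origin `X` does not depend on `θ`, and `e^{iθ}` has mean zero. This removes the boundary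
term at `0` in the order-one lower bound. -/
theorem radialMean_zero (X : Plane → Plane) : radialMean X 0 = 0 := by
  have hd : ∀ θ ∈ uIcc (-π) π, HasDerivAt (fun θ => inner ℝ (X 0) (-angularVector θ))
      (inner ℝ (X 0) (circleCurve 1 θ)) θ := fun θ _ => by
    have := (hasDerivAt_const θ (X 0)).inner ℝ (hasDerivAt_angularVector θ).neg
    simpa using this
  have c : Continuous fun θ => inner ℝ (X 0) (circleCurve 1 θ) :=
    continuous_const.inner continuous_circleCurve_one
  have := intervalIntegral.integral_eq_sub_of_hasDerivAt hd (c.intervalIntegrable _ _)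
  rw [angularVector_periodic_pi, sub_self] at this
  simpa [radialMean] using this

theorem radialMean_of_radial {r v : ℝ}
    (h : ∀ θ, inner ℝ (X (r • circleCurve 1 θ)) (circleCurve 1 θ) = v) :
    radialMean X r = 2 * π * v := by
  simp only [radialMean, h, intervalIntegral.integral_const, smul_eq_mul]
  ring

theorem abs_radialMean_le {ρ C : ℝ} (h : ∀ θ, ‖X (ρ • circleCurve 1 θ)‖ ≤ C) :
    |radialMean X ρ| ≤ 2 * π * C := by
  have := intervalIntegral.norm_integral_le_of_norm_le_const (a := -π) (b := π)
    (f := fun θ => inner ℝ (X (ρ • circleCurve 1 θ)) (circleCurve 1 θ)) (C := C) fun θ _ =>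
      (norm_inner_le_norm _ _).trans (by rw [norm_circleCurve_one, mul_one]; exact h θ)
  rw [show π - -π = 2 * π by ring, abs_of_pos (by positivity), Real.norm_eq_abs] at this
  rw [radialMean]; linarith

/-- The squared norm of the gradient of a field. -/
def gradSq (X : Plane → Plane) (x : Plane) : ℝ :=
  ‖partialD 0 X x‖ ^ 2 + ‖partialD 1 X x‖ ^ 2

theorem fderiv_circleCurve (X : Plane → Plane) (x : Plane) (θ : ℝ) :
    fderiv ℝ X x (circleCurve 1 θ) = cos θ • partialD 0 X x + sin θ • partialD 1 X x := by
  rw [circleCurve_one_eq, map_add, map_smul, map_smul]; rfl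

theorem fderiv_angularVector (X : Plane → Plane) (x : Plane) (θ : ℝ) :
    fderiv ℝ X x (angularVector θ) = (-sin θ) • partialD 0 X x + cos θ • partialD 1 X x := by
  rw [angularVector_eq, map_add, map_smul, map_smul]; rfl

/-- The Hilbert-Schmidt norm of the differential is the same in every orthonormal frame. -/
theorem gradSq_eq (X : Plane → Plane) (x : Plane) (θ : ℝ) :
    gradSq X x = ‖fderiv ℝ X x (circleCurve 1 θ)‖ ^ 2 +
      ‖fderiv ℝ X x (angularVector θ)‖ ^ 2 := by
  rw [fderiv_circleCurve, fderiv_angularVector, gradSq, norm_add_sq_real, norm_add_sq_real]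
  simp only [norm_smul, mul_pow, norm_eq_abs, sq_abs, real_inner_smul_left, real_inner_smul_right]
  have := sin_sq_add_cos_sq θ
  linear_combination (-‖partialD 0 X x‖ ^ 2 - ‖partialD 1 X x‖ ^ 2) * this

theorem sq_inner_le {v e : Plane} (he : ‖e‖ = 1) : inner ℝ v e ^ 2 ≤ ‖v‖ ^ 2 := by
  rw [sq_le_sq, abs_norm]
  simpa [he] using abs_real_inner_le_norm v e

theorem continuous_partialD (hX : ContDiff ℝ ∞ X) (k : Fin 2) : Continuous (partialD k X) :=
  (hX.continuous_fderiv (by simp)).clm_apply continuous_const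

theorem continuous_gradSq (hX : ContDiff ℝ ∞ X) : Continuous (gradSq X) :=
  ((continuous_partialD hX 0).norm.pow 2).add ((continuous_partialD hX 1).norm.pow 2)

/-- The energy of a field on a circle bounds that of its mean radial component. -/
theorem radialMean_energy_le (hX : ContDiff ℝ ∞ X) {A : ℝ} (hA : 0 < A) {ρ : ℝ} (hρ : 0 < ρ) :
    radialMean X ρ ^ 2 + A * (radialMeanDeriv X ρ ^ 2 + (radialMean X ρ / ρ) ^ 2) ≤
      2 * π * ∫ θ in (-π)..π, (‖X (ρ • circleCurve 1 θ)‖ ^ 2 +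
        A * gradSq X (ρ • circleCurve 1 θ)) := by
  have c := continuous_circleCurve_one
  have c' := continuous_angularVector
  have cρ : Continuous fun θ : ℝ => ((ρ, θ) : ℝ × ℝ) := by fun_prop
  have c1 : Continuous fun θ => X (ρ • circleCurve 1 θ) :=
    (hX.continuous.comp continuous_circleCurve_prod).comp cρ
  have c2 : Continuous fun θ => fderiv ℝ X (ρ • circleCurve 1 θ) :=
    (continuous_fderiv_circle hX).comp cρ
  -- Cauchy-Schwarz in `θ` for the radial component and for the two diagonal entries of the
  -- differential; the off-diagonal entries are dropped. Nothing is lost for radial fields `φ(|x|²)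
  -- x`, so the bound can be sharp.
  have e0 := sq_integral_circle_le (c1.inner c)
  have e1 := sq_integral_circle_le ((c2.clm_apply c).inner c)
  have e2 := sq_integral_circle_le ((c2.clm_apply c').inner c')
  have e3 : radialMean X ρ / ρ = ∫ θ in (-π)..π,
      inner ℝ (fderiv ℝ X (ρ • circleCurve 1 θ) (angularVector θ)) (angularVector θ) := by
    rw [← integral_angular_eq hX, mul_div_cancel_left₀ _ hρ.ne']
  rw [← e3] at e2
  have i0 : IntervalIntegrable (fun θ => inner ℝ (X (ρ • circleCurve 1 θ)) (circleCurve 1 θ) ^ 2)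
      volume (-π) π := ((c1.inner (𝕜 := ℝ) c).pow 2).intervalIntegrable _ _
  have i1 : IntervalIntegrable (fun θ => inner ℝ (fderiv ℝ X (ρ • circleCurve 1 θ)
      (circleCurve 1 θ)) (circleCurve 1 θ) ^ 2) volume (-π) π :=
    (((c2.clm_apply c).inner (𝕜 := ℝ) c).pow 2).intervalIntegrable _ _
  have i2 : IntervalIntegrable (fun θ => inner ℝ (fderiv ℝ X (ρ • circleCurve 1 θ)
      (angularVector θ)) (angularVector θ) ^ 2) volume (-π) π :=
    (((c2.clm_apply c').inner (𝕜 := ℝ) c').pow 2).intervalIntegrable _ _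
  have hsum : (∫ θ in (-π)..π, (inner ℝ (X (ρ • circleCurve 1 θ)) (circleCurve 1 θ)) ^ 2) +
      A * ((∫ θ in (-π)..π, (inner ℝ (fderiv ℝ X (ρ • circleCurve 1 θ) (circleCurve 1 θ))
        (circleCurve 1 θ)) ^ 2) +
        ∫ θ in (-π)..π, (inner ℝ (fderiv ℝ X (ρ • circleCurve 1 θ) (angularVector θ))
          (angularVector θ)) ^ 2) ≤
      ∫ θ in (-π)..π, (‖X (ρ • circleCurve 1 θ)‖ ^ 2 +
        A * gradSq X (ρ • circleCurve 1 θ)) := by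
    rw [← intervalIntegral.integral_add i1 i2, ← intervalIntegral.integral_const_mul,
      ← intervalIntegral.integral_add i0 ((i1.add i2).const_mul A)]
    refine intervalIntegral.integral_mono_on (by linarith [pi_pos])
      (i0.add ((i1.add i2).const_mul A)) ?_ fun θ _ => ?_
    · exact (((c1.norm.pow 2).add (((continuous_gradSq hX).comp
        (continuous_circleCurve_prod.comp cρ)).const_smul A))).intervalIntegrable _ _
    · rw [gradSq_eq X _ θ]
      have h0 := sq_inner_le (v := X (ρ • circleCurve 1 θ)) (norm_circleCurve_one θ)
      have h1 := sq_inner_le (v := fderiv ℝ X (ρ • circleCurve 1 θ) (circleCurve 1 θ))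
        (norm_circleCurve_one θ)
      have h2 := sq_inner_le (v := fderiv ℝ X (ρ • circleCurve 1 θ) (angularVector θ))
        (norm_angularVector θ)
      gcongr
  have e4 : A * (radialMeanDeriv X ρ ^ 2 + (radialMean X ρ / ρ) ^ 2) ≤
      A * (2 * π * (∫ θ in (-π)..π, (inner ℝ (fderiv ℝ X (ρ • circleCurve 1 θ) (circleCurve 1 θ))
        (circleCurve 1 θ)) ^ 2) + 2 * π *
        ∫ θ in (-π)..π, (inner ℝ (fderiv ℝ X (ρ • circleCurve 1 θ) (angularVector θ))
          (angularVector θ)) ^ 2) := by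
    gcongr
    exact e1
  calc _ ≤ _ := add_le_add e0 e4
    _ = 2 * π * ((∫ θ in (-π)..π, (inner ℝ (X (ρ • circleCurve 1 θ)) (circleCurve 1 θ)) ^ 2) +
      A * ((∫ θ in (-π)..π, (inner ℝ (fderiv ℝ X (ρ • circleCurve 1 θ) (circleCurve 1 θ))
        (circleCurve 1 θ)) ^ 2) +
        ∫ θ in (-π)..π, (inner ℝ (fderiv ℝ X (ρ • circleCurve 1 θ) (angularVector θ))
          (angularVector θ)) ^ 2)) := by ring
    _ ≤ _ := mul_le_mul_of_nonneg_left hsum (by positivity)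

/-- Picone's inequality: a solution `p` of the Riccati equation gives a lower bound for the
energy of a radial field. -/
theorem picone_le {A k a b : ℝ} (hA : 0 < A) (hk : A * k ^ 2 = 1) (ha : 0 < a) (hab : a ≤ b)
    {p u u' e : ℝ → ℝ}
    (hp : ∀ ρ ∈ Icc a b, HasDerivAt p (k ^ 2 - p ρ ^ 2 + p ρ / ρ) ρ)
    (hu : ∀ ρ, HasDerivAt u (u' ρ) ρ) (he : Continuous e)
    (hle : ∀ ρ, 0 < ρ → u ρ ^ 2 + A * (u' ρ ^ 2 + (u ρ / ρ) ^ 2) ≤ e ρ) :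
    A * ((b * p b - 1) * u b ^ 2) - A * ((a * p a - 1) * u a ^ 2) ≤ ∫ ρ in a..b, ρ * e ρ := by
  have hd : ∀ ρ ∈ Icc a b, HasDerivAt (fun ρ => A * ((ρ * p ρ - 1) * u ρ ^ 2))
      (A * ((p ρ + ρ * (k ^ 2 - p ρ ^ 2 + p ρ / ρ)) * u ρ ^ 2 +
        (ρ * p ρ - 1) * (2 * u ρ * u' ρ))) ρ := fun ρ hρ => by
    refine (((((hasDerivAt_id ρ).mul (hp ρ hρ)).sub_const 1).mul
      ((hu ρ).pow 2)).const_mul A).congr_deriv ?_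
    simp
  refine intervalIntegral.sub_le_integral_of_hasDeriv_right_of_le
    (g := fun ρ => A * ((ρ * p ρ - 1) * u ρ ^ 2)) hab
    (fun ρ hρ => (hd ρ hρ).continuousAt.continuousWithinAt)
    (fun ρ hρ => (hd ρ (Ioo_subset_Icc_self hρ)).hasDerivWithinAt)
    (continuous_id.mul he).continuousOn.integrableOn_Icc fun ρ hρ => ?_
  have hρ0 : 0 < ρ := ha.trans hρ.1
  refine le_trans ?_ (mul_le_mul_of_nonneg_left (hle ρ hρ0) hρ0.le)
  -- The defect is a square. Writing `p = y'/y`, it vanishes exactly when `ρ u` is proportional to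
  -- `y`, the case of the minimizer.
  have hsq : 0 ≤ A * ρ * (u' ρ + u ρ / ρ - p ρ * u ρ) ^ 2 := by positivity
  have e1 : ρ * (u ρ ^ 2 + A * (u' ρ ^ 2 + (u ρ / ρ) ^ 2)) -
      A * ((p ρ + ρ * (k ^ 2 - p ρ ^ 2 + p ρ / ρ)) * u ρ ^ 2 +
        (ρ * p ρ - 1) * (2 * u ρ * u' ρ)) = A * ρ * (u' ρ + u ρ / ρ - p ρ * u ρ) ^ 2 +
        ρ * u ρ ^ 2 * (1 - A * k ^ 2) := by
    field_simp
    ring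
  rw [hk, sub_self, mul_zero, add_zero] at e1
  linarith

end

/-! ### The lower bound for the metric of order one -/

/-- The value `2πA / (I₁ K₁)` of the metric of order one. -/
def besselMetric (A r : ℝ) : ℝ :=
  2 * π * A / (besselI 1 (r / √A) * besselK 1 (r / √A))

theorem besselMetric_pos {A r : ℝ} (hA : 0 < A) (hr : 0 < r) : 0 < besselMetric A r := by
  have h : 0 < r / √A := by positivity
  have h1 := besselI_pos 1 h
  have h2 := besselK_one_pos h
  rw [besselMetric]
  positivity

/-- This is `y'/y` for `y = ρ I₁(kρ)`, which solves `y'' = y'/ρ + k² y`;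
`hasDerivAt_riccati_besselK` is the same for `y = ρ K₁(kρ)`. -/
theorem hasDerivAt_riccati_besselI {k ρ : ℝ} (hk : 0 < k) (hρ : 0 < ρ) :
    HasDerivAt (fun ρ => k * (besselI 0 (k * ρ) / besselI 1 (k * ρ)))
      (k ^ 2 - (k * (besselI 0 (k * ρ) / besselI 1 (k * ρ))) ^ 2 +
        k * (besselI 0 (k * ρ) / besselI 1 (k * ρ)) / ρ) ρ := by
  have hz : 0 < k * ρ := by positivity
  have h1 := besselI_pos 1 hz
  have hm : HasDerivAt (fun ρ => k * ρ) k ρ := by simpa using (hasDerivAt_id ρ).const_mul k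
  refine ((((hasDerivAt_besselI_zero _).comp ρ hm).div
    ((hasDerivAt_besselI_one hz.ne').comp ρ hm) h1.ne').const_mul k).congr_deriv ?_
  simp only [Function.comp]
  field_simp
  ring

theorem hasDerivAt_riccati_besselK {k ρ : ℝ} (hk : 0 < k) (hρ : 0 < ρ) :
    HasDerivAt (fun ρ => -k * (besselK 0 (k * ρ) / besselK 1 (k * ρ)))
      (k ^ 2 - (-k * (besselK 0 (k * ρ) / besselK 1 (k * ρ))) ^ 2 +
        -k * (besselK 0 (k * ρ) / besselK 1 (k * ρ)) / ρ) ρ := by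
  have hz : 0 < k * ρ := by positivity
  have h1 := besselK_one_pos hz
  have hm : HasDerivAt (fun ρ => k * ρ) k ρ := by simpa using (hasDerivAt_id ρ).const_mul k
  refine ((((hasDerivAt_besselK_zero hz).comp ρ hm).div
    ((hasDerivAt_besselK_one hz).comp ρ hm) h1.ne').const_mul (-k)).congr_deriv ?_
  simp only [Function.comp]
  field_simp
  ring

theorem sobolevInner_one (A : ℝ) (S : 𝓢(Plane, Plane)) :
    sobolevInner A 1 S S = ∫ x, (‖S x‖ ^ 2 + A * gradSq S x) := by
  have hi : ∀ i j, Integrable fun x => ‖(partialD 0)^[i] ((partialD 1)^[j] S) x‖ ^ 2 := fun i j => by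
    obtain ⟨T, hT⟩ := exists_partialD_iterate₂ S i j
    rw [hT]; exact SchwartzMap.integrable_norm_sq T
  have h0 := hi 0 0
  have h1 := hi 1 0
  have h2 := hi 0 1
  simp only [Function.iterate_zero, Function.iterate_one, id] at h0 h1 h2
  rw [sobolevInner_self]
  simp only [gradSq]
  have h12 : Integrable fun x => ‖partialD 0 S x‖ ^ 2 + ‖partialD 1 S x‖ ^ 2 := h1.add h2
  rw [integral_add h0 (h12.const_mul A), integral_const_mul, integral_add h1 h2]
  simp [Finset.sum_range_succ, derivEnergy]
  ring

theorem integrable_gradSq (S : 𝓢(Plane, Plane)) : Integrable (gradSq S) := by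
  obtain ⟨T, hT⟩ := exists_partialD_iterate₂ S 1 0
  obtain ⟨T', hT'⟩ := exists_partialD_iterate₂ S 0 1
  simp only [Function.iterate_zero, Function.iterate_one, id] at hT hT'
  have := (SchwartzMap.integrable_norm_sq T).add (SchwartzMap.integrable_norm_sq T')
  rw [← hT, ← hT'] at this
  exact this

/-- The quotient `I₀/I₁` has a simple pole at the origin, so the factor multiplying `u²` stays
bounded, and `u` vanishes there. -/
theorem tendsto_riccati_boundary_zero {k : ℝ} (hk : 0 < k) {u : ℝ → ℝ} (hu : ContinuousAt u 0)
    (h0 : u 0 = 0) :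
    Tendsto (fun a => (a * (k * (besselI 0 (k * a) / besselI 1 (k * a))) - 1) * u a ^ 2)
      (𝓝[>] 0) (𝓝 0) := by
  have hS : ∀ m, ContinuousAt (fun a : ℝ => besselSeries m ((k * a) ^ 2 / 4)) 0 := fun m => by
    have := (contDiff_besselSeries m).continuous
    fun_prop
  have h1 : ContinuousAt (fun a : ℝ => (2 * (besselSeries 0 ((k * a) ^ 2 / 4) /
      besselSeries 1 ((k * a) ^ 2 / 4)) - 1) * u a ^ 2) 0 :=
    ((((hS 0).div (hS 1) (besselSeries_pos 1 (by positivity)).ne').const_mul 2).sub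
      continuousAt_const).mul (hu.pow 2)
  have h2 := h1.tendsto.mono_left (nhdsWithin_le_nhds (s := Ioi (0 : ℝ)))
  rw [h0, zero_pow two_ne_zero, mul_zero] at h2
  refine h2.congr' ?_
  filter_upwards [self_mem_nhdsWithin] with a ha
  have ha : 0 < a := ha
  have hp := besselSeries_pos 1 (show 0 ≤ (k * a) ^ 2 / 4 by positivity)
  congr 2
  rw [besselI_eq, besselI_eq, pow_zero, pow_one, one_mul]
  field_simp

/-- Since `K₀ ≤ K₁`, the factor multiplying `u²` grows at most linearly; decay of `u` like `1/M` is
then enough. -/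
theorem tendsto_riccati_boundary_atTop {k C : ℝ} (hk : 0 < k) {u : ℝ → ℝ}
    (hu : ∀ M, 0 < M → |u M| ≤ C / M) :
    Tendsto (fun M => (M * (-k * (besselK 0 (k * M) / besselK 1 (k * M))) - 1) * u M ^ 2)
      atTop (𝓝 0) := by
  have hb : Tendsto (fun M : ℝ => k * C ^ 2 * M⁻¹ + C ^ 2 * (M⁻¹) ^ 2) atTop (𝓝 0) := by
    simpa using (tendsto_inv_atTop_zero.const_mul (k * C ^ 2)).add
      ((tendsto_inv_atTop_zero.pow 2).const_mul (C ^ 2))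
  refine squeeze_zero_norm' ?_ hb
  filter_upwards [eventually_gt_atTop 0] with M hM
  have hz : 0 < k * M := by positivity
  have h1 := besselK_one_pos hz
  have h0 := besselK_zero_pos hz
  have hle : besselK 0 (k * M) / besselK 1 (k * M) ≤ 1 :=
    (div_le_one h1).2 (besselK_zero_le_one hz)
  have hge : 0 < besselK 0 (k * M) / besselK 1 (k * M) := by positivity
  set q := besselK 0 (k * M) / besselK 1 (k * M)
  rw [norm_mul, Real.norm_eq_abs, Real.norm_eq_abs, abs_pow]
  have e1 : |M * (-k * q) - 1| ≤ k * M + 1 := by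
    rw [abs_le]
    constructor <;> nlinarith [mul_le_mul_of_nonneg_left hle hz.le, mul_pos hz hge]
  calc _ ≤ (k * M + 1) * (C / M) ^ 2 := by gcongr; exact hu M hM
    _ = _ := by field_simp

/-- The lower bound for the metric of order one. -/
theorem besselMetric_le_sobolevInner {A r : ℝ} (hA : 0 < A) (hr : 0 < r) (S : 𝓢(Plane, Plane))
    (hS : ∀ θ, inner ℝ (S (r • circleCurve 1 θ)) (circleCurve 1 θ) = 1) :
    besselMetric A r ≤ sobolevInner A 1 S S := by
  set k := 1 / √A
  have hk : 0 < k := by positivity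
  have hAk : A * k ^ 2 = 1 := by simp [k, Real.sq_sqrt hA.le, hA.ne']
  have hX : ContDiff ℝ ∞ (S : Plane → Plane) := S.smooth ⊤
  set u := radialMean S
  have hu : ∀ ρ, HasDerivAt u (radialMeanDeriv S ρ) ρ := hasDerivAt_radialMean hX
  have hur : u r = 2 * π := by simpa using radialMean_of_radial hS
  set h : Plane → ℝ := fun x => ‖S x‖ ^ 2 + A * gradSq S x
  have hc : Continuous h := (hX.continuous.norm.pow 2).add ((continuous_gradSq hX).const_smul A)
  have h0 : ∀ x, 0 ≤ h x := fun x => by simp only [h, gradSq]; positivity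
  have hi : Integrable h :=
    (SchwartzMap.integrable_norm_sq S).add ((integrable_gradSq S).const_mul A)
  set e : ℝ → ℝ := fun ρ => 2 * π * ∫ θ in (-π)..π, h (ρ • circleCurve 1 θ)
  have he : Continuous e := continuous_const.mul (continuous_integral_circle
    (G := fun ρ θ => h (ρ • circleCurve 1 θ)) (hc.comp continuous_circleCurve_prod))
  have hle : ∀ ρ, 0 < ρ → u ρ ^ 2 + A * (radialMeanDeriv S ρ ^ 2 + (u ρ / ρ) ^ 2) ≤ e ρ :=
    fun ρ hρ => radialMean_energy_le hX hA hρ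
  set pI : ℝ → ℝ := fun ρ => k * (besselI 0 (k * ρ) / besselI 1 (k * ρ))
  set pK : ℝ → ℝ := fun ρ => -k * (besselK 0 (k * ρ) / besselK 1 (k * ρ))
  -- The inner Riccati solution is used on `[a, r]` and the outer one on `[r, M]`. The difference of
  -- their boundary terms at `r` survives as `a → 0` and `M → ∞`.
  have key : ∀ a M, 0 < a → a ≤ r → r ≤ M →
      (A * ((r * pI r - 1) * u r ^ 2) - A * ((r * pK r - 1) * u r ^ 2)) -
        A * ((a * pI a - 1) * u a ^ 2) + A * ((M * pK M - 1) * u M ^ 2) ≤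
        2 * π * sobolevInner A 1 S S := fun a M ha har hrM => by
    have l1 := picone_le hA hAk ha har (p := pI)
      (fun ρ hρ => hasDerivAt_riccati_besselI hk (ha.trans_le hρ.1)) hu he hle
    have l2 := picone_le hA hAk hr hrM (p := pK)
      (fun ρ hρ => hasDerivAt_riccati_besselK hk (hr.trans_le hρ.1)) hu he hle
    have l3 := intervalIntegral.integral_add_adjacent_intervals
      ((continuous_id.mul he).intervalIntegrable (μ := volume) a r)
      ((continuous_id.mul he).intervalIntegrable (μ := volume) r M)
    have l4 := integral_polar_le hc h0 hi ha.le (har.trans hrM)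
    have l5 : ∫ ρ in a..M, ρ * e ρ =
        2 * π * ∫ ρ in a..M, ρ * ∫ θ in (-π)..π, h (ρ • circleCurve 1 θ) := by
      rw [← intervalIntegral.integral_const_mul]
      refine intervalIntegral.integral_congr fun ρ _ => ?_
      simp only [e]; ring
    rw [sobolevInner_one]
    have l6 := mul_le_mul_of_nonneg_left l4 (show 0 ≤ 2 * π by positivity)
    simp only [Pi.mul_apply, id] at l3
    linarith
  obtain ⟨C, hC0, hC⟩ := S.decay 1 0
  have hdec : ∀ M, 0 < M → |u M| ≤ 2 * π * C / M := fun M hM => by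
    rw [mul_div_assoc]
    refine abs_radialMean_le fun θ => ?_
    have := hC (M • circleCurve 1 θ)
    rw [pow_one, norm_iteratedFDeriv_zero, ← circleCurve_eq_smul, norm_circleCurve hM.le] at this
    rw [le_div_iff₀ hM, mul_comm, ← circleCurve_eq_smul]; exact this
  have lim1 := (tendsto_riccati_boundary_zero hk (hu 0).continuousAt
    (radialMean_zero S)).const_mul A
  have lim2 := (tendsto_riccati_boundary_atTop hk hdec).const_mul A
  rw [mul_zero] at lim1 lim2
  set B := A * ((r * pI r - 1) * u r ^ 2) - A * ((r * pK r - 1) * u r ^ 2)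
  have key2 : ∀ M, r ≤ M → B + A * ((M * pK M - 1) * u M ^ 2) ≤ 2 * π * sobolevInner A 1 S S :=
    fun M hM => by
      have : Tendsto (fun a => B - A * ((a * pI a - 1) * u a ^ 2) + A * ((M * pK M - 1) * u M ^ 2))
          (𝓝[>] 0) (𝓝 (B - 0 + A * ((M * pK M - 1) * u M ^ 2))) :=
        (tendsto_const_nhds.sub lim1).add tendsto_const_nhds
      rw [sub_zero] at this
      refine le_of_tendsto this ?_
      filter_upwards [Ioc_mem_nhdsGT hr] with a ha
      exact key a M ha.1 ha.2 hM
  have key3 : B ≤ 2 * π * sobolevInner A 1 S S := by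
    have : Tendsto (fun M => B + A * ((M * pK M - 1) * u M ^ 2)) atTop (𝓝 (B + 0)) :=
      tendsto_const_nhds.add lim2
    rw [add_zero] at this
    refine le_of_tendsto this ?_
    filter_upwards [eventually_ge_atTop r] with M hM
    exact key2 M hM
  -- Here `u r = 2π`, and the Wronskian reduces `r (pI r - pK r)` to `1 / (I₁ K₁)`.
  have hB : B = 2 * π * besselMetric A r := by
    have hz : 0 < k * r := by positivity
    have w := bessel_wronskian hz
    have h1 := besselI_pos 1 hz
    have h2 := besselK_one_pos hz
    have er : r / √A = k * r := by simp only [k]; ring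
    simp only [B, pI, pK, besselMetric, hur, er]
    generalize besselI 0 (k * r) = a, besselI 1 (k * r) = b, besselK 0 (k * r) = c,
      besselK 1 (k * r) = d at w h1 h2 ⊢
    clear_value k
    field_simp
    linear_combination w
  rw [hB] at key3
  exact le_of_mul_le_mul_left key3 (by positivity)

/-! ### The lower bound for the metric of order two at small circles -/

/-- The divergence of a plane vector field. -/
def divergence (X : Plane → Plane) (x : Plane) : ℝ :=
  partialD 0 X x 0 + partialD 1 X x 1

theorem inner_circleCurve (v : Plane) (θ : ℝ) :
    inner ℝ v (circleCurve 1 θ) = v 0 * cos θ + v 1 * sin θ := by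
  simp [PiLp.inner_apply, circleCurve, mul_comm]

theorem inner_angularVector (v : Plane) (θ : ℝ) :
    inner ℝ v (angularVector θ) = -(v 0 * sin θ) + v 1 * cos θ := by
  simp [PiLp.inner_apply, angularVector, mul_comm]

theorem divergence_eq (X : Plane → Plane) (x : Plane) (θ : ℝ) :
    divergence X x = inner ℝ (fderiv ℝ X x (circleCurve 1 θ)) (circleCurve 1 θ) +
      inner ℝ (fderiv ℝ X x (angularVector θ)) (angularVector θ) := by
  rw [fderiv_circleCurve, fderiv_angularVector, inner_circleCurve, inner_angularVector, divergence]
  simp only [PiLp.add_apply, PiLp.smul_apply, smul_eq_mul]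
  have := sin_sq_add_cos_sq θ
  linear_combination (-partialD 0 X x 0 - partialD 1 X x 1) * this

theorem contDiff_partialD {X : Plane → Plane} (hX : ContDiff ℝ ∞ X) (k : Fin 2) :
    ContDiff ℝ ∞ (partialD k X) :=
  (hX.fderiv_right (by simp)).clm_apply contDiff_const

theorem contDiff_divergence {X : Plane → Plane} (hX : ContDiff ℝ ∞ X) :
    ContDiff ℝ ∞ (divergence X) := by
  have h0 := contDiff_euclidean.1 (contDiff_partialD hX 0) 0
  have h1 := contDiff_euclidean.1 (contDiff_partialD hX 1) 1
  exact h0.add h1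

/-- The Sobolev form contains the mixed derivative in one order only, while the gradient of the
divergence produces both. -/
theorem partialD_comm {X : Plane → Plane} (hX : ContDiff ℝ ∞ X) (x : Plane) :
    partialD 1 (partialD 0 X) x = partialD 0 (partialD 1 X) x := by
  have hs : IsSymmSndFDerivAt ℝ X x := 
    hX.contDiffAt.isSymmSndFDerivAt (by simpa using WithTop.coe_le_coe.2 (le_top (a := (2 : ℕ∞))))
  have hd : DifferentiableAt ℝ (fderiv ℝ X) x :=
    ((hX.fderiv_right (m := ∞) (by simp)).differentiable (by simp)) x
  have h : ∀ k l : Fin 2, partialD k (partialD l X) x =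
      fderiv ℝ (fderiv ℝ X) x (EuclideanSpace.single k 1) (EuclideanSpace.single l 1) :=
    fun k l => by
      change fderiv ℝ (fun y => fderiv ℝ X y (EuclideanSpace.single l 1)) x _ = _
      rw [fderiv_clm_apply hd (differentiableAt_const _)]
      simp
  rw [h, h, hs.eq]

/-- The density of the derivatives of first and second order in the Sobolev energy. -/
def hessianEnergy (X : Plane → Plane) (x : Plane) : ℝ :=
  gradSq X x + (‖partialD 0 (partialD 0 X) x‖ ^ 2 + 2 * ‖partialD 0 (partialD 1 X) x‖ ^ 2 +
    ‖partialD 1 (partialD 1 X) x‖ ^ 2)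

theorem sq_apply_le (v : Plane) (i : Fin 2) : v i ^ 2 ≤ ‖v‖ ^ 2 := by
  rw [sq_le_sq, abs_norm]
  exact PiLp.norm_apply_le v i

theorem sq_divergence_le (X : Plane → Plane) (x : Plane) :
    divergence X x ^ 2 ≤ 4 * hessianEnergy X x := by
  have h0 := sq_apply_le (partialD 0 X x) 0
  have h1 := sq_apply_le (partialD 1 X x) 1
  have : 0 ≤ ‖partialD 0 (partialD 0 X) x‖ ^ 2 + 2 * ‖partialD 0 (partialD 1 X) x‖ ^ 2 +
    ‖partialD 1 (partialD 1 X) x‖ ^ 2 := by positivity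
  rw [hessianEnergy, gradSq, divergence]
  nlinarith [sq_nonneg (partialD 0 X x 0 - partialD 1 X x 1)]

theorem fderiv_divergence {X : Plane → Plane} (hX : ContDiff ℝ ∞ X) (x : Plane) (k : Fin 2) :
    fderiv ℝ (divergence X) x (EuclideanSpace.single k 1) =
      partialD k (partialD 0 X) x 0 + partialD k (partialD 1 X) x 1 := by
  have h : ∀ l : Fin 2, HasFDerivAt (fun y => partialD l X y l)
      ((EuclideanSpace.proj l : Plane →L[ℝ] ℝ).comp (fderiv ℝ (partialD l X) x)) x := fun l =>
    (EuclideanSpace.proj l : Plane →L[ℝ] ℝ).hasFDerivAt.comp x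
      ((contDiff_partialD hX l).differentiable (by simp) x).hasFDerivAt
  have := ((h 0).add (h 1)).fderiv
  change fderiv ℝ ((fun y => partialD 0 X y 0) + fun y => partialD 1 X y 1) x _ = _
  rw [this]
  rfl

theorem sq_fderiv_divergence_le {X : Plane → Plane} (hX : ContDiff ℝ ∞ X) (x : Plane) (θ : ℝ) :
    fderiv ℝ (divergence X) x (circleCurve 1 θ) ^ 2 ≤ 4 * hessianEnergy X x := by
  rw [circleCurve_one_eq, map_add, map_smul, map_smul, fderiv_divergence hX, fderiv_divergence hX,
    partialD_comm hX, hessianEnergy, gradSq]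
  have h1 := sq_apply_le (partialD 0 (partialD 0 X) x) 0
  have h2 := sq_apply_le (partialD 0 (partialD 1 X) x) 1
  have h3 := sq_apply_le (partialD 0 (partialD 1 X) x) 0
  have h4 := sq_apply_le (partialD 1 (partialD 1 X) x) 1
  have h5 : 0 ≤ ‖partialD 0 X x‖ ^ 2 + ‖partialD 1 X x‖ ^ 2 := by positivity
  simp only [smul_eq_mul]
  generalize partialD 0 (partialD 0 X) x 0 = a at *
  generalize partialD 0 (partialD 1 X) x 1 = b at *
  generalize partialD 0 (partialD 1 X) x 0 = c at *
  generalize partialD 1 (partialD 1 X) x 1 = d at *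
  have e1 : (cos θ * (a + b) + sin θ * (c + d)) ^ 2 ≤ (a + b) ^ 2 + (c + d) ^ 2 := by
    have := sin_sq_add_cos_sq θ
    nlinarith [sq_nonneg (sin θ * (a + b) - cos θ * (c + d))]
  nlinarith [sq_nonneg (a - b), sq_nonneg (c - d)]

theorem continuous_hessianEnergy {X : Plane → Plane} (hX : ContDiff ℝ ∞ X) :
    Continuous (hessianEnergy X) := by
  have h := fun k l => (continuous_partialD (contDiff_partialD hX l) k).norm.pow 2
  exact (continuous_gradSq hX).add
    (((h 0 0).add (continuous_const.mul (h 0 1))).add (h 1 1))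

/-- The second-order weights 1, 2, 1 are the multinomial ones of `H²`, which appear with the factor
`A²`; the first-order terms carry `2A`. -/
theorem integrable_hessianEnergy (S : 𝓢(Plane, Plane)) : Integrable (hessianEnergy S) ∧
    ∀ A : ℝ, 0 < A → min A (A ^ 2) * ∫ x, hessianEnergy S x ≤ sobolevInner A 2 S S := by
  have hi : ∀ i j, Integrable fun x => ‖(partialD 0)^[i] ((partialD 1)^[j] S) x‖ ^ 2 := fun i j => by
    obtain ⟨T, hT⟩ := exists_partialD_iterate₂ S i j
    rw [hT]; exact SchwartzMap.integrable_norm_sq T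
  have h1 : Integrable fun x => ‖partialD 0 S x‖ ^ 2 + ‖partialD 1 S x‖ ^ 2 :=
    (hi 1 0).add (hi 0 1)
  have h2 : Integrable fun x => ‖partialD 0 (partialD 0 S) x‖ ^ 2 +
      2 * ‖partialD 0 (partialD 1 S) x‖ ^ 2 := (hi 2 0).add ((hi 1 1).const_mul 2)
  have h3 : Integrable fun x => ‖partialD 0 (partialD 0 S) x‖ ^ 2 +
      2 * ‖partialD 0 (partialD 1 S) x‖ ^ 2 + ‖partialD 1 (partialD 1 S) x‖ ^ 2 :=
    h2.add (hi 0 2)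
  refine ⟨h1.add h3, fun A hA => ?_⟩
  have e : ∫ x, hessianEnergy S x = derivEnergy 1 0 S + derivEnergy 0 1 S +
      (derivEnergy 2 0 S + 2 * derivEnergy 1 1 S + derivEnergy 0 2 S) := by
    simp only [hessianEnergy, gradSq]
    have i00 : Integrable fun x => ‖partialD 0 (partialD 0 S) x‖ ^ 2 := hi 2 0
    have i01 : Integrable fun x => ‖partialD 0 (partialD 1 S) x‖ ^ 2 := hi 1 1
    have i11 : Integrable fun x => ‖partialD 1 (partialD 1 S) x‖ ^ 2 := hi 0 2
    have i0 : Integrable fun x => ‖partialD 0 S x‖ ^ 2 := hi 1 0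
    have i1 : Integrable fun x => ‖partialD 1 S x‖ ^ 2 := hi 0 1
    rw [integral_add h1 h3, integral_add h2 i11, integral_add i00 (i01.const_mul 2),
      integral_add i0 i1, integral_const_mul]
    rfl
  have e2 : sobolevInner A 2 S S = derivEnergy 0 0 S + 2 * A * (derivEnergy 1 0 S +
      derivEnergy 0 1 S) +
      A ^ 2 * (derivEnergy 2 0 S + 2 * derivEnergy 1 1 S + derivEnergy 0 2 S) := by
    rw [sobolevInner_self]
    simp [Finset.sum_range_succ, Nat.factorial]
    ring
  rw [e, e2]
  have p0 := derivEnergy_nonneg 0 0 S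
  have p1 := add_nonneg (derivEnergy_nonneg 1 0 S) (derivEnergy_nonneg 0 1 S)
  have p2 := add_nonneg (add_nonneg (derivEnergy_nonneg 2 0 S)
    (mul_nonneg zero_le_two (derivEnergy_nonneg 1 1 S))) (derivEnergy_nonneg 0 2 S)
  have m1 := mul_le_mul_of_nonneg_right (min_le_left A (A ^ 2)) p1
  have m2 := mul_le_mul_of_nonneg_right (min_le_right A (A ^ 2)) p2
  nlinarith [mul_nonneg hA.le p1]

/-- If `D` and `D'` are bounded in `L²(ρ dρ)` and `(ρ f)' = ρ D`, then `f` vanishes at the origin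
at least as fast as `ρ √(log (1/ρ))`. -/
theorem sq_le_of_divergence_bound {f f' D D' : ℝ → ℝ} {B r : ℝ} (hr : 0 < r) (hr1 : r ≤ 1)
    (hf : ∀ ρ, HasDerivAt f (f' ρ) ρ) (hD : ∀ ρ, HasDerivAt D (D' ρ) ρ)
    (hD' : Continuous D') (hfD : ∀ ρ, ρ * D ρ = ρ * f' ρ + f ρ)
    (h1 : ∀ a b, 0 ≤ a → a ≤ b → ∫ ρ in a..b, ρ * D ρ ^ 2 ≤ B)
    (h2 : ∀ a b, 0 ≤ a → a ≤ b → ∫ ρ in a..b, ρ * D' ρ ^ 2 ≤ B) :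
    f r ^ 2 ≤ r ^ 2 * (2 + log (2 / r)) * B := by
  have cD : Continuous D := continuous_iff_continuousAt.2 fun ρ => (hD ρ).continuousAt
  have hB : 0 ≤ B := by simpa using h1 0 0 le_rfl le_rfl
  have hDr : D r ^ 2 ≤ 2 * B + 2 * (B * log (2 / r)) := by
    -- `D r` is compared with `D τ` by weighted Cauchy-Schwarz, where `∫ dρ/ρ` produces the
    -- logarithm. Averaging over `τ ∈ [1, 2]` then replaces the unknown value `D τ` by the `L²`
    -- bound.
    have step : ∀ τ ∈ Icc (1 : ℝ) 2,
        D r ^ 2 ≤ 2 * (τ * D τ ^ 2) + 2 * (B * log (2 / r)) := fun τ hτ => by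
      have hrτ : r ≤ τ := hr1.trans hτ.1
      have ftc : ∫ ρ in r..τ, D' ρ = D τ - D r :=
        intervalIntegral.integral_eq_sub_of_hasDerivAt (fun ρ _ => hD ρ)
          (hD'.intervalIntegrable _ _)
      have cs := sq_integral_mul_le (w := fun ρ => ρ) (φ := fun ρ => ρ⁻¹) (ψ := D') hrτ
        continuousOn_id (continuousOn_inv₀.mono fun ρ hρ => (hr.trans_le hρ.1).ne')
        hD'.continuousOn (fun ρ hρ => hr.le.trans hρ.1)
      have e1 : ∫ ρ in r..τ, ρ * (ρ⁻¹ * D' ρ) = D τ - D r := by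
        rw [← ftc]
        refine intervalIntegral.integral_congr fun ρ hρ => ?_
        rw [uIcc_of_le hrτ] at hρ
        have : ρ ≠ 0 := (hr.trans_le hρ.1).ne'
        field_simp
      have e2 : ∫ ρ in r..τ, ρ * ρ⁻¹ ^ 2 = log (τ / r) := by
        rw [← integral_inv_of_pos hr (hr.trans_le hrτ)]
        refine intervalIntegral.integral_congr fun ρ hρ => ?_
        rw [uIcc_of_le hrτ] at hρ
        have : ρ ≠ 0 := (hr.trans_le hρ.1).ne'
        field_simp
      rw [e1, e2] at cs
      have l1 : log (τ / r) ≤ log (2 / r) :=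
        log_le_log (div_pos (hr.trans_le hrτ) hr) (by gcongr; exact hτ.2)
      have l0 : 0 ≤ log (τ / r) := log_nonneg ((one_le_div hr).2 hrτ)
      have l2 : log (τ / r) * ∫ ρ in r..τ, ρ * D' ρ ^ 2 ≤ log (2 / r) * B :=
        mul_le_mul l1 (h2 r τ hr.le hrτ) (intervalIntegral.integral_nonneg hrτ fun ρ hρ =>
          mul_nonneg (hr.le.trans hρ.1) (sq_nonneg _)) (l0.trans l1)
      nlinarith [sq_nonneg (D τ + (D τ - D r)), mul_nonneg (sub_nonneg.2 hτ.1) (sq_nonneg (D τ))]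
    have c1 : Continuous fun τ => 2 * (τ * D τ ^ 2) := by fun_prop
    have c2 : Continuous fun τ => 2 * (τ * D τ ^ 2) + 2 * (B * log (2 / r)) := by fun_prop
    have := intervalIntegral.integral_mono_on (μ := volume) (show (1 : ℝ) ≤ 2 by norm_num)
      intervalIntegrable_const (c2.intervalIntegrable _ _) step
    rw [intervalIntegral.integral_add (c1.intervalIntegrable _ _) intervalIntegrable_const,
      intervalIntegral.integral_const_mul] at this
    simp only [intervalIntegral.integral_const, smul_eq_mul] at this
    have := h1 1 2 zero_le_one one_le_two
    linarith
  -- Since `(ρ f)' = ρ D`, the derivative of `ρ² D - 2 ρ f` is `ρ² D'`. Thus `2 r f(r)` differs from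
  -- `r² D(r)` by a term controlled by `D'` alone.
  have ftc : ∫ ρ in (0 : ℝ)..r, ρ * (ρ * D' ρ) = r ^ 2 * D r - 2 * (r * f r) := by
    have hd : ∀ ρ ∈ uIcc 0 r, HasDerivAt (fun ρ => ρ ^ 2 * D ρ - 2 * (ρ * f ρ))
        (ρ * (ρ * D' ρ)) ρ := fun ρ _ => by
      refine (((hasDerivAt_pow 2 ρ).mul (hD ρ)).sub
        (((hasDerivAt_id ρ).mul (hf ρ)).const_mul 2)).congr_deriv ?_
      have := hfD ρ
      simp only [id, Nat.cast_ofNat, one_mul]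
      linear_combination (2 : ℝ) * this
    have c : Continuous fun ρ => ρ * (ρ * D' ρ) := by fun_prop
    rw [intervalIntegral.integral_eq_sub_of_hasDerivAt hd (c.intervalIntegrable _ _)]
    ring
  have cs := sq_integral_mul_le (w := fun ρ => ρ) (φ := fun ρ => ρ) (ψ := D') hr.le
    continuousOn_id continuousOn_id hD'.continuousOn (fun ρ hρ => hρ.1)
  have e2 : ∫ ρ in (0 : ℝ)..r, ρ * ρ ^ 2 = r ^ 4 / 4 := by
    simp only [← pow_succ', integral_pow]
    norm_num
  rw [ftc, e2] at cs
  have l3 : r ^ 4 / 4 * ∫ ρ in (0 : ℝ)..r, ρ * D' ρ ^ 2 ≤ r ^ 4 / 4 * B := by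
    gcongr; exact h2 0 r le_rfl hr.le
  have l4 : (2 * (r * f r)) ^ 2 ≤ 2 * (r ^ 4 * D r ^ 2) + 2 * (r ^ 4 / 4 * B) := by
    nlinarith [sq_nonneg (r ^ 2 * D r + (r ^ 2 * D r - 2 * (r * f r)))]
  have l5 : r ^ 4 * D r ^ 2 ≤ r ^ 4 * (2 * B + 2 * (B * log (2 / r))) := by gcongr
  have l6 : r ^ 2 * f r ^ 2 ≤ r ^ 2 * (r ^ 2 * (2 + log (2 / r)) * B) := by
    nlinarith [mul_nonneg (pow_nonneg hr.le 4) hB]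
  exact le_of_mul_le_mul_left l6 (by positivity)

theorem sq_radialMean_le (S : 𝓢(Plane, Plane)) {r : ℝ} (hr : 0 < r) (hr1 : r ≤ 1) :
    radialMean S r ^ 2 ≤ r ^ 2 * (2 + log (2 / r)) * (8 * π * ∫ x, hessianEnergy S x) := by
  have hX : ContDiff ℝ ∞ (S : Plane → Plane) := S.smooth ⊤
  have hg := contDiff_divergence hX
  have cg' : Continuous fun p : ℝ × ℝ =>
      fderiv ℝ (divergence S) (p.1 • circleCurve 1 p.2) (circleCurve 1 p.2) :=
    ((hg.continuous_fderiv (by simp)).comp continuous_circleCurve_prod).clm_apply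
      (continuous_circleCurve_one.comp continuous_snd)
  have cg : Continuous fun p : ℝ × ℝ => divergence S (p.1 • circleCurve 1 p.2) :=
    hg.continuous.comp continuous_circleCurve_prod
  have cH := continuous_hessianEnergy hX
  have hH := (integrable_hessianEnergy S).1
  have cH2 : Continuous fun p : ℝ × ℝ => hessianEnergy S (p.1 • circleCurve 1 p.2) :=
    cH.comp continuous_circleCurve_prod
  have cs : ∀ ρ : ℝ, Continuous fun θ : ℝ => ((ρ, θ) : ℝ × ℝ) := fun ρ => by fun_prop
  -- The constant `8π` is `2π` from Cauchy-Schwarz on the circle times the 4 in the pointwise bounds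
  -- for the divergence and its gradient.
  have hbound : ∀ G : ℝ → ℝ → ℝ, (Continuous fun p : ℝ × ℝ => G p.1 p.2) →
      (∀ ρ θ, G ρ θ ^ 2 ≤ 4 * hessianEnergy S (ρ • circleCurve 1 θ)) → ∀ a b, 0 ≤ a → a ≤ b →
      ∫ ρ in a..b, ρ * (∫ θ in (-π)..π, G ρ θ) ^ 2 ≤ 8 * π * ∫ x, hessianEnergy S x := by
    intro G cG hG a b ha hab
    have hpol := integral_polar_le cH (fun x => by simp only [hessianEnergy, gradSq]; positivity)
      hH ha hab
    refine le_trans ?_ (mul_le_mul_of_nonneg_left hpol (by positivity))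
    rw [← intervalIntegral.integral_const_mul]
    have c1 := continuous_integral_circle cG
    have c2 := continuous_integral_circle (G := fun ρ θ => hessianEnergy S (ρ • circleCurve 1 θ)) cH2
    refine intervalIntegral.integral_mono_on hab
      ((continuous_id.mul (c1.pow 2)).intervalIntegrable _ _)
      ((continuous_const.mul (continuous_id.mul c2)).intervalIntegrable _ _) fun ρ hρ => ?_
    have h1 := sq_integral_circle_le (cG.comp (cs ρ))
    have h2 : ∫ θ in (-π)..π, G ρ θ ^ 2 ≤
        ∫ θ in (-π)..π, 4 * hessianEnergy S (ρ • circleCurve 1 θ) :=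
      intervalIntegral.integral_mono_on (by linarith [pi_pos])
        (((cG.comp (cs ρ)).pow 2).intervalIntegrable _ _)
        ((continuous_const.mul (cH2.comp (cs ρ))).intervalIntegrable _ _) fun θ _ => hG ρ θ
    rw [intervalIntegral.integral_const_mul] at h2
    have hρ0 : 0 ≤ ρ := ha.trans hρ.1
    simp only [Function.comp_def] at h1
    calc ρ * (∫ θ in (-π)..π, G ρ θ) ^ 2 ≤ ρ * (2 * π * (4 * ∫ θ in (-π)..π,
          hessianEnergy S (ρ • circleCurve 1 θ))) := by
            refine mul_le_mul_of_nonneg_left (h1.trans ?_) hρ0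
            exact mul_le_mul_of_nonneg_left h2 (by positivity)
      _ = _ := by ring
  refine sq_le_of_divergence_bound (f' := radialMeanDeriv S)
    (D := fun ρ => ∫ θ in (-π)..π, divergence S (ρ • circleCurve 1 θ))
    (D' := fun ρ => ∫ θ in (-π)..π,
      fderiv ℝ (divergence S) (ρ • circleCurve 1 θ) (circleCurve 1 θ)) hr hr1
    (hasDerivAt_radialMean hX) (fun ρ => ?_) (continuous_integral_circle cg') (fun ρ => ?_)
    (hbound _ cg fun ρ θ => sq_divergence_le _ _)
    (hbound _ cg' fun ρ θ => sq_fderiv_divergence_le hX _ _)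
  · refine hasDerivAt_integral_circle (G := fun ρ θ => divergence S (ρ • circleCurve 1 θ))
      (G' := fun ρ θ => fderiv ℝ (divergence S) (ρ • circleCurve 1 θ) (circleCurve 1 θ)) cg cg'
      (fun ρ θ => ?_) ρ
    have h := (hg.differentiable (by simp) (ρ • circleCurve 1 θ)).hasFDerivAt
    have h2 : HasDerivAt (fun s : ℝ => s • circleCurve 1 θ) (circleCurve 1 θ) ρ := by
      simpa using (hasDerivAt_id ρ).smul_const (circleCurve 1 θ)
    exact h.comp_hasDerivAt ρ h2
  · have c := continuous_circleCurve_one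
    have c' := continuous_angularVector
    have c2 : Continuous fun θ => fderiv ℝ S (ρ • circleCurve 1 θ) :=
      (continuous_fderiv_circle hX).comp (cs ρ)
    have e : ∫ θ in (-π)..π, divergence S (ρ • circleCurve 1 θ) = radialMeanDeriv S ρ +
        ∫ θ in (-π)..π, inner ℝ (fderiv ℝ S (ρ • circleCurve 1 θ) (angularVector θ))
          (angularVector θ) := by
      rw [radialMeanDeriv, ← intervalIntegral.integral_add
        (((c2.clm_apply c).inner c).intervalIntegrable _ _)
        (((c2.clm_apply c').inner c').intervalIntegrable _ _)]
      exact intervalIntegral.integral_congr fun θ _ => divergence_eq _ _ _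
    rw [e, mul_add, integral_angular_eq hX]

/-- The lower bound for the metric of order two at small circles. -/
theorem sobolevInner_two_ge {A : ℝ} (hA : 0 < A) : ∃ c : ℝ, 0 < c ∧
    ∀ (S : 𝓢(Plane, Plane)) (r : ℝ), 0 < r → r ≤ 1 →
      (∀ θ, inner ℝ (S (r • circleCurve 1 θ)) (circleCurve 1 θ) = 1) →
      c ^ 2 / (r ^ 2 * (2 + log (2 / r))) ≤ sobolevInner A 2 S S := by
  have hm : 0 < min A (A ^ 2) := lt_min hA (by positivity)
  -- With circle integral `2π`, the estimate reads `4π² ≤ 8π (...) ∫ hessianEnergy`, whence `π/2`;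
  -- the minimum converts the Hessian energy into `H²`.
  refine ⟨√(min A (A ^ 2) * π / 2), by positivity, fun S r hr hr1 hS => ?_⟩
  rw [Real.sq_sqrt (by positivity)]
  have h := sq_radialMean_le S hr hr1
  rw [radialMean_of_radial hS, mul_one] at h
  have hlog : 0 < log (2 / r) := log_pos ((one_lt_div hr).2 (by linarith))
  have hH := (integrable_hessianEnergy S).2 A hA
  rw [div_le_iff₀ (by positivity)]
  have h' : π / 2 ≤ r ^ 2 * (2 + log (2 / r)) * ∫ x, hessianEnergy S x := by
    nlinarith [pi_pos]
  calc min A (A ^ 2) * π / 2 = min A (A ^ 2) * (π / 2) := by ring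
    _ ≤ min A (A ^ 2) * (r ^ 2 * (2 + log (2 / r)) * ∫ x, hessianEnergy S x) := by gcongr
    _ = (min A (A ^ 2) * ∫ x, hessianEnergy S x) * (r ^ 2 * (2 + log (2 / r))) := by ring
    _ ≤ _ := by gcongr

/-! ### Radial fields and the two Euler-Lagrange profiles, in the variable `u = |x|²` -/

section

/-- The radial field `φ(|x|²) x`. -/
def radialField (φ : ℝ → ℝ) (x : Plane) : Plane := φ (‖x‖ ^ 2) • x

/-- The energy density of a radial field `φ(u) x` with respect to `u = |x|²`, `φ'` being the
derivative of `φ`. -/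
def radialEnergy (A : ℝ) (φ φ' : ℝ → ℝ) (u : ℝ) : ℝ :=
  u * φ u ^ 2 + A * ((φ u + 2 * u * φ' u) ^ 2 + φ u ^ 2)

theorem contDiff_radialField {φ : ℝ → ℝ} (hφ : ContDiff ℝ ∞ φ) : ContDiff ℝ ∞ (radialField φ) :=
  (hφ.comp (contDiff_norm_sq ℝ)).smul contDiff_id

theorem hasCompactSupport_radialField {φ : ℝ → ℝ} {M : ℝ} (hM : ∀ u, M ≤ u → φ u = 0) :
    HasCompactSupport (radialField φ) := by
  refine HasCompactSupport.intro (isCompact_closedBall (0 : Plane) (√M)) fun x hx => ?_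
  rw [mem_closedBall_zero_iff, not_le, Real.sqrt_lt' (by
    by_contra h
    exact absurd (hx.trans_le (not_lt.1 h)) (not_lt.2 (Real.sqrt_nonneg M)))] at hx
  rw [radialField, hM _ hx.le, zero_smul]

/-- The differential is `φ Id + 2 φ' x ⊗ x`, with eigenvalue `φ + 2uφ'` in the radial direction and
`φ` in the tangential one. -/
theorem gradSq_radialField {φ : ℝ → ℝ} (hφ : ContDiff ℝ ∞ φ) (x : Plane) :
    gradSq (radialField φ) x =
      (φ (‖x‖ ^ 2) + 2 * ‖x‖ ^ 2 * deriv φ (‖x‖ ^ 2)) ^ 2 + φ (‖x‖ ^ 2) ^ 2 := by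
  have hp : ∀ k, partialD k (radialField φ) x =
      φ (‖x‖ ^ 2) • EuclideanSpace.single k (1 : ℝ) +
        (deriv φ (‖x‖ ^ 2) * (2 * x k)) • x := fun k => by
    have h1 : HasFDerivAt (fun y : Plane => φ (‖y‖ ^ 2))
        (deriv φ (‖x‖ ^ 2) • (2 • innerSL ℝ x)) x :=
      ((hφ.differentiable (by simp) (‖x‖ ^ 2)).hasDerivAt).comp_hasFDerivAt x
        (hasStrictFDerivAt_norm_sq x).hasFDerivAt
    have h2 := (h1.smul (hasFDerivAt_id x)).fderiv
    change fderiv ℝ ((fun y : Plane => φ (‖y‖ ^ 2)) • id) x _ = _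
    rw [h2]
    simp [EuclideanSpace.inner_single_right]
  have e : ‖x‖ ^ 2 = x 0 ^ 2 + x 1 ^ 2 := by
    rw [EuclideanSpace.norm_sq_eq]; simp [Fin.sum_univ_two]
  rw [gradSq, hp, hp]
  generalize φ (‖x‖ ^ 2) = a, deriv φ (‖x‖ ^ 2) = b
  rw [EuclideanSpace.norm_sq_eq, EuclideanSpace.norm_sq_eq, e]
  simp [Fin.sum_univ_two]
  ring

/-- Polar coordinates with `ρ dρ = du / 2`: the angular factor `2π` becomes `π`. -/
theorem integral_norm_sq (g : ℝ → ℝ) :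
    ∫ x : Plane, g (‖x‖ ^ 2) = π * ∫ u in Ioi (0 : ℝ), g u := by
  have h1 := integral_fun_norm_addHaar (volume : Measure Plane) (fun y => g (y ^ 2))
  rw [h1, ← integral_comp_rpow_Ioi_of_pos (g := g) (p := 2) two_pos]
  have hv : (volume : Measure Plane).real (Metric.ball 0 1) = π := by
    rw [measureReal_def, EuclideanSpace.volume_ball]
    simp
    norm_num [Real.Gamma_two, Real.sq_sqrt pi_pos.le, ENNReal.toReal_ofReal pi_pos.le]
  rw [hv]
  simp only [finrank_euclideanSpace, Fintype.card_fin, smul_eq_mul, nsmul_eq_mul]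
  rw [← mul_assoc, mul_comm _ π, mul_assoc, ← integral_const_mul]
  congr 1
  refine integral_congr_ae (Eventually.of_forall fun y => ?_)
  norm_num
  ring

theorem sobolevInner_radialField (A : ℝ) {φ : ℝ → ℝ} (hφ : ContDiff ℝ ∞ φ) {M : ℝ}
    (hM : ∀ u, M ≤ u → φ u = 0) :
    sobolevInner A 1 (radialField φ) (radialField φ) =
      π * ∫ u in Ioi (0 : ℝ), radialEnergy A φ (deriv φ) u := by
  have := sobolevInner_one A
    ((hasCompactSupport_radialField hM).toSchwartzMap (contDiff_radialField hφ))
  change sobolevInner A 1 (radialField φ) (radialField φ) =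
    ∫ x, (‖radialField φ x‖ ^ 2 + A * gradSq (radialField φ) x) at this
  rw [this, ← integral_norm_sq]
  refine integral_congr_ae (Eventually.of_forall fun x => ?_)
  simp only
  rw [gradSq_radialField hφ, radialEnergy, radialField, norm_smul, mul_pow, norm_eq_abs, sq_abs]
  ring

theorem radialField_mem_radialFields (𝔛 : FieldClass) {φ : ℝ → ℝ} (hφ : ContDiff ℝ ∞ φ) {M : ℝ}
    (hM : ∀ u, M ≤ u → φ u = 0) {r : ℝ} (hr : 0 < r) (h1 : φ (r ^ 2) * r = 1) :
    radialField φ ∈ radialFields 𝔛 r 1 := by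
  refine ⟨mem_fields_of_compactSupport 𝔛 (contDiff_radialField hφ)
    (hasCompactSupport_radialField hM), fun θ => ?_⟩
  rw [radialField, ← circleCurve_eq_smul, norm_circleCurve hr.le, circleCurve_eq_smul, smul_smul,
    h1, one_smul, inner_circleCurve_one]

/-- For a solution of the Euler-Lagrange system, the energy density is a derivative. -/
theorem hasDerivAt_radialEnergy {A k u : ℝ} (hk : A * k ^ 2 = 1) {φ φ' d : ℝ → ℝ}
    (hφ : HasDerivAt φ (φ' u) u) (hd : HasDerivAt d (k ^ 2 / 2 * φ u) u)
    (hdφ : d u = 2 * φ u + 2 * u * φ' u) :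
    HasDerivAt (fun u => 2 * A * (u * φ u * (d u - φ u))) (radialEnergy A φ φ' u) u := by
  -- `d` is the divergence of the field `φ(|x|²) x`. A radial field is a gradient, so the equation
  -- `A ΔX = X` says `A ∇d = X`, which is `d' = k² φ / 2`.
  refine ((((hasDerivAt_id u).mul hφ).mul (hd.sub hφ)).const_mul (2 * A)).congr_deriv ?_
  simp only [radialEnergy, id, Pi.mul_apply, Pi.sub_apply, hdφ]
  linear_combination (u * φ u ^ 2) * hk

/-- The regular solution of the Euler-Lagrange equation. -/
def innerProfile (k r u : ℝ) : ℝ :=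
  besselSeries 1 (k ^ 2 * u / 4) / (r * besselSeries 1 (k ^ 2 * r ^ 2 / 4))

/-- The derivative of `innerProfile`. -/
def innerProfileDeriv (k r u : ℝ) : ℝ :=
  k ^ 2 / 4 * besselSeries 2 (k ^ 2 * u / 4) / (r * besselSeries 1 (k ^ 2 * r ^ 2 / 4))

/-- The divergence of the field with profile `innerProfile`. -/
def innerDivergence (k r u : ℝ) : ℝ :=
  2 * besselSeries 0 (k ^ 2 * u / 4) / (r * besselSeries 1 (k ^ 2 * r ^ 2 / 4))

/-- The decaying solution of the Euler-Lagrange equation. -/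
def outerProfile (k r u : ℝ) : ℝ := besselK 1 (k * √u) / √u / besselK 1 (k * r)

/-- The divergence of the field with profile `outerProfile`. -/
def outerDivergence (k r u : ℝ) : ℝ := -k * besselK 0 (k * √u) / besselK 1 (k * r)

/-- The derivative of `outerProfile`. -/
def outerProfileDeriv (k r u : ℝ) : ℝ :=
  (outerDivergence k r u - 2 * outerProfile k r u) / (2 * u)

theorem hasDerivAt_innerProfile (k r u : ℝ) :
    HasDerivAt (innerProfile k r) (innerProfileDeriv k r u) u := by
  have h : HasDerivAt (fun u => k ^ 2 * u / 4) (k ^ 2 / 4) u := by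
    simpa using ((hasDerivAt_id u).const_mul (k ^ 2)).div_const 4
  refine (((hasDerivAt_besselSeries 1 _).comp u h).div_const _).congr_deriv ?_
  rw [innerProfileDeriv]; ring

theorem hasDerivAt_innerDivergence (k r u : ℝ) :
    HasDerivAt (innerDivergence k r) (k ^ 2 / 2 * innerProfile k r u) u := by
  have h : HasDerivAt (fun u => k ^ 2 * u / 4) (k ^ 2 / 4) u := by
    simpa using ((hasDerivAt_id u).const_mul (k ^ 2)).div_const 4
  refine ((((hasDerivAt_besselSeries 0 _).comp u h).const_mul 2).div_const _).congr_deriv ?_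
  rw [innerProfile]; ring

theorem innerDivergence_eq (k r u : ℝ) :
    innerDivergence k r u = 2 * innerProfile k r u + 2 * u * innerProfileDeriv k r u := by
  have := besselSeries_recurrence 0 (k ^ 2 * u / 4)
  simp only [zero_add, Nat.cast_zero, one_mul] at this
  rw [innerDivergence, innerProfile, innerProfileDeriv, ← this]
  ring

theorem contDiff_innerProfile (k r : ℝ) : ContDiff ℝ ∞ (innerProfile k r) := by
  have := (contDiff_besselSeries 1).comp
    (by fun_prop : ContDiff ℝ ∞ fun u : ℝ => k ^ 2 * u / 4)
  exact this.div_const _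

theorem continuous_innerProfileDeriv (k r : ℝ) : Continuous (innerProfileDeriv k r) := by
  have := (contDiff_besselSeries 2).continuous
  unfold innerProfileDeriv
  fun_prop

variable {k r : ℝ}

theorem innerProfile_sq (hr : 0 < r) : innerProfile k r (r ^ 2) = r⁻¹ := by
  have := besselSeries_pos 1 (show 0 ≤ k ^ 2 * r ^ 2 / 4 by positivity)
  rw [innerProfile]; field_simp

theorem outerProfile_sq (hk : 0 < k) (hr : 0 < r) : outerProfile k r (r ^ 2) = r⁻¹ := by
  have := besselK_one_pos (show 0 < k * r by positivity)
  rw [outerProfile, Real.sqrt_sq hr.le]; field_simp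

theorem hasDerivAt_mul_sqrt {u : ℝ} (hu : 0 < u) :
    HasDerivAt (fun u => k * √u) (k / (2 * √u)) u := by
  refine ((Real.hasDerivAt_sqrt hu.ne').const_mul k).congr_deriv ?_
  ring

theorem hasDerivAt_outerDivergence (hk : 0 < k) {u : ℝ} (hu : 0 < u) :
    HasDerivAt (outerDivergence k r) (k ^ 2 / 2 * outerProfile k r u) u := by
  refine ((((hasDerivAt_besselK_zero (show 0 < k * √u by positivity)).comp u
    (hasDerivAt_mul_sqrt hu)).const_mul (-k)).div_const _).congr_deriv ?_
  rw [outerProfile]; ring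

/-- `outerProfileDeriv` is defined by solving `d = 2φ + 2uφ'` for `φ'`, so `outerDivergence_eq` is
mere algebra; the formula for the derivative of `K₁` enters here. -/
theorem hasDerivAt_outerProfile (hk : 0 < k) {u : ℝ} (hu : 0 < u) :
    HasDerivAt (outerProfile k r) (outerProfileDeriv k r u) u := by
  have hs : 0 < √u := Real.sqrt_pos.2 hu
  refine ((((hasDerivAt_besselK_one (show 0 < k * √u by positivity)).comp u
    (hasDerivAt_mul_sqrt hu)).div (Real.hasDerivAt_sqrt hu.ne') hs.ne').div_const _).congr_deriv ?_
  rw [outerProfileDeriv, outerDivergence, outerProfile]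
  have e : u = √u ^ 2 := (Real.sq_sqrt hu.le).symm
  simp only [Function.comp]
  generalize √u = s at *
  subst e
  generalize besselK 0 (k * s) = a, besselK 1 (k * s) = b, besselK 1 (k * r) = c
  -- Nothing is assumed about `r`, so the normalizing value may be zero; all quotients by it are
  -- then zero.
  rcases eq_or_ne c 0 with rfl | hc
  · simp
  · field_simp
    ring

theorem outerDivergence_eq {u : ℝ} (hu : u ≠ 0) :
    outerDivergence k r u = 2 * outerProfile k r u + 2 * u * outerProfileDeriv k r u := by
  rw [outerProfileDeriv]; field_simp; ring

theorem contDiffOn_outerProfile (hk : 0 < k) : ContDiffOn ℝ ∞ (outerProfile k r) (Ioi 0) := by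
  have hs : ContDiffOn ℝ ∞ (fun u : ℝ => √u) (Ioi 0) :=
    contDiffOn_id.sqrt fun u hu => ne_of_gt hu
  have h1 : ContDiffOn ℝ ∞ (fun u => besselK 1 (k * √u)) (Ioi 0) := by
    rw [besselK_one]
    exact (contDiffOn_coshMoment 1).comp (contDiffOn_const.mul hs)
      fun _ hu => mul_pos hk (Real.sqrt_pos.2 hu)
  exact (h1.div hs fun _ hu => (Real.sqrt_pos.2 hu).ne').div_const _

theorem outerProfile_nonneg (hk : 0 < k) (hr : 0 < r) {u : ℝ} (hu : 0 < u) :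
    0 < outerProfile k r u := by
  have h1 := besselK_one_pos (show 0 < k * √u by positivity)
  have h2 := besselK_one_pos (show 0 < k * r by positivity)
  rw [outerProfile]
  positivity

theorem continuousOn_outerDivergence (hk : 0 < k) : ContinuousOn (outerDivergence k r) (Ioi 0) :=
  fun _ hu => (hasDerivAt_outerDivergence hk hu).continuousAt.continuousWithinAt

theorem continuousOn_outerProfileDeriv (hk : 0 < k) :
    ContinuousOn (outerProfileDeriv k r) (Ioi 0) :=
  ((continuousOn_outerDivergence hk).sub (continuousOn_const.mul
    (contDiffOn_outerProfile hk).continuousOn)).div (continuousOn_const.mul continuousOn_id)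
      fun _ hu => (mul_pos two_pos hu).ne'

/-- With `q = K₁(k√u) / K₁(kr)`, the product is at most a constant times `√u q²`, and `q` decays
exponentially in `√u`. -/
theorem tendsto_outer_boundary (hk : 0 < k) (hr : 0 < r) :
    Tendsto (fun u => u * outerProfile k r u * (outerDivergence k r u - outerProfile k r u))
      atTop (𝓝 0) := by
  set z₀ := k * r
  have hz₀ : 0 < z₀ := by positivity
  set K := besselK 1 z₀
  have hK : 0 < K := besselK_one_pos hz₀
  have hb : ∀ u, r ^ 2 ≤ u → besselK 1 (k * √u) / K ≤ exp z₀ * exp (-(k * √u)) := fun u hu => by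
    have : r ≤ √u := Real.le_sqrt_of_sq_le hu
    have := coshMoment_le_exp 1 hz₀ (show z₀ ≤ k * √u by simp only [z₀]; gcongr)
    rw [← besselK_one] at this
    rw [div_le_iff₀ hK, ← exp_add]
    calc _ ≤ _ := this
      _ = _ := by rw [mul_comm]; congr 2; ring
  have lim : Tendsto (fun u : ℝ => exp z₀ ^ 2 * (k⁻¹ * (k * √u)^1 * exp (-(k * √u))) *
      (k + r⁻¹)) atTop (𝓝 0) := by
    have h1 : Tendsto (fun u : ℝ => k * √u) atTop atTop :=
      Real.tendsto_sqrt_atTop.const_mul_atTop hk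
    have h2 := (Real.tendsto_pow_mul_exp_neg_atTop_nhds_zero 1).comp h1
    have h3 := ((h2.const_mul k⁻¹).const_mul (exp z₀ ^ 2)).mul_const (k + r⁻¹)
    simp only [mul_zero, zero_mul] at h3
    refine h3.congr fun u => ?_
    simp only [Function.comp]; ring
  refine squeeze_zero_norm' ?_ lim
  filter_upwards [eventually_ge_atTop (r ^ 2)] with u hu
  have hu0 : 0 < u := (by positivity : 0 < r ^ 2).trans_le hu
  have hs : r ≤ √u := Real.le_sqrt_of_sq_le hu
  have hs0 : 0 < √u := hr.trans_le hs
  have hz : 0 < k * √u := by positivity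
  have hK1 := besselK_one_pos hz
  have hK0 := besselK_zero_pos hz
  set E := exp (-(k * √u))
  have hE : 0 < E := exp_pos _
  have hE1 : E ≤ 1 := exp_le_one_iff.2 (by linarith)
  set q := besselK 1 (k * √u) / K
  have hq0 : 0 < q := by positivity
  have hq : q ≤ exp z₀ * E := hb u hu
  have e1 : outerProfile k r u = q / √u := by
    simp only [outerProfile, q, K, z₀]; ring
  have e2 : |outerDivergence k r u - outerProfile k r u| ≤ (k + r⁻¹) * q := by
    have hd : |outerDivergence k r u| ≤ k * q := by
      rw [outerDivergence, abs_div, abs_mul, abs_neg, abs_of_pos hk, abs_of_pos hK0,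
        abs_of_pos hK, mul_div_assoc]
      simp only [q]
      gcongr
      exact besselK_zero_le_one hz
    have hp : |outerProfile k r u| ≤ r⁻¹ * q := by
      rw [e1, abs_of_pos (by positivity), div_eq_inv_mul]
      gcongr
    calc _ ≤ |outerDivergence k r u| + |outerProfile k r u| := abs_sub _ _
      _ ≤ k * q + r⁻¹ * q := add_le_add hd hp
      _ = _ := by ring
  rw [Real.norm_eq_abs, abs_mul]
  have e3 : |u * outerProfile k r u| = √u * q := by
    rw [e1, abs_of_pos (by positivity)]
    nth_rewrite 1 [← Real.mul_self_sqrt hu0.le]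
    field_simp
  rw [e3]
  calc √u * q * |outerDivergence k r u - outerProfile k r u| ≤ √u * q * ((k + r⁻¹) * q) := by
        gcongr
    _ ≤ √u * (exp z₀ * E) * ((k + r⁻¹) * (exp z₀ * E)) := by gcongr
    _ = exp z₀ ^ 2 * (√u * E) * (k + r⁻¹) * E := by ring
    _ ≤ exp z₀ ^ 2 * (√u * E) * (k + r⁻¹) * 1 := by gcongr
    _ = _ := by field_simp

end

/-! ### Smoothing and cutting off the minimizer -/

section

theorem deriv_smoothTransition_of_neg {x : ℝ} (hx : x < 0) : deriv smoothTransition x = 0 := by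
  have : smoothTransition =ᶠ[𝓝 x] fun _ => 0 := by
    filter_upwards [Iio_mem_nhds hx] with y hy
    exact smoothTransition.zero_of_nonpos (le_of_lt hy)
  rw [this.deriv_eq, deriv_const]

theorem deriv_smoothTransition_of_one_lt {x : ℝ} (hx : 1 < x) : deriv smoothTransition x = 0 := by
  have : smoothTransition =ᶠ[𝓝 x] fun _ => 1 := by
    filter_upwards [Ioi_mem_nhds hx] with y hy
    exact smoothTransition.one_of_one_le (le_of_lt hy)
  rw [this.deriv_eq, deriv_const]

theorem hasDerivAt_smoothTransition (x : ℝ) :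
    HasDerivAt smoothTransition (deriv smoothTransition x) x :=
  (smoothTransition.contDiff.differentiable (n := 1) (by simp) x).hasDerivAt

theorem exists_bound_deriv_smoothTransition :
    ∃ C, 0 ≤ C ∧ ∀ x, |deriv smoothTransition x| ≤ C := by
  have hc : Continuous (deriv smoothTransition) :=
    (smoothTransition.contDiff (n := 1)).continuous_deriv le_rfl
  obtain ⟨C, hC⟩ := (isCompact_Icc (a := (0 : ℝ)) (b := 1)).exists_bound_of_continuousOn
    hc.continuousOn
  have hC0 : 0 ≤ C := (norm_nonneg _).trans (hC 0 (by simp))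
  refine ⟨C, hC0, fun x => ?_⟩
  rcases lt_or_ge x 0 with h | h
  · simpa [deriv_smoothTransition_of_neg h] using hC0
  rcases lt_or_ge 1 x with h' | h'
  · simpa [deriv_smoothTransition_of_one_lt h'] using hC0
  exact hC x ⟨h, h'⟩

/-- Smooth profiles of compact support which approximate the minimizer: equal to the inner
solution for `u ≤ r²` and to the outer one for `r² + 1/N ≤ u ≤ N`. -/
def cutoffProfile (k r N u : ℝ) : ℝ :=
  smoothTransition (2 - u / N) * outerProfile k r u +
    smoothTransition (1 - N * (u - r ^ 2)) * (innerProfile k r u - outerProfile k r u)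

/-- The derivative of `cutoffProfile`. -/
def cutoffProfileDeriv (k r N u : ℝ) : ℝ :=
  deriv smoothTransition (2 - u / N) * (-1 / N) * outerProfile k r u +
    smoothTransition (2 - u / N) * outerProfileDeriv k r u +
    (deriv smoothTransition (1 - N * (u - r ^ 2)) * (-N) *
      (innerProfile k r u - outerProfile k r u) +
    smoothTransition (1 - N * (u - r ^ 2)) *
      (innerProfileDeriv k r u - outerProfileDeriv k r u))

variable {k r N : ℝ}

theorem hasDerivAt_cutoffProfile (hk : 0 < k) {u : ℝ} (hu : 0 < u) :
    HasDerivAt (cutoffProfile k r N) (cutoffProfileDeriv k r N u) u := by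
  have h1 : HasDerivAt (fun u => 2 - u / N) (-1 / N) u := by
    refine (((hasDerivAt_id u).div_const N).const_sub 2).congr_deriv ?_
    ring
  have h2 : HasDerivAt (fun u => 1 - N * (u - r ^ 2)) (-N) u := by
    refine ((((hasDerivAt_id u).sub_const (r ^ 2)).const_mul N).const_sub 1).congr_deriv ?_
    ring
  have hI := hasDerivAt_innerProfile k r u
  have hK := hasDerivAt_outerProfile (r := r) hk hu
  exact (((hasDerivAt_smoothTransition _).comp u h1).mul hK).add
    (((hasDerivAt_smoothTransition _).comp u h2).mul (hI.sub hK))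

theorem cutoffProfile_of_le (hN : r ^ 2 < N) {u : ℝ} (hu : u ≤ r ^ 2) :
    cutoffProfile k r N u = innerProfile k r u := by
  have hN0 : 0 < N := (sq_nonneg r).trans_lt hN
  rw [cutoffProfile, smoothTransition.one_of_one_le, smoothTransition.one_of_one_le]
  · ring
  · nlinarith
  · have : u / N ≤ 1 := (div_le_one hN0).2 (hu.trans hN.le)
    linarith

theorem contDiff_cutoffProfile (hk : 0 < k) (hr : 0 < r) (hN : r ^ 2 < N) :
    ContDiff ℝ ∞ (cutoffProfile k r N) := by
  rw [contDiff_iff_contDiffAt]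
  intro u
  rcases lt_or_ge u (r ^ 2) with h | h
  · refine (contDiff_innerProfile k r).contDiffAt.congr_of_eventuallyEq ?_
    filter_upwards [Iio_mem_nhds h] with y hy
    exact cutoffProfile_of_le hN (le_of_lt hy)
  · have hu : 0 < u := (by positivity : 0 < r ^ 2).trans_le h
    have hK : ContDiffAt ℝ ∞ (outerProfile k r) u :=
      (contDiffOn_outerProfile hk).contDiffAt (Ioi_mem_nhds hu)
    have hI := (contDiff_innerProfile k r).contDiffAt (x := u)
    have h1 : ContDiffAt ℝ ∞ (fun u => smoothTransition (2 - u / N)) u :=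
      (smoothTransition.contDiff.comp
        (by fun_prop : ContDiff ℝ ∞ fun u : ℝ => 2 - u / N)).contDiffAt
    have h2 : ContDiffAt ℝ ∞ (fun u => smoothTransition (1 - N * (u - r ^ 2))) u :=
      (smoothTransition.contDiff.comp
        (by fun_prop : ContDiff ℝ ∞ fun u : ℝ => 1 - N * (u - r ^ 2))).contDiffAt
    exact (h1.mul hK).add (h2.mul (hI.sub hK))

theorem cutoffProfile_of_ge (hN : r ^ 2 + 1 < N) {u : ℝ} (hu : 2 * N ≤ u) :
    cutoffProfile k r N u = 0 := by
  have hN1 : 1 < N := by nlinarith [sq_nonneg r]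
  rw [cutoffProfile, smoothTransition.zero_of_nonpos, smoothTransition.zero_of_nonpos]
  · ring
  · nlinarith
  · have : 2 ≤ u / N := (le_div_iff₀ (by linarith)).2 hu
    linarith

theorem radialEnergy_cutoffProfile_of_lt {A : ℝ} (hk : 0 < k) (hN : r ^ 2 < N) {u : ℝ}
    (hu : 0 < u) (hur : u < r ^ 2) :
    radialEnergy A (cutoffProfile k r N) (cutoffProfileDeriv k r N) u =
      radialEnergy A (innerProfile k r) (innerProfileDeriv k r) u := by
  have h : cutoffProfile k r N =ᶠ[𝓝 u] innerProfile k r := by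
    filter_upwards [Iio_mem_nhds hur] with y hy
    exact cutoffProfile_of_le hN (le_of_lt hy)
  have h2 := ((hasDerivAt_cutoffProfile (r := r) (N := N) hk hu).congr_of_eventuallyEq
    h.symm).unique (hasDerivAt_innerProfile k r u)
  rw [radialEnergy, radialEnergy, h2, cutoffProfile_of_le hN hur.le]

theorem radialEnergy_cutoffProfile_of_gt {A : ℝ} {u : ℝ} (hN : 0 < N)
    (h1 : u < N) (h2 : 1 < N * (u - r ^ 2)) :
    radialEnergy A (cutoffProfile k r N) (cutoffProfileDeriv k r N) u =
      radialEnergy A (outerProfile k r) (outerProfileDeriv k r) u := by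
  have e1 : 1 < 2 - u / N := by
    have : u / N < 1 := (div_lt_one hN).2 h1
    linarith
  have e2 : 1 - N * (u - r ^ 2) < 0 := by linarith
  rw [radialEnergy, radialEnergy, cutoffProfile, cutoffProfileDeriv,
    smoothTransition.one_of_one_le e1.le, smoothTransition.zero_of_nonpos e2.le,
    deriv_smoothTransition_of_neg e2, deriv_smoothTransition_of_one_lt e1]
  ring

/-- The algebra behind the dominating function: `x`, `y`, `z` come from the outer profile and its
cutoff at infinity, `a` and `b` from the transition layer at `r²`, where `s` bounds them. -/
theorem radial_energy_add_le {A C u φ ψ x y z a b s : ℝ} (hA : 0 < A) (hu : 0 < u)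
    (q1 : x ^ 2 ≤ φ ^ 2) (q2 : y ^ 2 ≤ ψ ^ 2) (q3 : z ^ 2 ≤ 16 * C ^ 2 * φ ^ 2)
    (q4 : a ^ 2 ≤ s ^ 2) (q5 : b ^ 2 ≤ s ^ 2) :
    u * (x + a) ^ 2 + A * ((y + z + b) ^ 2 + (x + a) ^ 2) ≤
      (3 + 48 * C ^ 2) * (u * φ ^ 2 + A * (ψ ^ 2 + φ ^ 2)) + (2 * u + 5 * A) * s ^ 2 := by
  have t1 : (x + a) ^ 2 ≤ 2 * φ ^ 2 + 2 * s ^ 2 := by nlinarith [sq_nonneg (x - a)]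
  have t2 : (y + z + b) ^ 2 ≤ 3 * ψ ^ 2 + 48 * C ^ 2 * φ ^ 2 + 3 * s ^ 2 := by
    nlinarith [sq_nonneg (y - z), sq_nonneg (y - b), sq_nonneg (z - b)]
  calc u * (x + a) ^ 2 + A * ((y + z + b) ^ 2 + (x + a) ^ 2)
      ≤ u * (2 * φ ^ 2 + 2 * s ^ 2) + A * ((3 * ψ ^ 2 + 48 * C ^ 2 * φ ^ 2 + 3 * s ^ 2) +
        (2 * φ ^ 2 + 2 * s ^ 2)) := by gcongr
    _ = (2 * u * φ ^ 2 + A * (3 * ψ ^ 2 + (48 * C ^ 2 + 2) * φ ^ 2)) +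
        (2 * u + 5 * A) * s ^ 2 := by ring
    _ ≤ _ := by
      gcongr
      have r1 : 0 ≤ u * φ ^ 2 := by positivity
      have r2 : 0 ≤ A * φ ^ 2 := by positivity
      have r3 : 0 ≤ C ^ 2 * (u * φ ^ 2) := by positivity
      have r4 : 0 ≤ C ^ 2 * (A * ψ ^ 2) := by positivity
      nlinarith

set_option maxHeartbeats 600000 in
/-- The energy densities of the cut-off profiles have a common bound. -/
theorem exists_bound_radialEnergy_cutoffProfile {A : ℝ} (hA : 0 < A) (hk : 0 < k) (hr : 0 < r) :
    ∃ C₁ C₂ : ℝ, ∀ N u, r ^ 2 + 1 < N → r ^ 2 < u →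
      |radialEnergy A (cutoffProfile k r N) (cutoffProfileDeriv k r N) u| ≤
        C₁ * radialEnergy A (outerProfile k r) (outerProfileDeriv k r) u +
          (Ioc (r ^ 2) (r ^ 2 + 1)).indicator (fun _ => C₂) u := by
  obtain ⟨C, hC0, hC⟩ := exists_bound_deriv_smoothTransition
  have hr2 : 0 < r ^ 2 := by positivity
  have hsub : Icc (r ^ 2) (r ^ 2 + 1) ⊆ Ioi 0 := fun u hu => hr2.trans_le hu.1
  have cI : Continuous (innerProfile k r) := (contDiff_innerProfile k r).continuous
  have cI' := continuous_innerProfileDeriv k r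
  have cK : ContinuousOn (outerProfile k r) (Icc (r ^ 2) (r ^ 2 + 1)) :=
    (contDiffOn_outerProfile hk).continuousOn.mono hsub
  have cK' : ContinuousOn (outerProfileDeriv k r) (Icc (r ^ 2) (r ^ 2 + 1)) :=
    (continuousOn_outerProfileDeriv hk).mono hsub
  obtain ⟨M₀, hM₀⟩ := isCompact_Icc.exists_bound_of_continuousOn (cI.continuousOn.sub cK)
  obtain ⟨L, hL⟩ := isCompact_Icc.exists_bound_of_continuousOn (cI'.continuousOn.sub cK')
  simp only [Real.norm_eq_abs, Pi.sub_apply] at hM₀ hL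
  have hM₀0 : 0 ≤ M₀ := (abs_nonneg _).trans (hM₀ (r ^ 2) ⟨le_rfl, by linarith⟩)
  have hL0 : 0 ≤ L := (abs_nonneg _).trans (hL (r ^ 2) ⟨le_rfl, by linarith⟩)
  -- The two profiles agree at `r²`, so their difference vanishes linearly. This offsets the slope
  -- of order `N` of the transition function, which varies only where `N (u - r²) ≤ 1`.
  have hLip : ∀ u ∈ Icc (r ^ 2) (r ^ 2 + 1),
      |innerProfile k r u - outerProfile k r u| ≤ L * (u - r ^ 2) := fun u hu => by
    have := (convex_Icc (r ^ 2) (r ^ 2 + 1)).norm_image_sub_le_of_norm_hasDerivWithin_le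
      (f := fun u => innerProfile k r u - outerProfile k r u)
      (fun y hy => ((hasDerivAt_innerProfile k r y).sub
        (hasDerivAt_outerProfile hk (hsub hy))).hasDerivWithinAt) hL
      (left_mem_Icc.2 (by linarith)) hu
    rwa [innerProfile_sq hr, outerProfile_sq hk hr, sub_self, sub_zero, Real.norm_eq_abs,
      Real.norm_eq_abs, abs_of_nonneg (sub_nonneg.2 hu.1)] at this
  -- The sum of the bounds for `χ Δ`, `2u χ Δ'` and `2u χ' Δ` in the layer, where `u ≤ r² + 1`.
  set M := M₀ + 2 * (r ^ 2 + 1) * L + 2 * (r ^ 2 + 1) * (C * L)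
  have hM0 : 0 ≤ M := by positivity
  refine ⟨3 + 48 * C ^ 2, (2 * (r ^ 2 + 1) + 5 * A) * M ^ 2, fun N u hN hu => ?_⟩
  have hN0 : 0 < N := by linarith
  have hu0 : 0 < u := hr2.trans hu
  set φ := outerProfile k r u
  set φ' := outerProfileDeriv k r u
  set Δ := innerProfile k r u - φ
  set Δ' := innerProfileDeriv k r u - φ'
  set η := smoothTransition (2 - u / N)
  set χ := smoothTransition (1 - N * (u - r ^ 2))
  have hη0 : 0 ≤ η := smoothTransition.nonneg _
  have hη1 : η ≤ 1 := smoothTransition.le_one _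
  have hχ0 : 0 ≤ χ := smoothTransition.nonneg _
  have hχ1 : χ ≤ 1 := smoothTransition.le_one _
  set η' := deriv smoothTransition (2 - u / N) * (-1 / N)
  set χ' := deriv smoothTransition (1 - N * (u - r ^ 2)) * (-N)
  -- The slope of the outer cutoff is of order `1/N` and vanishes for `u > 2N`, so the product with
  -- `u` is bounded independently of `N`.
  have hη' : |2 * u * η'| ≤ 4 * C := by
    rcases lt_or_ge (2 * N) u with h | h
    · have : 2 - u / N < 0 := by
        have : 2 < u / N := (lt_div_iff₀ hN0).2 h
        linarith
      simp only [η', deriv_smoothTransition_of_neg this]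
      simpa using hC0
    · have e : |2 * u * η'| = 2 * (u / N) * |deriv smoothTransition (2 - u / N)| := by
        simp only [η']
        rw [abs_mul, abs_mul _ (-1 / N), abs_of_pos (by positivity : 0 < 2 * u), abs_div, abs_neg,
          abs_one, abs_of_pos hN0]
        ring
      rw [e]
      have h3 : u / N ≤ 2 := (div_le_iff₀ hN0).2 h
      calc _ ≤ 2 * 2 * C := by gcongr; exact hC _
        _ = _ := by ring
  -- Since `N > 1`, the correction is absent for `u > r² + 1`, and `s = 0` serves there; inside the
  -- layer `s = M`.
  obtain ⟨s, hs0, hsM, h1, h2⟩ : ∃ s, 0 ≤ s ∧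
      (2 * u + 5 * A) * s ^ 2 ≤ (Ioc (r ^ 2) (r ^ 2 + 1)).indicator
        (fun _ => (2 * (r ^ 2 + 1) + 5 * A) * M ^ 2) u ∧
      |χ * Δ| ≤ s ∧ |χ * Δ + 2 * u * (χ' * Δ + χ * Δ')| ≤ s := by
    rcases lt_or_ge (r ^ 2 + 1) u with h | h
    · have hneg : 1 - N * (u - r ^ 2) < 0 := by nlinarith
      have eχ : χ = 0 := smoothTransition.zero_of_nonpos hneg.le
      have eχ' : χ' = 0 := by simp only [χ', deriv_smoothTransition_of_neg hneg, zero_mul]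
      refine ⟨0, le_rfl, ?_, by simp [eχ], by simp [eχ, eχ']⟩
      rw [indicator_of_notMem (fun hu' => not_lt.2 hu'.2 h)]
      simp
    · have hmem : u ∈ Icc (r ^ 2) (r ^ 2 + 1) := ⟨hu.le, h⟩
      have b0 : |Δ| ≤ M₀ := hM₀ u hmem
      have b1 : |Δ'| ≤ L := hL u hmem
      have b2 : |Δ| ≤ L * (u - r ^ 2) := hLip u hmem
      have b3 : |χ' * Δ| ≤ C * L := by
        rcases lt_or_ge 1 (N * (u - r ^ 2)) with h' | h'
        · have hneg : 1 - N * (u - r ^ 2) < 0 := by linarith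
          simp only [χ', deriv_smoothTransition_of_neg hneg, zero_mul, abs_zero]
          positivity
        · have hu' : 0 < u - r ^ 2 := by linarith
          calc |χ' * Δ| = |deriv smoothTransition (1 - N * (u - r ^ 2))| * (N * |Δ|) := by
                simp only [χ']
                rw [abs_mul, abs_mul, abs_neg, abs_of_pos hN0]; ring
            _ ≤ C * (N * (L * (u - r ^ 2))) := by gcongr; exact hC _
            _ = C * L * (N * (u - r ^ 2)) := by ring
            _ ≤ C * L * 1 := by gcongr
            _ = C * L := mul_one _
      have b4 : |χ * Δ| ≤ M₀ := by
        rw [abs_mul, abs_of_nonneg hχ0]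
        calc _ ≤ 1 * M₀ := by gcongr
          _ = _ := one_mul _
      have b5 : |χ * Δ'| ≤ L := by
        rw [abs_mul, abs_of_nonneg hχ0]
        calc _ ≤ 1 * L := by gcongr
          _ = _ := one_mul _
      refine ⟨M, hM0, ?_, ?_, ?_⟩
      · rw [indicator_of_mem (show u ∈ Ioc (r ^ 2) (r ^ 2 + 1) from ⟨hu, h⟩)]
        gcongr
      · refine b4.trans ?_
        have : 0 ≤ 2 * (r ^ 2 + 1) * L + 2 * (r ^ 2 + 1) * (C * L) := by positivity
        linarith
      · calc |χ * Δ + 2 * u * (χ' * Δ + χ * Δ')|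
            ≤ |χ * Δ| + 2 * u * (|χ' * Δ| + |χ * Δ'|) := by
              refine (abs_add_le _ _).trans ?_
              rw [abs_mul (2 * u), abs_of_pos (by positivity : 0 < 2 * u)]
              gcongr
              exact abs_add_le _ _
          _ ≤ M₀ + 2 * (r ^ 2 + 1) * (C * L + L) := by gcongr
          _ = M := by simp only [M]; ring
  set ψ := φ + 2 * u * φ'
  have hφ0 : 0 < φ := outerProfile_nonneg hk hr hu0
  have eφ : cutoffProfile k r N u = η * φ + χ * Δ := rfl
  have eψ : cutoffProfile k r N u + 2 * u * cutoffProfileDeriv k r N u =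
      η * ψ + (2 * u * η') * φ + (χ * Δ + 2 * u * (χ' * Δ + χ * Δ')) := by
    simp only [cutoffProfile, cutoffProfileDeriv, ψ, φ, φ', η, η', χ, χ', Δ, Δ']
    ring
  have q1 : (η * φ) ^ 2 ≤ φ ^ 2 := by
    rw [mul_pow]
    exact mul_le_of_le_one_left (sq_nonneg _) (pow_le_one₀ hη0 hη1)
  have q2 : (η * ψ) ^ 2 ≤ ψ ^ 2 := by
    rw [mul_pow]
    exact mul_le_of_le_one_left (sq_nonneg _) (pow_le_one₀ hη0 hη1)
  have q3 : ((2 * u * η') * φ) ^ 2 ≤ 16 * C ^ 2 * φ ^ 2 := by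
    rw [mul_pow]
    have := sq_le_sq' (abs_le.1 hη').1 (abs_le.1 hη').2
    gcongr
    linarith
  have q4 := sq_le_sq' (abs_le.1 h1).1 (abs_le.1 h1).2
  have q5 := sq_le_sq' (abs_le.1 h2).1 (abs_le.1 h2).2
  rw [radialEnergy, radialEnergy, eψ, eφ, abs_of_nonneg (by positivity)]
  refine le_trans ?_ (add_le_add_right hsM _)
  change _ ≤ (3 + 48 * C ^ 2) * (u * φ ^ 2 + A * (ψ ^ 2 + φ ^ 2)) + _
  generalize χ * Δ + 2 * u * (χ' * Δ + χ * Δ') = b at *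
  generalize χ * Δ = a at *
  generalize η * φ = x at *
  generalize η * ψ = y at *
  generalize (2 * u * η') * φ = z at *
  exact radial_energy_add_le hA hu0 q1 q2 q3 q4 q5

end

/-! ### Energy of the minimizer and the formula for the metric of order one -/

section

theorem radialEnergy_nonneg {A : ℝ} (hA : 0 < A) (φ φ' : ℝ → ℝ) {u : ℝ} (hu : 0 ≤ u) :
    0 ≤ radialEnergy A φ φ' u := by
  rw [radialEnergy]; positivity

theorem continuous_radialEnergy (A : ℝ) {φ : ℝ → ℝ} (hφ : ContDiff ℝ ∞ φ) :
    Continuous (radialEnergy A φ (deriv φ)) := by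
  have h1 := hφ.continuous
  have h2 := hφ.continuous_deriv (by simp)
  unfold radialEnergy
  fun_prop

variable {A k r : ℝ}

theorem integral_radialEnergy_inner (hk : A * k ^ 2 = 1) (hr : 0 < r) :
    ∫ u in (0 : ℝ)..r ^ 2, radialEnergy A (innerProfile k r) (innerProfileDeriv k r) u =
      2 * A * (r * (innerDivergence k r (r ^ 2) - r⁻¹)) := by
  have h1 := (contDiff_innerProfile k r).continuous
  have h2 := continuous_innerProfileDeriv k r
  have hc : Continuous (radialEnergy A (innerProfile k r) (innerProfileDeriv k r)) := by
    unfold radialEnergy; fun_prop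
  rw [intervalIntegral.integral_eq_sub_of_hasDerivAt (fun u _ => hasDerivAt_radialEnergy hk
    (hasDerivAt_innerProfile k r u) (hasDerivAt_innerDivergence k r u)
    (innerDivergence_eq k r u)) (hc.intervalIntegrable _ _), innerProfile_sq hr]
  field_simp
  ring

theorem integral_radialEnergy_outer (hA : 0 < A) (hk0 : 0 < k) (hk : A * k ^ 2 = 1) (hr : 0 < r) :
    IntegrableOn (radialEnergy A (outerProfile k r) (outerProfileDeriv k r)) (Ioi (r ^ 2)) ∧
    ∫ u in Ioi (r ^ 2), radialEnergy A (outerProfile k r) (outerProfileDeriv k r) u =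
      -(2 * A * (r * (outerDivergence k r (r ^ 2) - r⁻¹))) := by
  have hr2 : 0 < r ^ 2 := by positivity
  have hd : ∀ u ∈ Ici (r ^ 2), HasDerivAt (fun u => 2 * A * (u * outerProfile k r u *
      (outerDivergence k r u - outerProfile k r u)))
      (radialEnergy A (outerProfile k r) (outerProfileDeriv k r) u) u := fun u hu => by
    have hu0 : 0 < u := hr2.trans_le hu
    exact hasDerivAt_radialEnergy hk (hasDerivAt_outerProfile hk0 hu0)
      (hasDerivAt_outerDivergence hk0 hu0) (outerDivergence_eq hu0.ne')
  have hnn : ∀ u ∈ Ioi (r ^ 2),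
      0 ≤ radialEnergy A (outerProfile k r) (outerProfileDeriv k r) u := fun u hu =>
    radialEnergy_nonneg hA _ _ (hr2.le.trans (le_of_lt hu))
  have hlim := (tendsto_outer_boundary hk0 hr).const_mul (2 * A)
  refine ⟨integrableOn_Ioi_deriv_of_nonneg' hd hnn hlim, ?_⟩
  rw [integral_Ioi_of_hasDerivAt_of_nonneg' hd hnn hlim, outerProfile_sq hk0 hr]
  field_simp
  ring

/-- Up to `r²` the cut-off profile is the inner solution for every large `N`. Beyond `r²` the
densities are dominated, and at each point they equal the outer density once `N` is large. The `r⁻¹`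
terms cancel, leaving the jump of the divergence. -/
theorem tendsto_sobolevInner_cutoff (hA : 0 < A) (hk0 : 0 < k) (hk : A * k ^ 2 = 1) (hr : 0 < r) :
    Tendsto (fun N => sobolevInner A 1 (radialField (cutoffProfile k r N))
      (radialField (cutoffProfile k r N))) atTop
      (𝓝 (π * (2 * A * (r * (innerDivergence k r (r ^ 2) - outerDivergence k r (r ^ 2)))))) := by
  have hr2 : 0 < r ^ 2 := by positivity
  set E : ℝ → ℝ → ℝ := fun N => radialEnergy A (cutoffProfile k r N) (deriv (cutoffProfile k r N))
  have hE : ∀ N u, 0 < u → E N u =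
      radialEnergy A (cutoffProfile k r N) (cutoffProfileDeriv k r N) u := fun N u hu => by
    simp only [E, radialEnergy, (hasDerivAt_cutoffProfile hk0 hu).deriv]
  obtain ⟨iK, vK⟩ := integral_radialEnergy_outer hA hk0 hk hr
  obtain ⟨C₁, C₂, hbound⟩ := exists_bound_radialEnergy_cutoffProfile hA hk0 hr
  have cE : ∀ N, r ^ 2 < N → Continuous (E N) := fun N hN =>
    continuous_radialEnergy A (contDiff_cutoffProfile hk0 hr hN)
  set g : ℝ → ℝ := fun u => C₁ * radialEnergy A (outerProfile k r) (outerProfileDeriv k r) u +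
    (Ioc (r ^ 2) (r ^ 2 + 1)).indicator (fun _ => C₂) u
  have hg : IntegrableOn g (Ioi (r ^ 2)) := by
    refine (iK.const_mul C₁).add ?_
    refine Integrable.integrableOn ?_
    rw [integrable_indicator_iff measurableSet_Ioc]
    exact integrableOn_const (by simp)
  have hEg : ∀ N, r ^ 2 + 1 < N → ∀ᵐ u ∂volume.restrict (Ioi (r ^ 2)), ‖E N u‖ ≤ g u :=
    fun N hN => by
      filter_upwards [ae_restrict_mem measurableSet_Ioi] with u hu
      rw [hE N u (hr2.trans hu)]
      exact hbound N u hN hu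
  have lim : Tendsto (fun N => ∫ u in Ioi (r ^ 2), E N u) atTop (𝓝 (∫ u in Ioi (r ^ 2),
      radialEnergy A (outerProfile k r) (outerProfileDeriv k r) u)) := by
    refine tendsto_integral_filter_of_dominated_convergence g ?_ ?_ hg ?_
    · filter_upwards [eventually_gt_atTop (r ^ 2)] with N hN
      exact (cE N hN).aestronglyMeasurable
    · filter_upwards [eventually_gt_atTop (r ^ 2 + 1)] with N hN
      exact hEg N hN
    · filter_upwards [ae_restrict_mem measurableSet_Ioi] with u hu
      have hu' : 0 < u - r ^ 2 := sub_pos.2 hu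
      refine tendsto_const_nhds.congr' ?_
      filter_upwards [eventually_gt_atTop u, eventually_gt_atTop (u - r ^ 2)⁻¹,
        eventually_gt_atTop 0] with N h1 h2 h3
      rw [hE N u (hr2.trans hu), radialEnergy_cutoffProfile_of_gt h3 h1]
      rwa [inv_lt_iff_one_lt_mul₀ hu'] at h2
  rw [vK] at lim
  have lim2 := (lim.const_add (2 * A * (r * (innerDivergence k r (r ^ 2) - r⁻¹)))).const_mul π
  rw [show 2 * A * (r * (innerDivergence k r (r ^ 2) - r⁻¹)) +
      -(2 * A * (r * (outerDivergence k r (r ^ 2) - r⁻¹))) =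
      2 * A * (r * (innerDivergence k r (r ^ 2) - outerDivergence k r (r ^ 2))) by ring] at lim2
  refine lim2.congr' ?_
  filter_upwards [eventually_gt_atTop (r ^ 2 + 1)] with N hN
  have hN' : r ^ 2 < N := by linarith
  rw [sobolevInner_radialField A (contDiff_cutoffProfile hk0 hr hN')
    (fun u hu => cutoffProfile_of_ge hN hu)]
  congr 1
  have i2 : IntegrableOn (E N) (Ioi (r ^ 2)) :=
    hg.mono' (cE N hN').aestronglyMeasurable (hEg N hN)
  have i1 : IntegrableOn (E N) (Ioc 0 (r ^ 2)) := (cE N hN').integrableOn_Ioc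
  rw [← Ioc_union_Ioi_eq_Ioi hr2.le, setIntegral_union (Ioc_disjoint_Ioi le_rfl) measurableSet_Ioi
    i1 i2]
  congr 1
  rw [← integral_radialEnergy_inner hk hr, intervalIntegral.integral_of_le hr2.le,
    integral_Ioc_eq_integral_Ioo, integral_Ioc_eq_integral_Ioo]
  refine setIntegral_congr_fun measurableSet_Ioo fun u hu => ?_
  exact ((hE N u hu.1).trans (radialEnergy_cutoffProfile_of_lt hk0 hN' hu.1 hu.2)).symm

/-- The explicit formula for the metric of order one. -/
theorem circleMetric_one (𝔛 : FieldClass) (hA : 0 < A) (hr : 0 < r) :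
    circleMetric 𝔛 A 1 r = ENNReal.ofReal (besselMetric A r) := by
  rw [circleMetric_eq 𝔛 A 1 hr]
  refine le_antisymm ?_ (le_iInf₂ fun X hX => ENNReal.ofReal_le_ofReal ?_)
  · obtain ⟨k, hk⟩ : ∃ k, k = 1 / √A := ⟨_, rfl⟩
    have hk0 : 0 < k := by rw [hk]; positivity
    have hAk : A * k ^ 2 = 1 := by
      rw [hk, div_pow, Real.sq_sqrt hA.le, one_pow, mul_one_div, div_self hA.ne']
    -- The jump of the divergence is `k (I₀/I₁ + K₀/K₁) / r`, which the Wronskian evaluates.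
    have hval : π * (2 * A * (r * (innerDivergence k r (r ^ 2) - outerDivergence k r (r ^ 2)))) =
        besselMetric A r := by
      have er : r / √A = k * r := by rw [hk]; ring
      have hz : 0 < k * r := by positivity
      have w := bessel_wronskian hz
      have h1 := besselK_one_pos hz
      have s1 := besselSeries_pos 1 (show 0 ≤ k ^ 2 * r ^ 2 / 4 by positivity)
      rw [besselMetric, er, innerDivergence, outerDivergence, Real.sqrt_sq hr.le]
      rw [besselI_eq 0, besselI_eq 1, mul_pow] at w
      rw [besselI_eq 1, mul_pow]
      generalize besselSeries 0 (k ^ 2 * r ^ 2 / 4) = a, besselSeries 1 (k ^ 2 * r ^ 2 / 4) = b,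
        besselK 0 (k * r) = c, besselK 1 (k * r) = d at *
      rw [pow_zero, one_mul, pow_one] at w
      rw [pow_one]
      field_simp
      field_simp at w
      linear_combination w
    have lim := tendsto_sobolevInner_cutoff hA hk0 hAk hr
    rw [hval] at lim
    refine ge_of_tendsto (ENNReal.tendsto_ofReal lim) ?_
    filter_upwards [eventually_gt_atTop (r ^ 2 + 1)] with N hN
    have hN' : r ^ 2 < N := by linarith
    refine iInf₂_le (radialField (cutoffProfile k r N)) (radialField_mem_radialFields 𝔛
      (contDiff_cutoffProfile hk0 hr hN') (fun u hu => cutoffProfile_of_ge hN hu) hr ?_)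
    rw [cutoffProfile_of_le hN' le_rfl, innerProfile_sq hr, inv_mul_cancel₀ hr.ne']
  · obtain ⟨S, rfl⟩ := exists_schwartz_of_mem_fields hX.1
    exact besselMetric_le_sobolevInner hA hr S hX.2

end

/-! ### Speed, arc length and lengths of the families of circles -/

/-- The length of the radial unit vector field at the circle of radius `r`. -/
def radialSpeed (𝔛 : FieldClass) (A : ℝ) (n : ℕ) (r : ℝ) : ℝ :=
  √(circleMetricReal 𝔛 A n r)

theorem circleMetricReal_nonneg (𝔛 : FieldClass) (A : ℝ) (n : ℕ) (r : ℝ) :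
    0 ≤ circleMetricReal 𝔛 A n r := ENNReal.toReal_nonneg

theorem circleMetricReal_one_pos (𝔛 : FieldClass) {A r : ℝ} (hA : 0 < A) (hr : 0 < r) :
    0 < circleMetricReal 𝔛 A 1 r := by
  rw [circleMetricReal, circleMetric_one 𝔛 hA hr, ENNReal.toReal_ofReal (besselMetric_pos hA hr).le]
  exact besselMetric_pos hA hr

theorem circleMetricReal_mono_order (𝔛 : FieldClass) {A : ℝ} (hA : 0 < A) {m n : ℕ} (h : m ≤ n)
    {r : ℝ} (hr : 0 < r) : circleMetricReal 𝔛 A m r ≤ circleMetricReal 𝔛 A n r :=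
  ENNReal.toReal_mono (circleMetric_ne_top 𝔛 A n hr) (circleMetric_mono_order 𝔛 hA h hr)

theorem radialSpeed_pos (𝔛 : FieldClass) {A r : ℝ} (hA : 0 < A) {n : ℕ} (hn : 1 ≤ n)
    (hr : 0 < r) : 0 < radialSpeed 𝔛 A n r :=
  Real.sqrt_pos.2 ((circleMetricReal_one_pos 𝔛 hA hr).trans_le
    (circleMetricReal_mono_order 𝔛 hA hn hr))

theorem continuousOn_radialSpeed (𝔛 : FieldClass) {A : ℝ} (hA : 0 < A) (n : ℕ) :
    ContinuousOn (radialSpeed 𝔛 A n) (Ioi 0) :=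
  (continuousOn_circleMetricReal 𝔛 hA n).sqrt

theorem radialSpeed_one_le (𝔛 : FieldClass) {A r s : ℝ} (hA : 0 < A) {n : ℕ} (hn : 1 ≤ n)
    (hs : 0 < s) (h : s ≤ r) : radialSpeed 𝔛 A 1 s ≤ radialSpeed 𝔛 A n r :=
  Real.sqrt_le_sqrt ((circleMetricReal_one_mono 𝔛 hA hs h).trans
    (circleMetricReal_mono_order 𝔛 hA hn (hs.trans_le h)))

theorem speedSq_circleCurve (𝔛 : FieldClass) (A : ℝ) (n : ℕ) {r : ℝ → ℝ} {r' t : ℝ}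
    (hr : HasDerivAt r r' t) (h0 : 0 < r t) :
    speedSq 𝔛 A n (fun s => circleCurve (r s)) t =
      ENNReal.ofReal ((r' * radialSpeed 𝔛 A n (r t)) ^ 2) := by
  have hd : (fun θ => deriv (fun s => circleCurve (r s) θ) t) = fun θ => r' • circleCurve 1 θ := by
    ext1 θ
    rw [show (fun s => circleCurve (r s) θ) = fun s => r s • circleCurve 1 θ from
      funext fun s => circleCurve_eq_smul _ _]
    exact (hr.smul_const _).deriv
  rw [speedSq, hd, quotientMetric_radial 𝔛 A n h0, ← ofReal_circleMetricReal 𝔛 A n h0,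
    ← ENNReal.ofReal_mul (sq_nonneg _), mul_pow, radialSpeed,
    Real.sq_sqrt (circleMetricReal_nonneg 𝔛 A n _)]

theorem isCircleGeodesic_of_hasDerivAt (𝔛 : FieldClass) {A σ : ℝ} (hA : 0 < A) {n : ℕ}
    (hn : 1 ≤ n) {I : Set ℝ} {r : ℝ → ℝ}
    (h : ∀ t ∈ I, 0 < r t ∧ HasDerivAt r (σ * (radialSpeed 𝔛 A n (r t))⁻¹) t) :
    IsCircleGeodesic 𝔛 A n σ I r := fun t ht => by
  obtain ⟨h0, hd⟩ := h t ht
  refine ⟨h0, hd.differentiableAt, ?_⟩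
  rw [speedSq_circleCurve 𝔛 A n hd h0, inv_mul_cancel_right₀ (radialSpeed_pos 𝔛 hA hn h0).ne']

theorem pathLength_circleCurve (𝔛 : FieldClass) (A : ℝ) (n : ℕ) {I : Set ℝ}
    (hI : MeasurableSet I) (h0 : I ⊆ Ioi 0) :
    pathLength 𝔛 A n circleCurve I = ∫⁻ r in I, ENNReal.ofReal (radialSpeed 𝔛 A n r) := by
  refine setLIntegral_congr_fun hI fun r hr => ?_
  have := speedSq_circleCurve 𝔛 A n (hasDerivAt_id r) (h0 hr)
  simp only [id, one_mul] at this
  have e : 0 ≤ radialSpeed 𝔛 A n r := Real.sqrt_nonneg _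
  change speedSq 𝔛 A n (fun s => circleCurve s) r ^ (1 / 2 : ℝ) = _
  rw [this, ENNReal.ofReal_rpow_of_nonneg (sq_nonneg _) (by norm_num), ← Real.sqrt_eq_rpow,
    Real.sqrt_sq e]

/-- The arc length along the circles, measured from radius `r₀`. -/
def arcLength (𝔛 : FieldClass) (A : ℝ) (n : ℕ) (r₀ r : ℝ) : ℝ :=
  ∫ ρ in r₀..r, radialSpeed 𝔛 A n ρ

theorem hasDerivAt_arcLength (𝔛 : FieldClass) {A r₀ r : ℝ} (hA : 0 < A) (n : ℕ) (hr₀ : 0 < r₀)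
    (hr : 0 < r) : HasDerivAt (arcLength 𝔛 A n r₀) (radialSpeed 𝔛 A n r) r := by
  have hc := continuousOn_radialSpeed 𝔛 hA n
  refine intervalIntegral.integral_hasDerivAt_right ?_ ?_ (hc.continuousAt (Ioi_mem_nhds hr))
  · refine (hc.mono fun x hx => ?_).intervalIntegrable
    exact (lt_min hr₀ hr).trans_le hx.1
  · exact hc.stronglyMeasurableAtFilter isOpen_Ioi r hr

theorem arcLength_self (𝔛 : FieldClass) (A : ℝ) (n : ℕ) (r₀ : ℝ) : arcLength 𝔛 A n r₀ r₀ = 0 :=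
  intervalIntegral.integral_same

theorem strictMonoOn_of_hasDerivAt_pos {W w : ℝ → ℝ} (hd : ∀ r, 0 < r → HasDerivAt W (w r) r)
    (hw : ∀ r, 0 < r → 0 < w r) : StrictMonoOn W (Ioi 0) := by
  refine strictMonoOn_of_deriv_pos (convex_Ioi 0)
    (fun r hr => (hd r hr).continuousAt.continuousWithinAt) fun r hr => ?_
  rw [interior_Ioi] at hr
  rw [(hd r hr).deriv]
  exact hw r hr

/-- The inverse of an increasing function on `(0, ∞)` which is unbounded above. -/
theorem exists_inverse {W w : ℝ → ℝ} (hd : ∀ r, 0 < r → HasDerivAt W (w r) r)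
    (hw : ∀ r, 0 < r → 0 < w r) (htop : Tendsto W atTop atTop) :
    ∃ g : ℝ → ℝ, (∀ r, 0 < r → g (W r) = r) ∧
      ∀ t, (∃ a, 0 < a ∧ W a < t) → 0 < g t ∧ W (g t) = t ∧ HasDerivAt g (w (g t))⁻¹ t := by
  have hmono := strictMonoOn_of_hasDerivAt_pos hd hw
  -- `J` is the range of `W` on `(0, ∞)`, described so that `W` bounded below and `W` unbounded
  -- below are handled alike.
  set J : Set ℝ := {t | ∃ a, 0 < a ∧ W a < t}
  have hJ : IsOpen J := by
    have : J = ⋃ a ∈ Ioi (0 : ℝ), Ioi (W a) := by ext t; simp [J]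
    rw [this]
    exact isOpen_biUnion fun a _ => isOpen_Ioi
  have hsurj : ∀ t ∈ J, ∃ r, 0 < r ∧ W r = t := by
    rintro t ⟨a, ha, hat⟩
    obtain ⟨b, hb, hab⟩ := ((htop.eventually_gt_atTop t).and (eventually_gt_atTop a)).exists
    have hc : ContinuousOn W (Icc a b) := fun r hr =>
      (hd r (ha.trans_le hr.1)).continuousAt.continuousWithinAt
    obtain ⟨r, hr, hrt⟩ := intermediate_value_Icc hab.le hc ⟨hat.le, hb.le⟩
    exact ⟨r, ha.trans_le hr.1, hrt⟩
  have hmem : ∀ r, 0 < r → W r ∈ J := fun r hr =>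
    ⟨r / 2, by positivity, hmono (show r / 2 ∈ Ioi 0 by simpa using hr) hr (by linarith)⟩
  set g := Function.invFunOn W (Ioi 0)
  have hg : ∀ t ∈ J, 0 < g t ∧ W (g t) = t := fun t ht =>
    ⟨Function.invFunOn_mem (hsurj t ht), Function.invFunOn_eq (hsurj t ht)⟩
  have hgW : ∀ r, 0 < r → g (W r) = r := fun r hr =>
    hmono.injOn (hg _ (hmem r hr)).1 hr (hg _ (hmem r hr)).2
  have hgmono : StrictMonoOn g J := fun s hs t ht hst => by
    have h1 := hg s hs
    have h2 := hg t ht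
    rw [← hmono.lt_iff_lt h1.1 h2.1, h1.2, h2.2]
    exact hst
  have himg : g '' J = Ioi 0 := by
    ext r
    constructor
    · rintro ⟨t, ht, rfl⟩
      exact (hg t ht).1
    · exact fun hr => ⟨W r, hmem r hr, hgW r hr⟩
  refine ⟨g, hgW, fun t ht => ⟨(hg t ht).1, (hg t ht).2, ?_⟩⟩
  have hcont : ContinuousAt g t := hgmono.continuousAt_of_image_mem_nhds (hJ.mem_nhds ht)
    (himg ▸ Ioi_mem_nhds (hg t ht).1)
  exact HasDerivAt.of_local_left_inverse hcont (hd _ (hg t ht).1) (hw _ (hg t ht).1).ne'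
    (by filter_upwards [hJ.mem_nhds ht] with y hy using (hg y hy).2)

theorem tendsto_arcLength_atTop (𝔛 : FieldClass) {A r₀ : ℝ} (hA : 0 < A) {n : ℕ} (hn : 1 ≤ n)
    (hr₀ : 0 < r₀) : Tendsto (arcLength 𝔛 A n r₀) atTop atTop := by
  set c := radialSpeed 𝔛 A 1 r₀
  have hc : 0 < c := radialSpeed_pos 𝔛 hA le_rfl hr₀
  have hlin : Tendsto (fun r => c * (r - r₀)) atTop atTop :=
    (tendsto_atTop_add_const_right _ (-r₀) tendsto_id).const_mul_atTop hc
  refine tendsto_atTop_mono' _ ?_ hlin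
  filter_upwards [eventually_ge_atTop r₀] with r hr
  have := intervalIntegral.integral_mono_on (μ := volume) hr (f := fun _ => c)
    intervalIntegrable_const
    (((continuousOn_radialSpeed 𝔛 hA n).mono fun x hx => hr₀.trans_le hx.1).intervalIntegrable_of_Icc
      hr) fun x hx => radialSpeed_one_le 𝔛 hA hn hr₀ hx.1
  rw [intervalIntegral.integral_const, smul_eq_mul, mul_comm] at this
  exact this

/-- The order-two bound would allow the square root of `2 + log (2/r)`. The weaker form without the
root has an elementary primitive and still diverges. -/
theorem exists_radialSpeed_ge (𝔛 : FieldClass) {A : ℝ} (hA : 0 < A) :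
    ∃ c, 0 < c ∧ ∀ (n : ℕ) (r : ℝ), 2 ≤ n → 0 < r → r ≤ 1 →
      c / (r * (2 + log (2 / r))) ≤ radialSpeed 𝔛 A n r := by
  obtain ⟨c, hc, h⟩ := sobolevInner_two_ge hA
  refine ⟨c, hc, fun n r hn hr hr1 => ?_⟩
  have hlog : 0 < log (2 / r) := log_pos ((one_lt_div hr).2 (by linarith))
  have h2 : c ^ 2 / (r ^ 2 * (2 + log (2 / r))) ≤ circleMetricReal 𝔛 A 2 r := by
    rw [circleMetricReal, ← ENNReal.ofReal_le_iff_le_toReal (circleMetric_ne_top 𝔛 A 2 hr),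
      circleMetric_eq 𝔛 A 2 hr]
    refine le_iInf₂ fun X hX => ENNReal.ofReal_le_ofReal ?_
    obtain ⟨S, rfl⟩ := exists_schwartz_of_mem_fields hX.1
    exact h S r hr hr1 hX.2
  refine Real.le_sqrt_of_sq_le (le_trans ?_ (h2.trans (circleMetricReal_mono_order 𝔛 hA hn hr)))
  rw [div_pow, mul_pow]
  gcongr
  nlinarith

theorem tendsto_arcLength_zero (𝔛 : FieldClass) {A r₀ : ℝ} (hA : 0 < A) {n : ℕ} (hn : 2 ≤ n)
    (hr₀ : 0 < r₀) : Tendsto (arcLength 𝔛 A n r₀) (𝓝[>] 0) atBot := by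
  obtain ⟨c, hc, hbound⟩ := exists_radialSpeed_ge 𝔛 hA
  -- `-c L` is a primitive of the lower bound for the speed, so `arcLength + c L` is nondecreasing
  -- on `(0, 1]` while `L → ∞` at `0`.
  set L : ℝ → ℝ := fun r => log (2 + log (2 / r))
  have hL : Tendsto L (𝓝[>] 0) atTop := by
    refine tendsto_log_atTop.comp (tendsto_atTop_add_const_left _ _ (tendsto_log_atTop.comp ?_))
    exact (tendsto_inv_nhdsGT_zero.const_mul_atTop (two_pos (α := ℝ))).congr
      fun r => (div_eq_mul_inv 2 r).symm
  have hd : ∀ r ∈ Ioc (0 : ℝ) 1, HasDerivAt (fun r => arcLength 𝔛 A n r₀ r + c * L r)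
      (radialSpeed 𝔛 A n r - c / (r * (2 + log (2 / r)))) r := fun r hr => by
    have hr0 : 0 < r := hr.1
    have hlog : 0 < log (2 / r) := log_pos ((one_lt_div hr0).2 (by linarith [hr.2]))
    have h1 : HasDerivAt (fun r => 2 / r) (-2 / r ^ 2) r := by
      simpa [div_eq_mul_inv] using (hasDerivAt_inv hr0.ne').const_mul 2
    have h2 := ((h1.log (by positivity)).const_add 2).log (by positivity)
    refine ((hasDerivAt_arcLength 𝔛 hA n hr₀ hr0).add (h2.const_mul c)).congr_deriv ?_
    field_simp
    ring
  have hmono : MonotoneOn (fun r => arcLength 𝔛 A n r₀ r + c * L r) (Ioc 0 1) := by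
    refine monotoneOn_of_deriv_nonneg (convex_Ioc 0 1)
      (fun r hr => (hd r hr).continuousAt.continuousWithinAt)
      (fun r hr => (hd r (interior_subset hr)).differentiableAt.differentiableWithinAt)
      fun r hr => ?_
    rw [(hd r (interior_subset hr)).deriv]
    have := interior_subset hr
    exact sub_nonneg.2 (hbound n r hn this.1 this.2)
  have hlim : Tendsto (fun r => (arcLength 𝔛 A n r₀ 1 + c * L 1) + -(c * L r)) (𝓝[>] 0) atBot :=
    tendsto_atBot_add_const_left _ _ (tendsto_neg_atTop_atBot.comp (hL.const_mul_atTop hc))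
  refine tendsto_atBot_mono' _ ?_ hlim
  filter_upwards [Ioc_mem_nhdsGT one_pos] with r hr
  have := hmono hr (right_mem_Ioc.2 one_pos) hr.2
  simp only at this
  linarith

theorem lintegral_radialSpeed_eq_top (𝔛 : FieldClass) {A : ℝ} (hA : 0 < A) (n : ℕ) {I : Set ℝ}
    (hI : MeasurableSet I) (h0 : I ⊆ Ioi 0) (h : ¬ IntegrableOn (radialSpeed 𝔛 A n) I) :
    ∫⁻ r in I, ENNReal.ofReal (radialSpeed 𝔛 A n r) = ⊤ := by
  by_contra hne
  refine h ⟨((continuousOn_radialSpeed 𝔛 hA n).mono h0).aestronglyMeasurable hI, ?_⟩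
  rw [hasFiniteIntegral_iff_ofReal (f := radialSpeed 𝔛 A n)
    (Eventually.of_forall fun r => Real.sqrt_nonneg _)]
  exact lt_top_iff_ne_top.2 hne

theorem pathLength_Ici (𝔛 : FieldClass) {A R : ℝ} (hA : 0 < A) {n : ℕ} (hn : 1 ≤ n)
    (hR : 0 < R) : pathLength 𝔛 A n circleCurve (Ici R) = ⊤ := by
  have h0 : Ici R ⊆ Ioi 0 := fun r hr => hR.trans_le hr
  rw [pathLength_circleCurve 𝔛 A n measurableSet_Ici h0]
  refine lintegral_radialSpeed_eq_top 𝔛 hA n measurableSet_Ici h0 ?_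
  have hd : ∀ᶠ r in atTop, HasDerivAt (arcLength 𝔛 A n R) (radialSpeed 𝔛 A n r) r := by
    filter_upwards [eventually_gt_atTop 0] with r hr using hasDerivAt_arcLength 𝔛 hA n hR hr
  refine not_integrableOn_of_tendsto_norm_atTop_of_deriv_isBigO_filter
    (f := arcLength 𝔛 A n R) atTop (Ici_mem_atTop R) (hd.mono fun r hr => hr.differentiableAt)
    (tendsto_norm_atTop_atTop.comp (tendsto_arcLength_atTop 𝔛 hA hn hR)) ?_
  have he : deriv (arcLength 𝔛 A n R) =ᶠ[atTop] radialSpeed 𝔛 A n := hd.mono fun r hr => hr.deriv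
  exact Asymptotics.isBigO_congr he EventuallyEq.rfl |>.2 (Asymptotics.isBigO_refl _ _)

theorem pathLength_Ioc (𝔛 : FieldClass) {A R : ℝ} (hA : 0 < A) {n : ℕ} (hn : 2 ≤ n)
    (hR : 0 < R) : pathLength 𝔛 A n circleCurve (Ioc 0 R) = ⊤ := by
  have h0 : Ioc 0 R ⊆ Ioi 0 := fun r hr => hr.1
  rw [pathLength_circleCurve 𝔛 A n measurableSet_Ioc h0]
  refine lintegral_radialSpeed_eq_top 𝔛 hA n measurableSet_Ioc h0 ?_
  have hd : ∀ᶠ r in 𝓝[>] 0, HasDerivAt (arcLength 𝔛 A n R) (radialSpeed 𝔛 A n r) r := by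
    filter_upwards [self_mem_nhdsWithin] with r hr using hasDerivAt_arcLength 𝔛 hA n hR hr
  refine not_integrableOn_of_tendsto_norm_atTop_of_deriv_isBigO_filter
    (f := arcLength 𝔛 A n R) (𝓝[>] 0) (Ioc_mem_nhdsGT hR) (hd.mono fun r hr => hr.differentiableAt)
    (tendsto_abs_atBot_atTop.comp (tendsto_arcLength_zero 𝔛 hA hn hR)) ?_
  have he : deriv (arcLength 𝔛 A n R) =ᶠ[𝓝[>] 0] radialSpeed 𝔛 A n := hd.mono fun r hr => hr.deriv
  exact Asymptotics.isBigO_congr he EventuallyEq.rfl |>.2 (Asymptotics.isBigO_refl _ _)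

theorem pathLength_one_Ioc (𝔛 : FieldClass) {A R : ℝ} (hA : 0 < A) :
    pathLength 𝔛 A 1 circleCurve (Ioc 0 R) < ⊤ := by
  rw [pathLength_circleCurve 𝔛 A 1 measurableSet_Ioc fun r hr => hr.1]
  calc _ ≤ ∫⁻ _ in Ioc 0 R, ENNReal.ofReal (radialSpeed 𝔛 A 1 R) :=
        setLIntegral_mono' measurableSet_Ioc fun r hr =>
          ENNReal.ofReal_le_ofReal (radialSpeed_one_le 𝔛 hA le_rfl hr.1 hr.2)
    _ < ⊤ := by
        rw [setLIntegral_const]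
        exact ENNReal.mul_lt_top ENNReal.ofReal_lt_top (by simp)

/-- For order one the speed on `(0, r₀]` is at most its value at `r₀`, so the arc length lost
towards the origin is at most `r₀` times that value. -/
theorem arcLength_one_ge (𝔛 : FieldClass) {A r₀ r : ℝ} (hA : 0 < A) (hr₀ : 0 < r₀) (hr : 0 < r) :
    -(r₀ * radialSpeed 𝔛 A 1 r₀) ≤ arcLength 𝔛 A 1 r₀ r := by
  have hw : 0 < radialSpeed 𝔛 A 1 r₀ := radialSpeed_pos 𝔛 hA le_rfl hr₀
  rcases le_total r₀ r with h | h
  · have : 0 ≤ arcLength 𝔛 A 1 r₀ r :=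
      intervalIntegral.integral_nonneg h fun _ _ => Real.sqrt_nonneg _
    have := mul_pos hr₀ hw
    linarith
  · rw [arcLength, intervalIntegral.integral_symm, neg_le_neg_iff]
    have := intervalIntegral.integral_mono_on (μ := volume) h
      (((continuousOn_radialSpeed 𝔛 hA 1).mono fun x hx =>
        hr.trans_le hx.1).intervalIntegrable_of_Icc h)
      (intervalIntegrable_const (c := radialSpeed 𝔛 A 1 r₀))
      fun x hx => radialSpeed_one_le 𝔛 hA le_rfl (hr.trans_le hx.1) hx.2
    rw [intervalIntegral.integral_const, smul_eq_mul] at this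
    nlinarith

/-! ### Constant speed parametrizations -/

/-- The inverse of the arc length, which parametrizes the geodesic of concentric circles. -/
theorem exists_arcLength_inverse (𝔛 : FieldClass) {A r₀ : ℝ} (hA : 0 < A) {n : ℕ} (hn : 1 ≤ n)
    (hr₀ : 0 < r₀) : ∃ g : ℝ → ℝ, g 0 = r₀ ∧
      (∀ t, (∃ a, 0 < a ∧ arcLength 𝔛 A n r₀ a < t) → 0 < g t ∧
        HasDerivAt g (radialSpeed 𝔛 A n (g t))⁻¹ t) ∧
      (∀ t a b, 0 < a → arcLength 𝔛 A n r₀ a < t → 0 < b → arcLength 𝔛 A n r₀ b > t → g t < b) ∧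
      Tendsto g atTop atTop := by
  have hd : ∀ r, 0 < r → HasDerivAt (arcLength 𝔛 A n r₀) (radialSpeed 𝔛 A n r) r :=
    fun r hr => hasDerivAt_arcLength 𝔛 hA n hr₀ hr
  have hw : ∀ r, 0 < r → 0 < radialSpeed 𝔛 A n r := fun r hr => radialSpeed_pos 𝔛 hA hn hr
  obtain ⟨g, hg1, hg2⟩ := exists_inverse hd hw (tendsto_arcLength_atTop 𝔛 hA hn hr₀)
  have hmono := strictMonoOn_of_hasDerivAt_pos hd hw
  refine ⟨g, ?_, fun t ht => ⟨(hg2 t ht).1, (hg2 t ht).2.2⟩, fun t a b ha hat hb hbt => ?_, ?_⟩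
  · have := hg1 r₀ hr₀
    rwa [arcLength_self] at this
  · obtain ⟨h1, h2, -⟩ := hg2 t ⟨a, ha, hat⟩
    rw [← hmono.lt_iff_lt h1 hb, h2]
    exact hbt
  · refine tendsto_atTop.2 fun M => ?_
    have hM : 0 < max M 1 := lt_max_of_lt_right one_pos
    filter_upwards [eventually_gt_atTop (arcLength 𝔛 A n r₀ (max M 1))] with t ht
    obtain ⟨h1, h2, -⟩ := hg2 t ⟨_, hM, ht⟩
    refine (le_max_left M 1).trans (le_of_lt ?_)
    rw [← hmono.lt_iff_lt hM h1, h2]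
    exact ht

theorem hasDerivAt_comp_speed {g : ℝ → ℝ} {g' σ t : ℝ} (h : HasDerivAt g g' (σ * t)) :
    HasDerivAt (fun t => g (σ * t)) (σ * g') t := by
  have h1 : HasDerivAt (fun t => σ * t) σ t := by simpa using (hasDerivAt_id t).const_mul σ
  exact (h.comp t h1).congr_deriv (mul_comm _ _)

theorem exists_complete_geodesic (𝔛 : FieldClass) {A σ r₀ : ℝ} (hA : 0 < A) {n : ℕ} (hn : 2 ≤ n)
    (hσ : 0 < σ) (hr₀ : 0 < r₀) : ∃ r : ℝ → ℝ, r 0 = r₀ ∧ IsCircleGeodesic 𝔛 A n σ univ r ∧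
      Tendsto r atBot (𝓝 0) ∧ Tendsto r atTop atTop := by
  have hn1 : 1 ≤ n := by omega
  obtain ⟨g, g0, hg, hgt, gtop⟩ := exists_arcLength_inverse 𝔛 hA hn1 hr₀
  have hlim := tendsto_arcLength_zero 𝔛 hA hn hr₀
  -- The arc length is unbounded below at `0`, so its inverse is defined on all of `ℝ`.
  have hall : ∀ t, ∃ a, 0 < a ∧ arcLength 𝔛 A n r₀ a < t := fun t =>
    ((eventually_mem_nhdsWithin (s := Ioi (0 : ℝ))).and (hlim.eventually_lt_atBot t)).exists
  refine ⟨fun t => g (σ * t), by simpa using g0,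
    isCircleGeodesic_of_hasDerivAt 𝔛 hA hn1 fun t _ =>
      ⟨(hg _ (hall _)).1, hasDerivAt_comp_speed (hg _ (hall _)).2⟩, ?_,
    gtop.comp (tendsto_id.const_mul_atTop hσ)⟩
  have gbot : Tendsto g atBot (𝓝 0) := by
    rw [tendsto_order]
    refine ⟨fun b hb => Eventually.of_forall fun t => hb.trans (hg t (hall t)).1, fun b hb => ?_⟩
    filter_upwards [eventually_lt_atBot (arcLength 𝔛 A n r₀ b)] with t ht
    obtain ⟨a, ha, hat⟩ := hall t
    exact hgt t a b ha hat hb ht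
  exact gbot.comp (tendsto_id.const_mul_atBot hσ)

theorem exists_incomplete_geodesic (𝔛 : FieldClass) {A σ r₀ : ℝ} (hA : 0 < A) (hσ : 0 < σ)
    (hr₀ : 0 < r₀) : ∃ T : ℝ, 0 < T ∧ ∃ r : ℝ → ℝ, r 0 = r₀ ∧
      IsCircleGeodesic 𝔛 A 1 σ (Ioi (-T)) r ∧
      Tendsto r (𝓝[>] (-T)) (𝓝 0) ∧ Tendsto r atTop atTop := by
  obtain ⟨g, g0, hg, hgt, gtop⟩ := exists_arcLength_inverse 𝔛 hA le_rfl hr₀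
  set W := arcLength 𝔛 A 1 r₀
  have hmono : StrictMonoOn W (Ioi 0) := strictMonoOn_of_hasDerivAt_pos
    (fun r hr => hasDerivAt_arcLength 𝔛 hA 1 hr₀ hr) fun r hr => radialSpeed_pos 𝔛 hA le_rfl hr
  have hbdd : BddBelow (W '' Ioi 0) :=
    ⟨_, by rintro _ ⟨r, hr, rfl⟩; exact arcLength_one_ge 𝔛 hA hr₀ hr⟩
  have hne : (W '' Ioi 0).Nonempty := ⟨W r₀, r₀, hr₀, rfl⟩
  -- The infimum of the arc length is finite and not attained, because `W` is strictly increasing.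
  -- The circles shrink to the origin at time `m / σ`, so `T = -m / σ`.
  set m := sInf (W '' Ioi 0)
  have hm : ∀ r, 0 < r → m < W r := fun r hr => by
    have h2 : 0 < r / 2 := by positivity
    exact (csInf_le hbdd ⟨r / 2, h2, rfl⟩).trans_lt (hmono h2 hr (by linarith))
  have hall : ∀ t, m < t → ∃ a, 0 < a ∧ W a < t := fun t ht => by
    obtain ⟨_, ⟨a, ha, rfl⟩, hat⟩ := exists_lt_of_csInf_lt hne ht
    exact ⟨a, ha, hat⟩
  have hm0 : m < 0 := by simpa [W, arcLength_self] using hm r₀ hr₀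
  have hT : ∀ t, t ∈ Ioi (-(-m / σ)) → m < σ * t := fun t ht => by
    have : m / σ < t := by simpa [neg_div] using ht
    rwa [div_lt_iff₀' hσ] at this
  refine ⟨-m / σ, div_pos (neg_pos.2 hm0) hσ, fun t => g (σ * t), by simpa using g0,
    isCircleGeodesic_of_hasDerivAt 𝔛 hA le_rfl fun t ht =>
      ⟨(hg _ (hall _ (hT t ht))).1, hasDerivAt_comp_speed (hg _ (hall _ (hT t ht))).2⟩, ?_,
    gtop.comp (tendsto_id.const_mul_atTop hσ)⟩
  rw [tendsto_order]
  refine ⟨fun b hb => ?_, fun b hb => ?_⟩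
  · filter_upwards [self_mem_nhdsWithin] with t ht
    exact hb.trans (hg _ (hall _ (hT t ht))).1
  · have hlt : -(-m / σ) < W b / σ := by
      rw [neg_div, neg_neg]
      exact div_lt_div_of_pos_right (hm b hb) hσ
    filter_upwards [Ioo_mem_nhdsGT hlt] with t ht
    obtain ⟨a, ha, hat⟩ := hall _ (hT t ht.1)
    exact hgt _ a b ha hat hb ((lt_div_iff₀' hσ).1 ht.2)

/-- Along any such parametrization `W ∘ r` has derivative `σ` or `-σ` at each time. The radius is
only assumed differentiable, so Darboux's theorem is what fixes the sign. Then `W ∘ r` is affine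
with nonzero slope on `ℝ`, contradicting the lower bound for `W`. -/
theorem not_exists_complete_geodesic (𝔛 : FieldClass) {A σ : ℝ} (hA : 0 < A) (hσ : 0 < σ) :
    ¬ ∃ r : ℝ → ℝ, IsCircleGeodesic 𝔛 A 1 σ univ r := by
  rintro ⟨r, hr⟩
  set W := arcLength 𝔛 A 1 1
  set φ' : ℝ → ℝ := fun t => deriv r t * radialSpeed 𝔛 A 1 (r t)
  have hφ : ∀ t, HasDerivAt (fun t => W (r t)) (φ' t) t := fun t => by
    obtain ⟨h0, hd, -⟩ := hr t trivial
    exact ((hasDerivAt_arcLength 𝔛 hA 1 one_pos h0).comp t hd.hasDerivAt).congr_deriv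
      (mul_comm _ _)
  have hsq : ∀ t, φ' t = σ ∨ φ' t = -σ := fun t => by
    obtain ⟨h0, hd, hs⟩ := hr t trivial
    rw [speedSq_circleCurve 𝔛 A 1 hd.hasDerivAt h0,
      ENNReal.ofReal_eq_ofReal_iff (sq_nonneg _) (sq_nonneg _)] at hs
    exact sq_eq_sq_iff_eq_or_eq_neg.1 hs
  have hconst : ∃ s, s ≠ 0 ∧ ∀ t, φ' t = s := by
    rcases hasDerivWithinAt_forall_lt_or_forall_gt_of_forall_ne convex_univ
      (fun t _ => (hφ t).hasDerivWithinAt) (m := 0) (fun t _ => by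
        rcases hsq t with h | h <;> rw [h] <;> simp [hσ.ne']) with h | h
    · exact ⟨-σ, by simpa using hσ.ne', fun t => (hsq t).resolve_left fun e => by
        linarith [h t trivial]⟩
    · exact ⟨σ, hσ.ne', fun t => (hsq t).resolve_right fun e => by linarith [h t trivial]⟩
  obtain ⟨s, hs0, hs⟩ := hconst
  have hlin : ∀ t, W (r t) - s * t = W (r 0) - s * 0 := fun t => by
    refine is_const_of_deriv_eq_zero (f := fun t => W (r t) - s * t) (fun x => ?_) (fun x => ?_) t 0
    · exact ((hφ x).sub ((hasDerivAt_id x).const_mul s)).differentiableAt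
    · have := ((hφ x).sub ((hasDerivAt_id x).const_mul s)).deriv
      rw [hs, mul_one, sub_self] at this
      exact this
  have hlow : ∀ t, -(1 * radialSpeed 𝔛 A 1 1) ≤ W (r t) := fun t =>
    arcLength_one_ge 𝔛 hA one_pos (hr t trivial).1
  -- The time at which the affine function would lie exactly 1 below the lower bound.
  have h1 := hlow ((-(1 * radialSpeed 𝔛 A 1 1) - W (r 0) - 1) / s)
  have h2 := hlin ((-(1 * radialSpeed 𝔛 A 1 1) - W (r 0) - 1) / s)
  rw [mul_div_cancel₀ _ hs0] at h2
  linarith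

end DiffMetric

end

theorem mainTheorem8 (𝔛 : FieldClass) (A : ℝ) (hA : 0 < A) :
    -- `n ≥ 2`: infinite length towards `r = 0` and `r = ∞`, and the constant speed
    -- parametrization exists for all times and runs through all the circles
    (∀ n : ℕ, 2 ≤ n →
      (∀ R : ℝ, 0 < R →
        pathLength 𝔛 A n circleCurve (Ioc 0 R) = ⊤ ∧
        pathLength 𝔛 A n circleCurve (Ici R) = ⊤) ∧
      (∀ σ r₀ : ℝ, 0 < σ → 0 < r₀ →
        ∃ r : ℝ → ℝ, r 0 = r₀ ∧ IsCircleGeodesic 𝔛 A n σ univ r ∧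
          Tendsto r atBot (𝓝 0) ∧ Tendsto r atTop atTop)) ∧
    -- `n = 1`: finite length towards `r = 0`, infinite length towards `r = ∞`
    (∀ R : ℝ, 0 < R →
      pathLength 𝔛 A 1 circleCurve (Ioc 0 R) < ⊤ ∧
      pathLength 𝔛 A 1 circleCurve (Ici R) = ⊤) ∧
    -- `n = 1`: the geodesic reaches `r = 0` in finite time, but needs infinite time for `r = ∞`
    (∀ σ r₀ : ℝ, 0 < σ → 0 < r₀ →
      (∃ T : ℝ, 0 < T ∧ ∃ r : ℝ → ℝ, r 0 = r₀ ∧ IsCircleGeodesic 𝔛 A 1 σ (Ioi (-T)) r ∧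
        Tendsto r (𝓝[>] (-T)) (𝓝 0) ∧ Tendsto r atTop atTop) ∧
      ¬ ∃ r : ℝ → ℝ, IsCircleGeodesic 𝔛 A 1 σ univ r) ∧
    -- `n = 1`: the explicit metric, on the tangent vector `v e^{iθ}` at the circle of radius `r`
    (∀ r v : ℝ, 0 < r →
      quotientMetric 𝔛 A 1 (circleCurve r) (fun θ => v • circleCurve 1 θ) =
        ENNReal.ofReal (2 * π * A * v ^ 2 / (besselI 1 (r / √A) * besselK 1 (r / √A)))) := by
  refine ⟨fun n hn => ⟨fun R hR => ⟨pathLength_Ioc 𝔛 hA hn hR, pathLength_Ici 𝔛 hA (by omega) hR⟩,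
    fun σ r₀ hσ hr₀ => exists_complete_geodesic 𝔛 hA hn hσ hr₀⟩,
    fun R hR => ⟨pathLength_one_Ioc 𝔛 hA, pathLength_Ici 𝔛 hA le_rfl hR⟩,
    fun σ r₀ hσ hr₀ => ⟨exists_incomplete_geodesic 𝔛 hA hσ hr₀,
      not_exists_complete_geodesic 𝔛 hA hσ⟩, fun r v hr => ?_⟩
  rw [quotientMetric_radial 𝔛 A 1 hr, circleMetric_one 𝔛 hA hr,
    ← ENNReal.ofReal_mul (sq_nonneg v), besselMetric]
  congr 1
  ring
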